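/- Let $m>n\ge 1$, let $X\subset\mathbb{R}^m$ and $Y\subset\mathbb{R}^n$ be open and bounded with $Y$ convex, let $c\in C^2(\bar X\times\bar Y)$, $V\in C^2(\bar Y)$, $W\in C^2(\bar Y\times\bar Y)$ with $W(y,z)=W(z,y)$ (here $C^2$ on the closure of an open set means $C^2$ inside, with the derivatives of order at most $2$ extending continuously to the closure; derivatives at boundary points are these extensions). Let $\mu$ be a probability measure on $X$ that is absolutely continuous with respect to Lebesgue measure, with density $\bar\mu$. Assume: (a) $c$ is twisted: for every $x\in X$ the map $y\mapsto D_xc(x,y)$ is injective on $Y$; and non-degenerate: the $m\times n$ matrix $D^2_{xy}c(x,y)$ has rank $n$ for all $(x,y)\in\bar X\times\bar Y$; (b) there is $C>0$ with $D^2_{yy}c(x,y)+D^2V(y)+D^2_{yy}W(y,z)\ge C\,\mathrm{Id}$ for all $x\in X$, $y,z\in Y$; (c) $[D_yc(x,y)+DV(y)+D_yW(y,z)]\cdot \mathbf n\ge 0$ for all $x\in X$, $z\in Y$, $y\in\partial Y$ and every outward unit normal $\mathbf n$ to $Y$ at $y$. Let $\nu$ be any minimizer of $$\nu\mapsto \mathcal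 T_c(\mu,\nu)+\int V\,d\nu+\frac12\iint W(y,z)\,d\nu(z)\,d\nu(y)$$ over the probability measures on $\bar Y$, where $\mathcal T_c(\mu,\nu)=\inf_\gamma\int c\,d\gamma$ is the infimum over all couplings $\gamma$ of $\mu$ and $\nu$. Then $\nu$ is absolutely continuous with respect to Lebesgue measure. Moreover, Kantorovich potentials $(u,v)$ exist, i.e. maximizers of $\int u\,d\mu+\int v\,d\nu$ among $u\in L^1(\mu)$, $v\in L^1(\nu)$ with $u(x)+v(y)\le c(x,y)$ on $\bar X\times\bar Y$ that satisfy $u(x)=\min_{y\in\bar Y}[c(x,y)-v(y)]$ on $\bar X$ and $v(y)=\min_{x\in\bar X}[c(x,y)-u(x)]$ on $\bar Y$. For every such pair, at Lebesgue almost every $y\in\operatorname{spt}(\nu)$ (in particular at $\nu$-almost every $y$) the function $v$ is differentiable and has a second-order Taylor expansion with symmetric Hessian $D^2v(y)$, and the density $\bar\nu$ of $\nu$ satisfies $$\bar\nu(y)=\int_{\{x\in X:\,D_yc(x,y)=Dv(y)\}}\frac{\det\big(D^2_{yy}c(x,y)-D^2v(y)\big)}{\sqrt{\big|\det\big(D^2_{yx}c\,D^2_{xy}c\big)(x,y)\big|}}\,\bar\mu(x)\,d\mathcal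 H^{m-n}(x),$$ the integral being absolutely convergent. -/

import Mathlib

open MeasureTheory Set Filter Topology Asymptotics
open scoped Matrix ENNReal

noncomputable section

/-- Euclidean space `ℝ^d`. -/
abbrev Euc (d : ℕ) : Type := EuclideanSpace ℝ (Fin d)

/-- `f ∈ C²(closure Ω)` for an open set `Ω`: `f` is continuous on the closure of `Ω`, is `C²` in
`Ω`, and its derivatives of order at most two extend continuously to the closure of `Ω`. -/
def IsC2UpToBoundary {E : Type*} [NormedAddCommGroup E] [NormedSpace ℝ E]
    (Ω : Set E) (f : E → ℝ) : Prop :=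
  ContinuousOn f (closure Ω) ∧ ContDiffOn ℝ 2 f Ω ∧
    ∀ k : ℕ, k ≤ 2 → ∀ p ∈ closure Ω, ∃ L, Tendsto (iteratedFDeriv ℝ k f) (𝓝[Ω] p) (𝓝 L)

/-- The Hessian matrix `D²f(y)`. -/
def hessianMatrix {n : ℕ} (f : Euc n → ℝ) (y : Euc n) : Matrix (Fin n) (Fin n) ℝ :=
  Matrix.of fun i j =>
    fderiv ℝ (fun y' => fderiv ℝ f y' (EuclideanSpace.single j 1)) y (EuclideanSpace.single i 1)

/-- The `m × n` matrix `D²_{xy} c(x, y)` of mixed second derivatives. -/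
def mixedHessian {m n : ℕ} (c : Euc m → Euc n → ℝ) (x : Euc m) (y : Euc n) :
    Matrix (Fin m) (Fin n) ℝ :=
  Matrix.of fun i j =>
    fderiv ℝ (fun x' => fderiv ℝ (fun y' => c x' y') y (EuclideanSpace.single j 1)) x
      (EuclideanSpace.single i 1)

/-- The twist condition: for each `x ∈ X`, the map `y ↦ D_x c(x, y)` is injective on `Y`. -/
def IsTwisted {m n : ℕ} (X : Set (Euc m)) (Y : Set (Euc n)) (c : Euc m → Euc n → ℝ) : Prop :=
  ∀ x ∈ X, InjOn (fun y => gradient (fun x' => c x' y) x) Y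

/-- Non-degeneracy: `D²_{xy} c` (extended continuously from `X × Y`) has rank `n` at every point of
`closure X × closure Y`. Used for `n < m`, where this is the full rank. -/
def IsNondegenerate {m n : ℕ} (X : Set (Euc m)) (Y : Set (Euc n)) (c : Euc m → Euc n → ℝ) : Prop :=
  ∀ x ∈ closure X, ∀ y ∈ closure Y,
    (extendFrom (X ×ˢ Y) (fun p : Euc m × Euc n => mixedHessian c p.1 p.2) (x, y)).rank = n

/-- Uniform convexity of `y ↦ c(x, y) + V(y) + W(y, z)` on `Y`, uniformly in `x ∈ X`, `z ∈ Y`. -/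
def IsUniformlyConvexSum {m n : ℕ} (X : Set (Euc m)) (Y : Set (Euc n)) (c : Euc m → Euc n → ℝ)
    (V : Euc n → ℝ) (W : Euc n → Euc n → ℝ) : Prop :=
  ∃ C : ℝ, 0 < C ∧ ∀ x ∈ X, ∀ y ∈ Y, ∀ z ∈ Y,
    (hessianMatrix (fun y' => c x y') y + hessianMatrix V y + hessianMatrix (fun y' => W y' z) y
      - C • (1 : Matrix (Fin n) (Fin n) ℝ)).PosSemidef

/-- `e` is an outward unit normal to the convex set `Y` at `y` (the unique one at every boundary
point where the boundary is differentiable). -/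
def IsOutwardUnitNormal {n : ℕ} (Y : Set (Euc n)) (y e : Euc n) : Prop :=
  ‖e‖ = 1 ∧ ∀ y' ∈ Y, inner ℝ e (y' - y) ≤ 0

/-- The outward gradient condition
`[D_y c(x, y) + DV(y) + D_y W(y, z)] · n_Y(y) ≥ 0` for `x ∈ X`, `z ∈ Y`, `y ∈ ∂Y`;
the gradient at `y ∈ ∂Y` is the continuous extension of the gradient in `Y`. -/
def HasOutwardGradient {m n : ℕ} (X : Set (Euc m)) (Y : Set (Euc n)) (c : Euc m → Euc n → ℝ)
    (V : Euc n → ℝ) (W : Euc n → Euc n → ℝ) : Prop :=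
  ∀ x ∈ X, ∀ z ∈ Y, ∀ y ∈ frontier Y, ∀ e, IsOutwardUnitNormal Y y e →
    0 ≤ inner ℝ
      (extendFrom Y (fun w => gradient (fun y' => c x y') w + gradient V w
        + gradient (fun y' => W y' z) w) y) e

/-- `ν` is a (Borel) probability measure on the set `S`. -/
def IsProbabilityOn {d : ℕ} (S : Set (Euc d)) (ν : Measure (Euc d)) : Prop :=
  IsProbabilityMeasure ν ∧ ν Sᶜ = 0

/-- The optimal transport cost `T_c(μ, ν)`: the infimum of `∫ c dγ` over all couplings `γ`. -/
def transportCost {m n : ℕ} (c : Euc m → Euc n → ℝ) (μ : Measure (Euc m)) (ν : Measure (Euc n)) :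
    ℝ :=
  sInf ((fun γ : Measure (Euc m × Euc n) => ∫ p, c p.1 p.2 ∂γ) '' {γ | γ.fst = μ ∧ γ.snd = ν})

/-- `T_c(μ, ν) + ∫ V dν + (1/2) ∬ W dν dν`. -/
def interactionFunctional {m n : ℕ} (c : Euc m → Euc n → ℝ) (V : Euc n → ℝ)
    (W : Euc n → Euc n → ℝ) (μ : Measure (Euc m)) (ν : Measure (Euc n)) : ℝ :=
  transportCost c μ ν + ∫ y, V y ∂ν + (1 / 2) * ∫ y, ∫ z, W y z ∂ν ∂ν

/-- `ν` minimizes the interaction functional among the probability measures on `closure Y`. -/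
def IsInteractionMinimizer {m n : ℕ} (Y : Set (Euc n)) (c : Euc m → Euc n → ℝ) (V : Euc n → ℝ)
    (W : Euc n → Euc n → ℝ) (μ : Measure (Euc m)) (ν : Measure (Euc n)) : Prop :=
  IsProbabilityOn (closure Y) ν ∧ ∀ ν' : Measure (Euc n), IsProbabilityOn (closure Y) ν' →
    interactionFunctional c V W μ ν ≤ interactionFunctional c V W μ ν'

/-- Admissible pairs of the dual problem: `u ∈ L¹(μ)`, `v ∈ L¹(ν)` and `u(x) + v(y) ≤ c(x, y)`. -/
def IsDualAdmissible {m n : ℕ} (X : Set (Euc m)) (Y : Set (Euc n)) (c : Euc m → Euc n → ℝ)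
    (μ : Measure (Euc m)) (ν : Measure (Euc n)) (u : Euc m → ℝ) (v : Euc n → ℝ) : Prop :=
  Integrable u μ ∧ Integrable v ν ∧ ∀ x ∈ closure X, ∀ y ∈ closure Y, u x + v y ≤ c x y

/-- `(u, v)` is a pair of Kantorovich potentials: a solution of the dual problem which is
`c`-conjugate, that is `u(x) = min_y [c(x, y) - v(y)]` and `v(y) = min_x [c(x, y) - u(x)]`. -/
def IsKantorovichPair {m n : ℕ} (X : Set (Euc m)) (Y : Set (Euc n)) (c : Euc m → Euc n → ℝ)
    (μ : Measure (Euc m)) (ν : Measure (Euc n)) (u : Euc m → ℝ) (v : Euc n → ℝ) : Prop :=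
  IsDualAdmissible X Y c μ ν u v ∧
  (∀ u' v', IsDualAdmissible X Y c μ ν u' v' →
    ∫ x, u' x ∂μ + ∫ y, v' y ∂ν ≤ ∫ x, u x ∂μ + ∫ y, v y ∂ν) ∧
  (∀ x ∈ closure X, IsLeast ((fun y => c x y - v y) '' closure Y) (u x)) ∧
  (∀ y ∈ closure Y, IsLeast ((fun x => c x y - u x) '' closure X) (v y))

/-- `v` is twice differentiable at `y` in the sense of Alexandrov, with Hessian `D²v(y) = A`: `v` is
differentiable at `y`, `A` is symmetric and
`v(y + h) = v(y) + Dv(y) · h + (1/2) h · A h + o(|h|²)`. This determines `A`. -/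
def HasHessianAt {n : ℕ} (v : Euc n → ℝ) (y : Euc n) (A : Matrix (Fin n) (Fin n) ℝ) : Prop :=
  DifferentiableAt ℝ v y ∧ A.IsSymm ∧
    (fun h : Euc n => v (y + h) - v y - inner ℝ (gradient v y) h
      - (1 / 2) * ∑ i, ∑ j, A i j * h i * h j) =o[𝓝 0] fun h : Euc n => ‖h‖ ^ 2

/-- The set `X_=(y, p) = {x ∈ X : D_y c(x, y) = p}`. -/
def levelSet {m n : ℕ} (X : Set (Euc m)) (c : Euc m → Euc n → ℝ) (y p : Euc n) : Set (Euc m) :=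
  {x | x ∈ X ∧ gradient (fun y' => c x y') y = p}

/-- The integrand of the Monge–Ampère type equation,
`det(D²_{yy}c(x, y) - A) / √|det(D²_{yx}c D²_{xy}c)(x, y)| · dμ/dx(x)`. -/
def mongeAmpereIntegrand {m n : ℕ} (c : Euc m → Euc n → ℝ) (μ : Measure (Euc m)) (y : Euc n)
    (A : Matrix (Fin n) (Fin n) ℝ) (x : Euc m) : ℝ :=
  (hessianMatrix (fun y' => c x y') y - A).det
    / Real.sqrt |((mixedHessian c x y)ᵀ * mixedHessian c x y).det|
    * (μ.rnDeriv volume x).toReal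

/-- The local Monge–Ampère type equation at `y`: `v` is twice differentiable at `y`, the integral
exists and
`dν/dy(y) = ∫_{X_=(y, Dv(y))} det(D²_{yy}c - D²v(y)) / √|det(D²_{yx}c D²_{xy}c)| dμ/dx d𝓗^{m-n}`.
Here `μHE[m - n]` is the Hausdorff measure in its usual normalization, in which it agrees with
Lebesgue measure on `ℝ^{m-n}`. -/
def SatisfiesLocalMongeAmpereAt {m n : ℕ} (X : Set (Euc m)) (c : Euc m → Euc n → ℝ)
    (μ : Measure (Euc m)) (ν : Measure (Euc n)) (v : Euc n → ℝ) (y : Euc n) : Prop :=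
  ∃ A : Matrix (Fin n) (Fin n) ℝ, HasHessianAt v y A ∧
    IntegrableOn (mongeAmpereIntegrand c μ y A) (levelSet X c y (gradient v y)) μHE[m - n] ∧
    (ν.rnDeriv volume y).toReal =
      ∫ x in levelSet X c y (gradient v y), mongeAmpereIntegrand c μ y A x ∂μHE[m - n]

end

/-! Write R for `meanField V W ν`, that is V + ∫ W(z, ·) dν(z). For each x the function c(x, ·) + R
is strongly convex on the closure of Y, and the outward gradient condition excludes a nonzero
gradient at a minimizer, even on the boundary. Hence the minimizer T x is the unique solution of D_y
c(x, y) + DR(y) = 0, and T is continuous (`exists_isConvexLandscape`, `gradient_eq_zero_of_isMin`,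
`exists_argmin`). Moving mass from ν towards T_# μ does not lower the functional. To first order
this says that a nearly optimal coupling of μ and ν is nearly optimal for c + R as well, so by
strong convexity it lies L²-close to the graph of T; therefore ν = T_# μ (`first_variation`,
`minimizer_eq_map`).

For absolute continuity, subtract the equations of T at two points. The variation of D_y c in x is
controlled by the variation of T, and by the rank condition it controls n directions of x. A linear
map L into ℝ^(m-n) takes care of the others, so x ↦ (T x, L x) has locally a Lipschitz inverse and T
pulls null sets back to null sets (`volume_inter_preimage_eq_zero`). In particular ν does not charge
the frontier of the convex set Y. Then DR is C¹ in Y, and the implicit function theorem makes T a C¹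
submersion wherever T x ∈ Y. The coarea formula (`lintegral_coarea`, built here from the area
formula) writes the density of T_# μ as an integral over the fibres of T. Those fibres are the level
sets of D_y c(·, y), and the Jacobian of T is the ratio of determinants in the equation
(`normDet_adjoint_fderiv_argmin`).

It remains to replace -R by an arbitrary potential v. Duality gives u(x) + v(T x) = c(x, T x) almost
everywhere, so φ = v + R is touched from above by a parabola with horizontal tangent at every point
of the support in Y; φ is also semiconcave. At a density point of the support such a function is
constant up to second order: a path through N intermediate points of the support accumulates N
quadratic errors of relative size 1/N², hence a total of order 1/N (`isLittleO_sq_of_density`). Thus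
v has the second-order expansion of -R almost everywhere on the support, and the equation found for
-R becomes the equation for v. -/

/-! ### Localization and comparison of Hausdorff measures -/

/-- A property of sets which is inherited by subsets, holds for the empty set and holds locally on
`O`, holds for all members of a suitable countable measurable partition of `O`. -/
theorem exists_measurable_partition_of_local {α : Type*} [TopologicalSpace α]
    [SecondCountableTopology α] [MeasurableSpace α] [OpensMeasurableSpace α] {O : Set α}
    (hO : IsOpen O) (P : Set α → Prop) (h_empty : P ∅) (hmono : ∀ s t, s ⊆ t → P t → P s)
    (hloc : ∀ x ∈ O, ∃ N ∈ 𝓝 x, P N) :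
    ∃ D : ℕ → Set α, (∀ i, MeasurableSet (D i)) ∧ Pairwise (Function.onFun Disjoint D) ∧
      ⋃ i, D i = O ∧ ∀ i, P (D i) := by
  have h1 : ∀ x ∈ O, ∃ N, x ∈ N ∧ IsOpen N ∧ N ⊆ O ∧ P N := by
    intro x hx
    obtain ⟨N, hN, hP⟩ := hloc x hx
    obtain ⟨M, hM, hMo, hxM⟩ := mem_nhds_iff.1 (inter_mem hN (hO.mem_nhds hx))
    exact ⟨M, hxM, hMo, hM.trans inter_subset_right, hmono _ _ (hM.trans inter_subset_left) hP⟩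
  choose! N hxN hNo hNO hNP using h1
  obtain ⟨t, htO, htc, hcov⟩ := TopologicalSpace.countable_cover_nhdsWithin (f := N) (s := O)
    (fun x hx => mem_nhdsWithin_of_mem_nhds ((hNo x hx).mem_nhds (hxN x hx)))
  rcases t.eq_empty_or_nonempty with rfl | hne
  · have : O = ∅ := by simpa using hcov
    exact ⟨fun _ => ∅, fun _ => MeasurableSet.empty, fun i j _ => by simp [Function.onFun],
      by simp [this], fun _ => h_empty⟩
  · obtain ⟨g, rfl⟩ := htc.exists_eq_range hne
    have hg : ∀ i, g i ∈ O := fun i => htO (mem_range_self i)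
    refine ⟨disjointed (fun i => N (g i)), MeasurableSet.disjointed
      (fun i => (hNo _ (hg i)).measurableSet), disjoint_disjointed _, ?_, fun i =>
      hmono _ _ (disjointed_subset _ i) (hNP _ (hg i))⟩
    rw [iUnion_disjointed]
    refine Subset.antisymm (iUnion_subset fun i => hNO _ (hg i)) ?_
    simpa using hcov

/-- The hypothesis makes f factor on s as F ∘ g with F K-Lipschitz on g '' s; no injectivity is
needed. It serves to compare a map with its linearization, and a set with its image under a map with
Lipschitz inverse. -/
theorem euclideanHausdorffMeasure_image_le_of_edist_le {α β γ : Type*} [EMetricSpace β]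
    [EMetricSpace γ] [MeasurableSpace β] [BorelSpace β] [MeasurableSpace γ] [BorelSpace γ]
    {f : α → β} {g : α → γ} {s : Set α} {K : NNReal} (d : ℕ)
    (h : ∀ a ∈ s, ∀ b ∈ s, edist (f a) (f b) ≤ K * edist (g a) (g b)) :
    μHE[d] (f '' s) ≤ (K : ℝ≥0∞) ^ d * μHE[d] (g '' s) := by
  rcases s.eq_empty_or_nonempty with rfl | ⟨a₀, ha₀⟩
  · simp
  have : Nonempty α := ⟨a₀⟩
  set F : γ → β := fun y => f (Function.invFunOn g s y)
  have hF : ∀ a ∈ s, F (g a) = f a := by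
    intro a ha
    have hex : ∃ b ∈ s, g b = g a := ⟨a, ha, rfl⟩
    have h1 := Function.invFunOn_mem hex
    have h2 := Function.invFunOn_eq hex
    have := h _ h1 a ha
    rw [h2] at this
    simpa [F] using this
  have himg : f '' s = F '' (g '' s) := by
    rw [image_image]
    exact image_congr fun a ha => (hF a ha).symm
  have hL : LipschitzOnWith K F (g '' s) := by
    rintro _ ⟨a, ha, rfl⟩ _ ⟨b, hb, rfl⟩
    rw [hF a ha, hF b hb]
    exact h a ha b hb
  have := hL.hausdorffMeasure_image_le (d := (d : ℝ)) (by positivity)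
  rw [← himg] at this
  simp only [Measure.euclideanHausdorffMeasure_def, Measure.smul_apply, ENNReal.smul_def,
    smul_eq_mul]
  calc _ ≤ _ := mul_le_mul_right this _
    _ = _ := by rw [ENNReal.rpow_natCast]; ring

/-! ### The area formula for injective immersions -/

section NormDet

variable {U V : Type*} [NormedAddCommGroup U] [InnerProductSpace ℝ U] [FiniteDimensional ℝ U]
  [NormedAddCommGroup V] [InnerProductSpace ℝ V] [FiniteDimensional ℝ V]

theorem LinearMap.normDet_pos_of_injective {f : U →ₗ[ℝ] V} (hf : Function.Injective f) :
    0 < f.normDet :=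
  lt_of_le_of_ne f.normDet_nonneg fun h =>
    (LinearMap.normDet_eq_zero_iff_ker_ne_bot.1 h.symm) (LinearMap.ker_eq_bot.2 hf)

theorem ContinuousLinearMap.normDet_eq_sqrt (f : U →L[ℝ] V) :
    (f : U →ₗ[ℝ] V).normDet =
      Real.sqrt (((ContinuousLinearMap.adjoint f).comp f).det) := by
  have h := f.normDet_sq
  rw [← Real.sqrt_sq (LinearMap.normDet_nonneg (f : U →ₗ[ℝ] V))]
  congr 1

theorem ContinuousLinearMap.continuous_normDet :
    Continuous fun f : U →L[ℝ] V => (f : U →ₗ[ℝ] V).normDet := by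
  simp_rw [ContinuousLinearMap.normDet_eq_sqrt]
  refine Real.continuous_sqrt.comp (ContinuousLinearMap.continuous_det.comp ?_)
  exact (ContinuousLinearMap.adjoint.continuous).clm_comp continuous_id

variable [MeasurableSpace U] [BorelSpace U] [MeasurableSpace V] [BorelSpace V]

/-- An injective linear map is bounded below, so the small error in strict differentiability is a
small fraction of ‖L(a - b)‖. -/
theorem exists_nhds_edist_comparison {φ : U → V} {L : U →L[ℝ] V} {x₀ : U}
    (hφ : HasStrictFDerivAt φ L x₀) (hL : Function.Injective L) {K : NNReal} (hK : 1 < K) :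
    ∃ N ∈ 𝓝 x₀, ∀ a ∈ N, ∀ b ∈ N, edist (φ a) (φ b) ≤ K * edist (L a) (L b) ∧
      edist (L a) (L b) ≤ K * edist (φ a) (φ b) := by
  obtain ⟨C, hC, hanti⟩ := (LinearMap.injective_iff_antilipschitz (L : U →ₗ[ℝ] V)).1 hL
  have hK' : (1 : ℝ) < K := by exact_mod_cast hK
  have hC' : (0 : ℝ) < C := by exact_mod_cast hC
  -- With this choice the error is at most (1 - 1/K)‖L(a - b)‖. The lower bound then has the factor
  -- 1/K, and the upper one the factor 2 - 1/K, which is at most K.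
  set η : ℝ := (1 - (K : ℝ)⁻¹) / C with hη
  have hKinv : (K : ℝ)⁻¹ < 1 := inv_lt_one_of_one_lt₀ hK'
  have hη0 : 0 < η := div_pos (by linarith) hC'
  obtain ⟨N, hN, happ⟩ := hφ.approximates_deriv_on_nhds (c := ⟨η, hη0.le⟩) (Or.inr hη0)
  refine ⟨N, hN, fun a ha b hb => ?_⟩
  have h1 : ‖φ a - φ b - L (a - b)‖ ≤ η * ‖a - b‖ := happ a ha b hb
  have h2 : ‖a - b‖ ≤ C * ‖L (a - b)‖ := by
    have := hanti.le_mul_dist a b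
    simpa [dist_eq_norm, map_sub] using this
  have h3 : ‖φ a - φ b - L (a - b)‖ ≤ (1 - (K : ℝ)⁻¹) * ‖L (a - b)‖ := by
    refine h1.trans ?_
    calc η * ‖a - b‖ ≤ η * (C * ‖L (a - b)‖) := by gcongr
      _ = _ := by rw [hη]; field_simp
  have h4 : ‖φ a - φ b‖ ≤ ‖L (a - b)‖ + (1 - (K : ℝ)⁻¹) * ‖L (a - b)‖ := by
    calc ‖φ a - φ b‖ = ‖L (a - b) + (φ a - φ b - L (a - b))‖ := by congr 1; abel
      _ ≤ _ := (norm_add_le _ _).trans (by gcongr)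
  have h5 : ‖L (a - b)‖ ≤ ‖φ a - φ b‖ + (1 - (K : ℝ)⁻¹) * ‖L (a - b)‖ := by
    calc ‖L (a - b)‖ = ‖(φ a - φ b) - (φ a - φ b - L (a - b))‖ := by congr 1; abel
      _ ≤ _ := (norm_sub_le _ _).trans (by gcongr)
  have hKK : (K : ℝ) * (K : ℝ)⁻¹ = 1 := mul_inv_cancel₀ (by positivity)
  have hn := norm_nonneg (L (a - b))
  have h6 : 2 - (K : ℝ)⁻¹ ≤ K := by nlinarith [sq_nonneg ((K : ℝ) - 1)]
  constructor
  · rw [edist_dist, edist_dist, ← ENNReal.ofReal_coe_nnreal, ← ENNReal.ofReal_mul (by positivity)]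
    refine ENNReal.ofReal_le_ofReal ?_
    rw [dist_eq_norm, dist_eq_norm, ← map_sub]
    nlinarith
  · rw [edist_dist, edist_dist, ← ENNReal.ofReal_coe_nnreal, ← ENNReal.ofReal_mul (by positivity)]
    refine ENNReal.ofReal_le_ofReal ?_
    rw [dist_eq_norm, dist_eq_norm, ← map_sub]
    have : (K : ℝ)⁻¹ * ‖L (a - b)‖ ≤ ‖φ a - φ b‖ := by linarith
    calc ‖L (a - b)‖ = K * ((K : ℝ)⁻¹ * ‖L (a - b)‖) := by rw [← mul_assoc, hKK, one_mul]
      _ ≤ _ := by gcongr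

/-- Freezing the derivative at x₀ costs a factor K^d for the Hausdorff measure and one more factor K
for replacing the Jacobian by its value at x₀. For the frozen linear map the formula is exact. -/
theorem exists_nhds_measure_image_comparison {φ : U → V} {O : Set U} (hO : IsOpen O)
    (hφ : ContDiffOn ℝ 1 φ O) (hinj : ∀ x ∈ O, Function.Injective (fderiv ℝ φ x)) {x₀ : U}
    (hx₀ : x₀ ∈ O) {K : NNReal} (hK : 1 < K) :
    ∃ N ∈ 𝓝 x₀, ∀ A ⊆ N, MeasurableSet A →
      μHE[Module.finrank ℝ U] (φ '' A) ≤ (K : ℝ≥0∞) ^ (Module.finrank ℝ U + 1) *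
        ∫⁻ x in A, ENNReal.ofReal (fderiv ℝ φ x : U →ₗ[ℝ] V).normDet ∧
      ∫⁻ x in A, ENNReal.ofReal (fderiv ℝ φ x : U →ₗ[ℝ] V).normDet ≤
        (K : ℝ≥0∞) ^ (Module.finrank ℝ U + 1) * μHE[Module.finrank ℝ U] (φ '' A) := by
  set J : U → ℝ := fun x => (fderiv ℝ φ x : U →ₗ[ℝ] V).normDet
  have hcd : ContDiffAt ℝ 1 φ x₀ := hφ.contDiffAt (hO.mem_nhds hx₀)
  obtain ⟨N₁, hN₁, hdist⟩ := exists_nhds_edist_comparison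
    (hcd.hasStrictFDerivAt one_ne_zero) (hinj x₀ hx₀) hK
  have hJ0 : 0 < J x₀ := LinearMap.normDet_pos_of_injective (hinj x₀ hx₀)
  have hJc : ContinuousAt J x₀ :=
    ContinuousLinearMap.continuous_normDet.continuousAt.comp
      ((hcd.fderiv_right (m := 0) (by simp)).continuousAt)
  have hK' : (1 : ℝ) < K := by exact_mod_cast hK
  have hev : ∀ᶠ x in 𝓝 x₀, J x < K * J x₀ ∧ J x₀ < K * J x := by
    refine (hJc.eventually_lt continuousAt_const (by nlinarith)).and
      (continuousAt_const.eventually_lt (hJc.const_mul _) (by nlinarith))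
  refine ⟨N₁ ∩ {x | J x < K * J x₀ ∧ J x₀ < K * J x}, inter_mem hN₁ hev, fun A hA hAm => ?_⟩
  set d := Module.finrank ℝ U
  set L := fderiv ℝ φ x₀
  have hLA : μHE[d] (L '' A) = ENNReal.ofReal (J x₀) * volume A :=
    (L : U →ₗ[ℝ] V).euclideanHausdorffMeasure_image_eq_normDet_mul_volume A
  have e1 : μHE[d] (φ '' A) ≤ (K : ℝ≥0∞) ^ d * μHE[d] (L '' A) :=
    euclideanHausdorffMeasure_image_le_of_edist_le d
      fun a ha b hb => (hdist a (hA ha).1 b (hA hb).1).1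
  have e2 : μHE[d] (L '' A) ≤ (K : ℝ≥0∞) ^ d * μHE[d] (φ '' A) :=
    euclideanHausdorffMeasure_image_le_of_edist_le d
      fun a ha b hb => (hdist a (hA ha).1 b (hA hb).1).2
  have hofK : ∀ r : ℝ, ENNReal.ofReal (K * r) = K * ENNReal.ofReal r := fun r => by
    rw [ENNReal.ofReal_mul (by positivity), ENNReal.ofReal_coe_nnreal]
  have f1 : ENNReal.ofReal (J x₀) * volume A ≤ K * ∫⁻ x in A, ENNReal.ofReal (J x) := by
    rw [← lintegral_const_mul' _ _ ENNReal.coe_ne_top, ← setLIntegral_const]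
    refine setLIntegral_mono' hAm fun x hx => ?_
    rw [← hofK]
    exact ENNReal.ofReal_le_ofReal (hA hx).2.2.le
  have f2 : ∫⁻ x in A, ENNReal.ofReal (J x) ≤ K * (ENNReal.ofReal (J x₀) * volume A) := by
    rw [← mul_assoc, ← setLIntegral_const]
    refine setLIntegral_mono' hAm fun x hx => ?_
    rw [← hofK]
    exact ENNReal.ofReal_le_ofReal (hA hx).2.1.le
  constructor
  · calc μHE[d] (φ '' A) ≤ (K : ℝ≥0∞) ^ d * (ENNReal.ofReal (J x₀) * volume A) := hLA ▸ e1
      _ ≤ (K : ℝ≥0∞) ^ d * (K * ∫⁻ x in A, ENNReal.ofReal (J x)) := by gcongr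
      _ = _ := by ring
  · calc _ ≤ _ := f2
      _ ≤ K * ((K : ℝ≥0∞) ^ d * μHE[d] (φ '' A)) := by rw [← hLA]; gcongr
      _ = _ := by ring

/-- The area formula for injective `C¹` immersions. -/
theorem euclideanHausdorffMeasure_image_eq_lintegral_normDet {φ : U → V} {O : Set U}
    (hO : IsOpen O) (hφ : ContDiffOn ℝ 1 φ O)
    (hinj : ∀ x ∈ O, Function.Injective (fderiv ℝ φ x)) (hφi : InjOn φ O) {A : Set U}
    (hA : MeasurableSet A) (hAO : A ⊆ O) :
    μHE[Module.finrank ℝ U] (φ '' A) =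
      ∫⁻ x in A, ENNReal.ofReal (fderiv ℝ φ x : U →ₗ[ℝ] V).normDet := by
  set d := Module.finrank ℝ U
  set I := ∫⁻ x in A, ENNReal.ofReal (fderiv ℝ φ x : U →ₗ[ℝ] V).normDet
  have key : ∀ K : NNReal, 1 < K → μHE[d] (φ '' A) ≤ (K : ℝ≥0∞) ^ (d + 1) * I ∧
      I ≤ (K : ℝ≥0∞) ^ (d + 1) * μHE[d] (φ '' A) := by
    intro K hK
    obtain ⟨D, hDm, hDd, hDO, hDP⟩ := exists_measurable_partition_of_local hO
      (fun N => ∀ A ⊆ N, MeasurableSet A →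
      μHE[d] (φ '' A) ≤ (K : ℝ≥0∞) ^ (d + 1) *
        ∫⁻ x in A, ENNReal.ofReal (fderiv ℝ φ x : U →ₗ[ℝ] V).normDet ∧
      ∫⁻ x in A, ENNReal.ofReal (fderiv ℝ φ x : U →ₗ[ℝ] V).normDet ≤
        (K : ℝ≥0∞) ^ (d + 1) * μHE[d] (φ '' A))
      (fun A hA _ => by simp [subset_empty_iff.1 hA])
      (fun s t hst ht A hA => ht A (hA.trans hst))
      (fun x hx => exists_nhds_measure_image_comparison hO hφ hinj hx hK)
    have hAU : A = ⋃ i, A ∩ D i := by rw [← inter_iUnion, hDO, inter_eq_left.2 hAO]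
    have hm : ∀ i, MeasurableSet (A ∩ D i) := fun i => hA.inter (hDm i)
    have hdisj : Pairwise (Function.onFun Disjoint fun i => A ∩ D i) := fun i j hij =>
      (hDd hij).mono inter_subset_right inter_subset_right
    have hI : I = ∑' i, ∫⁻ x in A ∩ D i, ENNReal.ofReal (fderiv ℝ φ x : U →ₗ[ℝ] V).normDet := by
      rw [← lintegral_iUnion hm hdisj, ← hAU]
    have hμ : μHE[d] (φ '' A) = ∑' i, μHE[d] (φ '' (A ∩ D i)) := by
      conv_lhs => rw [hAU, image_iUnion]
      refine measure_iUnion (fun i j hij => ?_) fun i => ?_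
      · exact (hdisj hij).image hφi (inter_subset_left.trans hAO) (inter_subset_left.trans hAO)
      · exact (hm i).image_of_continuousOn_injOn
          (hφ.continuousOn.mono (inter_subset_left.trans hAO))
          (hφi.mono (inter_subset_left.trans hAO))
    rw [hI, hμ, ← ENNReal.tsum_mul_left, ← ENNReal.tsum_mul_left]
    exact ⟨ENNReal.tsum_le_tsum fun i => (hDP i _ inter_subset_right (hm i)).1,
      ENNReal.tsum_le_tsum fun i => (hDP i _ inter_subset_right (hm i)).2⟩
  -- The exponent does not depend on K, so the distortion disappears as K decreases to 1.
  have lim : ∀ a b : ℝ≥0∞, (∀ K : NNReal, 1 < K → a ≤ (K : ℝ≥0∞) ^ (d + 1) * b) → a ≤ b := by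
    intro a b h
    have ht : Tendsto (fun K : NNReal => (K : ℝ≥0∞) ^ (d + 1) * b) (𝓝[>] 1)
        (𝓝 (((1 : NNReal) : ℝ≥0∞) ^ (d + 1) * b)) := by
      refine ENNReal.Tendsto.mul_const ?_ (Or.inl (by simp))
      refine ((ENNReal.continuous_pow _).tendsto _).comp ?_
      exact (ENNReal.continuous_coe.tendsto _).mono_left nhdsWithin_le_nhds
    simp only [ENNReal.coe_one, one_pow, one_mul] at ht
    exact ge_of_tendsto ht (eventually_mem_nhdsWithin.mono fun K hK => h K hK)
  exact le_antisymm (lim _ _ fun K hK => (key K hK).1) (lim _ _ fun K hK => (key K hK).2)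

/-- The area formula for sets identifies the Hausdorff measure on the image with the push-forward of
the Jacobian density; integrating f against both sides gives the formula. -/
theorem lintegral_image_eq_lintegral_normDet_mul {φ : U → V} {O : Set U}
    (hO : IsOpen O) (hφ : ContDiffOn ℝ 1 φ O)
    (hinj : ∀ x ∈ O, Function.Injective (fderiv ℝ φ x)) (hφi : InjOn φ O) {f : V → ℝ≥0∞}
    (hf : Measurable f) :
    ∫⁻ x in φ '' O, f x ∂μHE[Module.finrank ℝ U] =
      ∫⁻ z in O, ENNReal.ofReal (fderiv ℝ φ z : U →ₗ[ℝ] V).normDet * f (φ z) := by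
  set J : U → ℝ≥0∞ := fun x => ENNReal.ofReal (fderiv ℝ φ x : U →ₗ[ℝ] V).normDet
  have hJ : Measurable J := (ContinuousLinearMap.continuous_normDet.measurable.comp
    (measurable_fderiv ℝ φ)).ennreal_ofReal
  classical
  -- Outside O the map φ need not be measurable; the junk value 0 is never seen by the restricted
  -- measure.
  set g : U → V := O.piecewise φ fun _ => 0
  have hg : Measurable g := hφ.continuousOn.measurable_piecewise continuousOn_const hO.measurableSet
  have hgO : ∀ x ∈ O, g x = φ x := fun x hx => piecewise_eq_of_mem _ _ _ hx
  have heq : (μHE[Module.finrank ℝ U] : Measure V).restrict (φ '' O) =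
      ((volume.restrict O).withDensity J).map g := by
    ext s hs
    have hpre : MeasurableSet (g ⁻¹' s ∩ O) := (hg hs).inter hO.measurableSet
    have himg : s ∩ φ '' O = φ '' (g ⁻¹' s ∩ O) := by
      ext y
      constructor
      · rintro ⟨hy, x, hx, rfl⟩
        exact ⟨x, ⟨by rwa [mem_preimage, hgO x hx], hx⟩, rfl⟩
      · rintro ⟨x, ⟨hxs, hx⟩, rfl⟩
        exact ⟨by rwa [mem_preimage, hgO x hx] at hxs, x, hx, rfl⟩
    rw [Measure.restrict_apply hs, Measure.map_apply hg hs, himg,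
      euclideanHausdorffMeasure_image_eq_lintegral_normDet hO hφ hinj hφi hpre inter_subset_right,
      withDensity_apply _ (hg hs), Measure.restrict_restrict (hg hs)]
  rw [heq, lintegral_map hf hg]
  refine (lintegral_withDensity_eq_lintegral_mul (volume.restrict O) hJ (hf.comp hg)).trans ?_
  refine setLIntegral_congr_fun hO.measurableSet fun x hx => ?_
  simp [J, hgO x hx]

end NormDet

/-! ### Linear algebra of the coarea factor -/

section Coarea

variable {E F K : Type*} [NormedAddCommGroup E] [InnerProductSpace ℝ E] [FiniteDimensional ℝ E]
  [NormedAddCommGroup F] [InnerProductSpace ℝ F] [FiniteDimensional ℝ F]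
  [NormedAddCommGroup K] [InnerProductSpace ℝ K] [FiniteDimensional ℝ K]

/-- The continuous linear equivalence underlying a linear isometry from the `L²` product. -/
noncomputable def prodEquivOfIsometry (ι : WithLp 2 (F × K) ≃ₗᵢ[ℝ] E) : (F × K) ≃L[ℝ] E :=
  (WithLp.prodContinuousLinearEquiv 2 ℝ F K).symm.trans ι.toContinuousLinearEquiv

theorem prodEquivOfIsometry_apply (ι : WithLp 2 (F × K) ≃ₗᵢ[ℝ] E) (p : F × K) :
    prodEquivOfIsometry ι p = ι (WithLp.toLp 2 p) := rfl

theorem measurePreserving_prodEquivOfIsometry [MeasurableSpace E] [BorelSpace E]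
    [MeasurableSpace F] [BorelSpace F] [MeasurableSpace K] [BorelSpace K]
    (ι : WithLp 2 (F × K) ≃ₗᵢ[ℝ] E) :
    MeasurePreserving (prodEquivOfIsometry ι) volume volume :=
  ι.measurePreserving.comp (WithLp.volume_preserving_toLp F K)

theorem exists_isometry_withLp_prod
    (h : Module.finrank ℝ E = Module.finrank ℝ F + Module.finrank ℝ K) :
    Nonempty (WithLp 2 (F × K) ≃ₗᵢ[ℝ] E) := by
  refine ⟨(stdOrthonormalBasis ℝ _).equiv (stdOrthonormalBasis ℝ _) (finCongr ?_)⟩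
  rw [h, ← Module.finrank_prod, (WithLp.linearEquiv 2 ℝ (F × K)).finrank_eq]

/-- The orthogonal projection onto the kernel of D, with the kernel identified with K, recovers
exactly what D forgets. -/
theorem exists_complementary_map
    (h : Module.finrank ℝ E = Module.finrank ℝ F + Module.finrank ℝ K) {D : E →L[ℝ] F}
    (hD : Function.Surjective D) :
    ∃ L : E →L[ℝ] K, Function.Injective (D.prod L) := by
  have hk : Module.finrank ℝ D.ker = Module.finrank ℝ K := by
    have h1 := LinearMap.finrank_range_add_finrank_ker (D : E →ₗ[ℝ] F)
    rw [LinearMap.range_eq_top.2 hD, finrank_top, h] at h1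
    exact Nat.add_left_cancel h1
  obtain ⟨e⟩ := FiniteDimensional.nonempty_continuousLinearEquiv_of_finrank_eq hk
  refine ⟨(e : D.ker →L[ℝ] K).comp D.ker.orthogonalProjectionOnto,
    (injective_iff_map_eq_zero _).2 fun x hx => ?_⟩
  have h1 : D x = 0 := congrArg Prod.fst hx
  have h2 : e (D.ker.orthogonalProjectionOnto x) = 0 := congrArg Prod.snd hx
  have h3 : D.ker.orthogonalProjectionOnto x = 0 := by simpa using h2
  have h4 := D.ker.orthogonalProjectionOnto_mem_subspace_eq_self ⟨x, h1⟩
  rw [h3] at h4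
  exact (congrArg Subtype.val h4).symm

/-- A continuous linear equivalence from an injective linear map into a space of equal
dimension. -/
theorem exists_equiv_of_injective {G : Type*} [NormedAddCommGroup G] [NormedSpace ℝ G]
    [FiniteDimensional ℝ G] (h : Module.finrank ℝ E = Module.finrank ℝ G) {A : E →L[ℝ] G}
    (hA : Function.Injective A) : ∃ e : E ≃L[ℝ] G, (e : E →L[ℝ] G) = A := by
  refine ⟨(LinearMap.linearEquivOfInjective (A : E →ₗ[ℝ] G) hA h).toContinuousLinearEquiv, ?_⟩
  ext x
  rfl

/-- The pointwise identity behind the coarea formula. Let D be the first component of e and let P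
parametrize its kernel. The vectors D* b_i and P b_j are mutually orthogonal, so the matrix `MQ` of
both families satisfies (det MQ)² = normDet(D*)² normDet(P)². Paired with the columns of e⁻¹ they
form a block triangular matrix with one identity block, so det MQ · det N = normDet(P)². Since det N
· det M = 1, eliminating det MQ gives the claim up to sign, and both sides are nonnegative. -/
theorem normDet_adjoint_fst_eq (ι : WithLp 2 (F × K) ≃ₗᵢ[ℝ] E) (e : E ≃L[ℝ] F × K) :
    (ContinuousLinearMap.adjoint ((ContinuousLinearMap.fst ℝ F K).comp (e : E →L[ℝ] F × K)) :
      F →ₗ[ℝ] E).normDet =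
    |((prodEquivOfIsometry ι : F × K →L[ℝ] E).comp (e : E →L[ℝ] F × K)).det| *
      ((e.symm : F × K →L[ℝ] E).comp (ContinuousLinearMap.inr ℝ F K) : K →ₗ[ℝ] E).normDet := by
  set D : E →L[ℝ] F := (ContinuousLinearMap.fst ℝ F K).comp (e : E →L[ℝ] F × K)
  set P : K →L[ℝ] E := (e.symm : F × K →L[ℝ] E).comp (ContinuousLinearMap.inr ℝ F K)
  set e₀ := prodEquivOfIsometry ι
  set bF := stdOrthonormalBasis ℝ F
  set bK := stdOrthonormalBasis ℝ K
  set B := (bF.prod bK).map ι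
  set N : E →ₗ[ℝ] E := ((e.symm : F × K →L[ℝ] E) : F × K →ₗ[ℝ] E) ∘ₗ
    ((e₀.symm : E →L[ℝ] F × K) : E →ₗ[ℝ] F × K)
  set M : E →ₗ[ℝ] E := (((e₀ : F × K →L[ℝ] E).comp (e : E →L[ℝ] F × K) : E →L[ℝ] E) : E →ₗ[ℝ] E)
  have hNM : LinearMap.det N * LinearMap.det M = 1 := by
    rw [← LinearMap.det_comp, ← LinearMap.det_id (M := E) (A := ℝ)]
    congr 1
    ext x
    simp [N, M]
  have hNB : ∀ b, N (B b) =
      Sum.elim (fun i => e.symm (bF i, 0)) (fun j => P (bK j)) b := by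
    have he0 : ∀ p, e₀.symm (ι (WithLp.toLp 2 p)) = p := fun p =>
      (ContinuousLinearEquiv.symm_apply_eq _).2 (prodEquivOfIsometry_apply ι p).symm
    rintro (i | j)
    · simp [N, B, he0]
    · simp [N, B, he0, P]
  set q : (Fin (Module.finrank ℝ F)) ⊕ (Fin (Module.finrank ℝ K)) → E :=
    Sum.elim (fun i => ContinuousLinearMap.adjoint D (bF i)) (fun j => P (bK j))
  set MQ : Matrix (Fin (Module.finrank ℝ F) ⊕ Fin (Module.finrank ℝ K))
    (Fin (Module.finrank ℝ F) ⊕ Fin (Module.finrank ℝ K)) ℝ := Matrix.of fun a b => inner ℝ (B a) (q b)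
  have hprod : ∀ (p : (Fin (Module.finrank ℝ F)) ⊕ (Fin (Module.finrank ℝ K)) → E),
      MQᵀ * (Matrix.of fun a b => inner ℝ (B a) (p b)) =
        Matrix.of fun a b => inner ℝ (q a) (p b) := by
    intro p
    ext a b
    rw [Matrix.mul_apply]
    simp only [MQ, Matrix.transpose_apply, Matrix.of_apply]
    rw [← B.sum_inner_mul_inner]
    exact Finset.sum_congr rfl fun i _ => by rw [real_inner_comm]
  have hDe : ∀ v, D (e.symm v) = v.1 := fun v => by simp [D]
  have hDP : ∀ j, D (P (bK j)) = 0 := fun j => by simp [P, hDe]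
  have hx : (Matrix.gram ℝ fun i => ContinuousLinearMap.adjoint D (bF i)).det =
      (ContinuousLinearMap.adjoint D : F →ₗ[ℝ] E).normDet ^ 2 :=
    ((ContinuousLinearMap.adjoint D : F →ₗ[ℝ] E).normDet_sq_eq_det_gram bF).symm
  have hy : (Matrix.gram ℝ fun i => P (bK i)).det = (P : K →ₗ[ℝ] E).normDet ^ 2 :=
    ((P : K →ₗ[ℝ] E).normDet_sq_eq_det_gram bK).symm
  have h1 : MQ.det * MQ.det = (ContinuousLinearMap.adjoint D : F →ₗ[ℝ] E).normDet ^ 2 *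
      (P : K →ₗ[ℝ] E).normDet ^ 2 := by
    rw [← hx, ← hy]
    nth_rw 1 [← Matrix.det_transpose MQ]
    rw [← Matrix.det_mul, hprod q, ← Matrix.det_fromBlocks_zero₁₂ _ 0]
    congr 1
    ext (i | i) (j | j)
    · simp [q, Matrix.gram]
    · simp [q, ContinuousLinearMap.adjoint_inner_left, hDP]
    · simp [q, ContinuousLinearMap.adjoint_inner_right, hDP]
    · simp [q, Matrix.gram]
  have h2 : MQ.det * LinearMap.det N = (P : K →ₗ[ℝ] E).normDet ^ 2 := by
    have hN : LinearMap.det N = (Matrix.of fun a b => inner ℝ (B a) (N (B b))).det := by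
      rw [← LinearMap.det_toMatrix B.toBasis]
      congr 1
      ext a b
      rw [LinearMap.toMatrix_apply]
      simp [OrthonormalBasis.repr_apply_apply]
    rw [hN, ← Matrix.det_transpose MQ, ← Matrix.det_mul, hprod, ← hy,
      ← one_mul (Matrix.det (Matrix.gram ℝ _)), ← Matrix.det_one (n := Fin (Module.finrank ℝ F)),
      ← Matrix.det_fromBlocks_zero₁₂ _ (Matrix.of fun i j => inner ℝ (P (bK i)) (e.symm (bF j, 0)))]
    congr 1
    ext (i | i) (j | j)
    · simp [q, hNB, ContinuousLinearMap.adjoint_inner_left, hDe, Matrix.one_apply,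
        orthonormal_iff_ite.1 bF.orthonormal]
    · simp [q, hNB, ContinuousLinearMap.adjoint_inner_left, hDP]
    · simp [q, hNB]
    · simp [q, hNB, Matrix.gram]
  have hPinj : Function.Injective P := by
    intro a b hab
    have := e.symm.injective hab
    simpa using this
  have hy0 : 0 < (P : K →ₗ[ℝ] E).normDet := LinearMap.normDet_pos_of_injective hPinj
  have hx0 := (ContinuousLinearMap.adjoint D : F →ₗ[ℝ] E).normDet_nonneg
  change _ = |LinearMap.det M| * _
  set x := (ContinuousLinearMap.adjoint D : F →ₗ[ℝ] E).normDet
  set y := (P : K →ₗ[ℝ] E).normDet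
  have hsq : x ^ 2 = (|LinearMap.det M| * y) ^ 2 := by
    rw [mul_pow, sq_abs]
    have e1 : (x ^ 2 * (LinearMap.det N) ^ 2) * y ^ 2 = y ^ 2 * y ^ 2 := by
      calc (x ^ 2 * (LinearMap.det N) ^ 2) * y ^ 2
          = (x ^ 2 * y ^ 2) * (LinearMap.det N) ^ 2 := by ring
        _ = (MQ.det * LinearMap.det N) * (MQ.det * LinearMap.det N) := by rw [← h1]; ring
        _ = _ := by rw [h2]
    have e2 := mul_right_cancel₀ (by positivity) e1
    calc x ^ 2 = x ^ 2 * (LinearMap.det N * LinearMap.det M) ^ 2 := by rw [hNM]; ring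
      _ = (x ^ 2 * LinearMap.det N ^ 2) * LinearMap.det M ^ 2 := by ring
      _ = _ := by rw [e2]; ring
  exact (pow_left_inj₀ hx0 (by positivity) two_ne_zero).1 hsq

end Coarea

/-! ### The coarea formula for submersions -/

section Coarea

variable {E F K : Type*} [NormedAddCommGroup E] [InnerProductSpace ℝ E] [FiniteDimensional ℝ E]
  [NormedAddCommGroup F] [InnerProductSpace ℝ F] [FiniteDimensional ℝ F]
  [NormedAddCommGroup K] [InnerProductSpace ℝ K] [FiniteDimensional ℝ K]

/-- The inverse function theorem for x ↦ (T x, L x). Invertibility of the derivative is an open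
condition, so the chart is shrunk to have it at every point of its source. -/
theorem exists_partialHomeomorph_of_submersion {T : E → F} {U : Set E} (hU : IsOpen U)
    (hT : ContDiffOn ℝ 1 T U) {L : E →L[ℝ] K} {x₀ : E} (hx₀ : x₀ ∈ U)
    (hdim : Module.finrank ℝ E = Module.finrank ℝ F + Module.finrank ℝ K)
    (hL : Function.Injective ((fderiv ℝ T x₀).prod L)) :
    ∃ h : OpenPartialHomeomorph E (F × K), x₀ ∈ h.source ∧ h.source ⊆ U ∧
      (∀ x, h x = (T x, L x)) ∧
      ∀ x ∈ h.source, ∃ e : E ≃L[ℝ] F × K, (e : E →L[ℝ] F × K) = (fderiv ℝ T x).prod L := by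
  have hdim' : Module.finrank ℝ E = Module.finrank ℝ (F × K) := by rw [hdim, Module.finrank_prod]
  obtain ⟨e₁, he₁⟩ := exists_equiv_of_injective hdim' hL
  have hcd : ContDiffAt ℝ 1 T x₀ := hT.contDiffAt (hU.mem_nhds hx₀)
  have hs : HasStrictFDerivAt (fun x => (T x, L x)) (e₁ : E →L[ℝ] F × K) x₀ := by
    rw [he₁]
    exact (hcd.hasStrictFDerivAt one_ne_zero).prodMk L.hasStrictFDerivAt
  have hcont : ContinuousOn (fun x => (fderiv ℝ T x).prod L) U :=
    (ContinuousLinearMap.prodₗᵢ ℝ : ((E →L[ℝ] F) × (E →L[ℝ] K)) ≃ₗᵢ[ℝ] _).continuous.comp_continuousOn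
      ((hT.continuousOn_fderiv_of_isOpen hU le_rfl).prodMk continuousOn_const)
  obtain ⟨s, hs_open, hs_eq⟩ := (continuousOn_iff'.1 hcont) _
    (ContinuousLinearEquiv.isOpen (𝕜 := ℝ) (E := E) (F := F × K))
  have hmem : ∀ x ∈ U, x ∈ s ↔ ∃ e : E ≃L[ℝ] F × K,
      (e : E →L[ℝ] F × K) = (fderiv ℝ T x).prod L := fun x hx => by
    have := Set.ext_iff.1 hs_eq x
    simpa [hx] using this.symm
  refine ⟨(hs.toOpenPartialHomeomorph _).restrOpen (s ∩ U) (hs_open.inter hU), ?_, ?_, ?_, ?_⟩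
  · exact ⟨hs.mem_toOpenPartialHomeomorph_source, (hmem _ hx₀).2 ⟨e₁, he₁⟩, hx₀⟩
  · exact fun x hx => hx.2.2
  · exact fun x => rfl
  · exact fun x hx => (hmem x hx.2.2).1 hx.2.1

variable [MeasurableSpace E] [BorelSpace E] [MeasurableSpace F] [BorelSpace F]
  [MeasurableSpace K] [BorelSpace K]

/-- In the chart (T, L) the fibres of T are the slices {y} × K. The area formula on each slice,
Tonelli on F × K and the change of variables back to E leave two Jacobians, whose product is given
by `normDet_adjoint_fst_eq`. -/
theorem exists_nhds_coarea {T : E → F} {U : Set E} (hU : IsOpen U)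
    (hT : ContDiffOn ℝ 1 T U) (hsurj : ∀ x ∈ U, Function.Surjective (fderiv ℝ T x))
    (hdim : Module.finrank ℝ E = Module.finrank ℝ F + Module.finrank ℝ K) {x₀ : E} (hx₀ : x₀ ∈ U) :
    ∃ N ∈ 𝓝 x₀, ∀ A ⊆ N, MeasurableSet A → ∀ f : E → ℝ≥0∞, Measurable f →
      Measurable (fun y => ∫⁻ x in A ∩ T ⁻¹' {y}, f x ∂μHE[Module.finrank ℝ K]) ∧
      ∫⁻ y, ∫⁻ x in A ∩ T ⁻¹' {y}, f x ∂μHE[Module.finrank ℝ K] =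
        ∫⁻ x in A, f x *
          ENNReal.ofReal (ContinuousLinearMap.adjoint (fderiv ℝ T x) : F →ₗ[ℝ] E).normDet := by
  obtain ⟨L, hL⟩ := exists_complementary_map (K := K) hdim (hsurj x₀ hx₀)
  obtain ⟨h, hxs, hsU, hh, hinv⟩ := exists_partialHomeomorph_of_submersion hU hT hx₀ hdim hL
  obtain ⟨ι⟩ := exists_isometry_withLp_prod hdim
  refine ⟨h.source, h.open_source.mem_nhds hxs, fun A hA hAm f hf => ?_⟩
  have hder : ∀ x ∈ h.source, ∀ e : E ≃L[ℝ] F × K,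
      (e : E →L[ℝ] F × K) = (fderiv ℝ T x).prod L → HasFDerivAt h (e : E →L[ℝ] F × K) x := by
    intro x hx e he
    rw [he]
    have hcd : ContDiffAt ℝ 1 T x := hT.contDiffAt (hU.mem_nhds (hsU hx))
    have := (hcd.differentiableAt one_ne_zero).hasFDerivAt.prodMk (L.hasFDerivAt (x := x))
    exact this.congr_of_eventuallyEq (Eventually.of_forall fun z => hh z)
  have hcdh : ∀ x ∈ h.source, ContDiffAt ℝ 1 h x := fun x hx =>
    ((hT.contDiffAt (hU.mem_nhds (hsU hx))).prodMk L.contDiff.contDiffAt).congr_of_eventuallyEq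
      (Eventually.of_forall fun z => hh z)
  have hsymm : ∀ p ∈ h.target, ContDiffAt ℝ 1 h.symm p := by
    intro p hp
    obtain ⟨e, he⟩ := hinv _ (h.map_target hp)
    exact h.contDiffAt_symm hp (hder _ (h.map_target hp) e he) (hcdh _ (h.map_target hp))
  have hsymm' : ∀ x ∈ h.source, ∀ e : E ≃L[ℝ] F × K,
      (e : E →L[ℝ] F × K) = (fderiv ℝ T x).prod L →
        fderiv ℝ h.symm (h x) = (e.symm : F × K →L[ℝ] E) := by
    intro x hx e he
    refine (h.hasFDerivAt_symm (h.map_source hx) ?_).fderiv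
    rw [h.left_inv hx]
    exact hder x hx e he
  set O : Set (F × K) := h.target
  have hOo : IsOpen O := h.open_target
  set J : F × K → ℝ≥0∞ := fun p => ENNReal.ofReal
    ((fderiv ℝ h.symm p).comp (ContinuousLinearMap.inr ℝ F K) : K →ₗ[ℝ] E).normDet
  have hJ : Measurable J := by
    refine (ContinuousLinearMap.continuous_normDet.measurable.comp ?_).ennreal_ofReal
    exact ((ContinuousLinearMap.compL ℝ K (F × K) E).flip
      (ContinuousLinearMap.inr ℝ F K)).continuous.measurable.comp (measurable_fderiv ℝ h.symm)
  classical
  set g : F × K → E := O.piecewise h.symm fun _ => x₀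
  have hg : Measurable g := h.symm.continuousOn.measurable_piecewise continuousOn_const
    hOo.measurableSet
  have hgO : ∀ p ∈ O, g p = h.symm p := fun p hp => piecewise_eq_of_mem _ _ _ hp
  set H : F × K → ℝ≥0∞ := O.indicator fun p => J p * A.indicator f (g p)
  have hH : Measurable H := (hJ.mul ((hf.indicator hAm).comp hg)).indicator hOo.measurableSet
  have hTA : ∀ y, MeasurableSet (h.source ∩ T ⁻¹' {y}) := fun y => by
    obtain ⟨u, hu, hue⟩ := (continuousOn_iff_isClosed.1 (hT.continuousOn.mono hsU)) {y}
      isClosed_singleton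
    rw [inter_comm, hue]
    exact hu.measurableSet.inter h.open_source.measurableSet
  -- The inverse chart restricted to a slice is an injective immersion onto the fibre, so the area
  -- formula applies to it.
  have hslice : ∀ y, ∫⁻ x in A ∩ T ⁻¹' {y}, f x ∂μHE[Module.finrank ℝ K] = ∫⁻ z, H (y, z) := by
    intro y
    set Oy : Set K := (fun z => (y, z)) ⁻¹' O
    have hOy : IsOpen Oy := hOo.preimage (by fun_prop)
    have hφ : ∀ z ∈ Oy, ContDiffAt ℝ 1 (fun z => h.symm (y, z)) z := fun z hz =>
      (hsymm (y, z) hz).comp z (contDiffAt_const.prodMk contDiffAt_id)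
    have hφ' : ∀ z ∈ Oy, fderiv ℝ (fun z => h.symm (y, z)) z =
        (fderiv ℝ h.symm (y, z)).comp (ContinuousLinearMap.inr ℝ F K) := fun z hz =>
      (((hsymm (y, z) hz).differentiableAt one_ne_zero).hasFDerivAt.comp z
        (hasFDerivAt_prodMk_right y z)).fderiv
    have himg : (fun z => h.symm (y, z)) '' Oy = h.source ∩ T ⁻¹' {y} := by
      ext x
      constructor
      · rintro ⟨z, hz, rfl⟩
        refine ⟨h.map_target hz, ?_⟩
        have := h.right_inv hz
        rw [hh] at this
        exact congrArg Prod.fst this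
      · rintro ⟨hx, hxy⟩
        have hxy' : h x = (y, L x) := by rw [hh, show T x = y from hxy]
        refine ⟨L x, ?_, ?_⟩
        · change (y, L x) ∈ O
          rw [← hxy']
          exact h.map_source hx
        · change h.symm (y, L x) = x
          rw [← hxy', h.left_inv hx]
    have harea := lintegral_image_eq_lintegral_normDet_mul hOy
      (fun z hz => (hφ z hz).contDiffWithinAt)
      (fun z hz => by
        rw [hφ' z hz]
        obtain ⟨e, he⟩ := hinv _ (h.map_target hz)
        have h1 := hsymm' _ (h.map_target hz) e he
        rw [h.right_inv hz] at h1
        rw [h1]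
        intro a b hab
        simpa using e.symm.injective hab)
      (fun z hz z' hz' hzz => by
        have := h.symm.injOn (x₁ := (y, z)) hz (x₂ := (y, z')) hz' hzz
        exact congrArg Prod.snd this)
      (hf.indicator hAm)
    rw [himg] at harea
    calc ∫⁻ x in A ∩ T ⁻¹' {y}, f x ∂μHE[Module.finrank ℝ K]
        = ∫⁻ x in h.source ∩ T ⁻¹' {y}, A.indicator f x ∂μHE[Module.finrank ℝ K] := by
          rw [lintegral_indicator hAm, Measure.restrict_restrict hAm, ← inter_assoc,
            inter_eq_left.2 hA]
      _ = _ := harea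
      _ = ∫⁻ z in Oy, H (y, z) := by
          refine setLIntegral_congr_fun hOy.measurableSet fun z hz => ?_
          have hz' : (y, z) ∈ O := hz
          simp only [H, indicator_of_mem hz', hgO _ hz', J, hφ' z hz]
      _ = ∫⁻ z, H (y, z) := by
          rw [← lintegral_indicator hOy.measurableSet]
          refine lintegral_congr fun z => ?_
          by_cases hz : z ∈ Oy
          · rw [indicator_of_mem hz]
          · rw [indicator_of_notMem hz]
            exact (indicator_of_notMem (s := O) (a := (y, z)) hz _).symm
  constructor
  · simp_rw [hslice]
    exact hH.lintegral_prod_right'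
  simp_rw [hslice]
  -- F × K carries the sup norm; `e₀` moves the product into E while preserving volume, so that the
  -- determinant of an endomorphism of E can be used.
  set e₀ := prodEquivOfIsometry ι
  have hmp := measurePreserving_prodEquivOfIsometry ι
  have hemb : MeasurableEmbedding e₀ := e₀.toHomeomorph.measurableEmbedding
  calc ∫⁻ y, ∫⁻ z, H (y, z) = ∫⁻ p, H p := by
        rw [Measure.volume_eq_prod, lintegral_prod _ hH.aemeasurable]
    _ = ∫⁻ p in O, H p := by
        rw [← lintegral_indicator hOo.measurableSet]
        refine lintegral_congr fun p => ?_
        simp only [H, indicator_indicator, inter_self]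
    _ = ∫⁻ p in e₀ ⁻¹' (e₀ '' O), H (e₀.symm (e₀ p)) := by
        rw [preimage_image_eq _ e₀.injective]
        simp
    _ = ∫⁻ q in e₀ '' O, H (e₀.symm q) :=
        hmp.setLIntegral_comp_preimage_emb hemb (fun q => H (e₀.symm q)) _
    _ = ∫⁻ q in (fun x => e₀ (h x)) '' h.source, H (e₀.symm q) := by
        rw [show (fun x => e₀ (h x)) '' h.source = e₀ '' O by
          rw [← image_image e₀ h, h.image_source_eq_target]]
    _ = ∫⁻ x in h.source, ENNReal.ofReal
          |((e₀ : F × K →L[ℝ] E).comp ((fderiv ℝ T x).prod L)).det| * H (e₀.symm (e₀ (h x))) := by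
        refine lintegral_image_eq_lintegral_abs_det_fderiv_mul volume h.open_source.measurableSet
          (fun x hx => ?_) (fun a ha b hb hab => h.injOn ha hb (e₀.injective hab)) _
        obtain ⟨e, he⟩ := hinv x hx
        rw [← he]
        exact ((e₀ : F × K →L[ℝ] E).hasFDerivAt.comp x (hder x hx e he)).hasFDerivWithinAt
    _ = ∫⁻ x in h.source, A.indicator (fun x => f x * ENNReal.ofReal
          (ContinuousLinearMap.adjoint (fderiv ℝ T x) : F →ₗ[ℝ] E).normDet) x := by
        refine setLIntegral_congr_fun h.open_source.measurableSet fun x hx => ?_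
        obtain ⟨e, he⟩ := hinv x hx
        have hxO : h x ∈ O := h.map_source hx
        have hD : (ContinuousLinearMap.fst ℝ F K).comp (e : E →L[ℝ] F × K) = fderiv ℝ T x := by
          rw [he]; rfl
        have hnd := normDet_adjoint_fst_eq ι e
        rw [hD] at hnd
        simp only [e₀.symm_apply_apply, H, indicator_of_mem hxO, hgO _ hxO, h.left_inv hx, J,
          hsymm' x hx e he]
        by_cases hxA : x ∈ A
        · rw [indicator_of_mem hxA, indicator_of_mem hxA, hnd, ← he,
            ENNReal.ofReal_mul (abs_nonneg _)]
          ring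
        · rw [indicator_of_notMem hxA, indicator_of_notMem hxA, mul_zero, mul_zero]
    _ = _ := by
        rw [lintegral_indicator hAm, Measure.restrict_restrict hAm, inter_eq_left.2 hA]

/-- The coarea formula for `C¹` submersions. -/
theorem lintegral_coarea {k : ℕ} {T : E → F} {U : Set E} (hU : IsOpen U)
    (hT : ContDiffOn ℝ 1 T U) (hsurj : ∀ x ∈ U, Function.Surjective (fderiv ℝ T x))
    (hdim : Module.finrank ℝ E = Module.finrank ℝ F + k) {f : E → ℝ≥0∞} (hf : Measurable f) :
    Measurable (fun y => ∫⁻ x in U ∩ T ⁻¹' {y}, f x ∂μHE[k]) ∧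
      ∫⁻ y, ∫⁻ x in U ∩ T ⁻¹' {y}, f x ∂μHE[k] =
        ∫⁻ x in U, f x *
          ENNReal.ofReal (ContinuousLinearMap.adjoint (fderiv ℝ T x) : F →ₗ[ℝ] E).normDet := by
  have hk : Module.finrank ℝ (EuclideanSpace ℝ (Fin k)) = k := by simp
  obtain ⟨D, hDm, hDd, hDU, hDP⟩ := exists_measurable_partition_of_local hU
    (fun N => N ⊆ U ∧ ∀ A ⊆ N, MeasurableSet A → ∀ f : E → ℝ≥0∞, Measurable f →
      Measurable (fun y => ∫⁻ x in A ∩ T ⁻¹' {y}, f x ∂μHE[k]) ∧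
      ∫⁻ y, ∫⁻ x in A ∩ T ⁻¹' {y}, f x ∂μHE[k] =
        ∫⁻ x in A, f x *
          ENNReal.ofReal (ContinuousLinearMap.adjoint (fderiv ℝ T x) : F →ₗ[ℝ] E).normDet)
    ⟨empty_subset _, fun A hA _ f _ => by simp [subset_empty_iff.1 hA]⟩
    (fun s t hst ht => ⟨hst.trans ht.1, fun A hA => ht.2 A (hA.trans hst)⟩)
    (fun x hx => by
      obtain ⟨N, hN, hNP⟩ := exists_nhds_coarea (K := EuclideanSpace ℝ (Fin k)) hU hT hsurj
        (by rw [hk, hdim]) hx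
      rw [hk] at hNP
      exact ⟨N ∩ U, inter_mem hN (hU.mem_nhds hx), inter_subset_right,
        fun A hA => hNP A (hA.trans inter_subset_left)⟩)
  have hP := fun i => (hDP i).2 _ Subset.rfl (hDm i) f hf
  have hsplit : ∀ y, ∫⁻ x in U ∩ T ⁻¹' {y}, f x ∂μHE[k] =
      ∑' i, ∫⁻ x in D i ∩ T ⁻¹' {y}, f x ∂μHE[k] := by
    intro y
    rw [← hDU, iUnion_inter]
    refine lintegral_iUnion (fun i => ?_) (fun i j hij =>
      (hDd hij).mono inter_subset_left inter_subset_left) _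
    obtain ⟨u, hu, hue⟩ := (continuousOn_iff_isClosed.1 (hT.continuousOn.mono (hDP i).1)) {y}
      isClosed_singleton
    rw [inter_comm, hue]
    exact hu.measurableSet.inter (hDm i)
  simp_rw [hsplit]
  refine ⟨Measurable.tsum fun i => (hP i).1, ?_⟩
  rw [lintegral_tsum fun i => (hP i).1.aemeasurable]
  simp_rw [fun i => (hP i).2]
  rw [← lintegral_iUnion hDm hDd, hDU]

end Coarea

/-! ### Functions that are C¹ up to the boundary -/

section Calculus

variable {P Q H : Type*} [NormedAddCommGroup P] [NormedSpace ℝ P] [NormedAddCommGroup Q]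
  [NormedSpace ℝ Q] [NormedAddCommGroup H] [NormedSpace ℝ H]

theorem le_of_deriv_le_affine {ψ ψ' : ℝ → ℝ} {a b : ℝ}
    (h : ∀ s ∈ Icc (0 : ℝ) 1, HasDerivAt ψ (ψ' s) s) (hb : ∀ s ∈ Icc (0 : ℝ) 1, ψ' s ≤ a + b * s) :
    ψ 1 ≤ ψ 0 + a + b / 2 := by
  have hB : ∀ x : ℝ, HasDerivAt (fun s => ψ 0 + a * s + b / 2 * s ^ 2) (a + b * x) x := fun x => by
    have h1 : HasDerivAt (fun s : ℝ => a * s) a x := by simpa using (hasDerivAt_id x).const_mul a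
    have h2 : HasDerivAt (fun s : ℝ => b / 2 * s ^ 2) (b * x) x := by
      have := (hasDerivAt_pow 2 x).const_mul (b / 2)
      refine this.congr_deriv ?_
      simp; ring
    exact (h1.const_add (ψ 0)).add h2
  have := image_le_of_deriv_right_le_deriv_boundary (f := ψ) (f' := ψ') (a := 0) (b := 1)
    (fun x hx => (h x hx).continuousAt.continuousWithinAt)
    (fun x hx => (h x (Ico_subset_Icc_self hx)).hasDerivWithinAt)
    (B := fun s => ψ 0 + a * s + b / 2 * s ^ 2) (B' := fun x => a + b * x) (by simp)
    (fun x _ => (hB x).continuousAt.continuousWithinAt)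
    (fun x _ => (hB x).hasDerivWithinAt) (fun x hx => hb x (Ico_subset_Icc_self hx))
    (right_mem_Icc.2 zero_le_one)
  simpa using this

theorem tendsto_fderiv_of_tendsto_iteratedFDeriv_one {g : P → H} {l : Filter P}
    (h : ∃ L, Tendsto (iteratedFDeriv ℝ 1 g) l (𝓝 L)) : ∃ L, Tendsto (fderiv ℝ g) l (𝓝 L) := by
  obtain ⟨L, hL⟩ := h
  refine ⟨_, ((continuousMultilinearCurryFin1 ℝ P H).continuous.tendsto L |>.comp hL).congr
    fun x => ?_⟩
  ext v
  simp [continuousMultilinearCurryFin1_apply]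

theorem tendsto_fderiv_fderiv_of_tendsto_iteratedFDeriv_two {g : P → H} {l : Filter P}
    (h : ∃ L, Tendsto (iteratedFDeriv ℝ 2 g) l (𝓝 L)) :
    ∃ L, Tendsto (fderiv ℝ (fderiv ℝ g)) l (𝓝 L) := by
  obtain ⟨L, hL⟩ := h
  refine tendsto_fderiv_of_tendsto_iteratedFDeriv_one ⟨_,
    ((continuousMultilinearCurryRightEquiv' ℝ 1 P H).continuous.tendsto L |>.comp hL).congr
    fun x => ?_⟩
  simp [iteratedFDeriv_succ_eq_comp_right (n := 1)]

/-- `G` is `C¹` in `Ω` and `G`, `DG` extend continuously to the closure of `Ω`. -/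
structure IsC1UpToBoundary (Ω : Set P) (G : P → H) : Prop where
  contDiffOn : ContDiffOn ℝ 1 G Ω
  tendsto : ∀ p ∈ closure Ω, ∃ L, Tendsto G (𝓝[Ω] p) (𝓝 L)
  tendsto_fderiv : ∀ p ∈ closure Ω, ∃ L, Tendsto (fderiv ℝ G) (𝓝[Ω] p) (𝓝 L)

namespace IsC1UpToBoundary

variable {Ω : Set P} {G G' : P → H}

theorem congr (h : IsC1UpToBoundary Ω G) (hΩ : IsOpen Ω) (hG : EqOn G' G Ω) :
    IsC1UpToBoundary Ω G' where
  contDiffOn := h.contDiffOn.congr hG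
  tendsto p hp := by
    obtain ⟨L, hL⟩ := h.tendsto p hp
    exact ⟨L, tendsto_nhdsWithin_congr (fun x hx => (hG hx).symm) hL⟩
  tendsto_fderiv p hp := by
    obtain ⟨L, hL⟩ := h.tendsto_fderiv p hp
    refine ⟨L, tendsto_nhdsWithin_congr (fun x hx => ?_) hL⟩
    exact ((hG.eventuallyEq_of_mem (hΩ.mem_nhds hx)).fderiv_eq).symm

theorem differentiableAt (h : IsC1UpToBoundary Ω G) (hΩ : IsOpen Ω) {x : P} (hx : x ∈ Ω) :
    DifferentiableAt ℝ G x :=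
  (h.contDiffOn.contDiffAt (hΩ.mem_nhds hx)).differentiableAt one_ne_zero

theorem add (h : IsC1UpToBoundary Ω G) (h' : IsC1UpToBoundary Ω G') (hΩ : IsOpen Ω) :
    IsC1UpToBoundary Ω (fun p => G p + G' p) where
  contDiffOn := h.contDiffOn.add h'.contDiffOn
  tendsto p hp := by
    obtain ⟨L, hL⟩ := h.tendsto p hp
    obtain ⟨L', hL'⟩ := h'.tendsto p hp
    exact ⟨L + L', hL.add hL'⟩
  tendsto_fderiv p hp := by
    obtain ⟨L, hL⟩ := h.tendsto_fderiv p hp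
    obtain ⟨L', hL'⟩ := h'.tendsto_fderiv p hp
    refine ⟨L + L', tendsto_nhdsWithin_congr (fun x hx => ?_) (hL.add hL')⟩
    exact (fderiv_fun_add (h.differentiableAt hΩ hx) (h'.differentiableAt hΩ hx)).symm

theorem comp_snd {A : Set Q} (h : IsC1UpToBoundary Ω G) (hΩ : IsOpen Ω) :
    IsC1UpToBoundary (A ×ˢ Ω) (fun p : Q × P => G p.2) where
  contDiffOn := h.contDiffOn.comp contDiff_snd.contDiffOn fun p hp => hp.2
  tendsto p hp := by
    rw [closure_prod_eq] at hp
    obtain ⟨L, hL⟩ := h.tendsto p.2 hp.2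
    refine ⟨L, hL.comp ?_⟩
    exact (continuous_snd.tendsto p).inf (tendsto_principal_principal.2 fun q hq => hq.2)
  tendsto_fderiv p hp := by
    rw [closure_prod_eq] at hp
    obtain ⟨L, hL⟩ := h.tendsto_fderiv p.2 hp.2
    have ht : Tendsto (Prod.snd : Q × P → P) (𝓝[A ×ˢ Ω] p) (𝓝[Ω] p.2) :=
      (continuous_snd.tendsto p).inf (tendsto_principal_principal.2 fun q hq => hq.2)
    refine ⟨L.comp (ContinuousLinearMap.snd ℝ Q P), tendsto_nhdsWithin_congr (fun x hx => ?_)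
      (((((ContinuousLinearMap.compL ℝ (Q × P) P H).flip
        (ContinuousLinearMap.snd ℝ Q P)).continuous.tendsto L).comp hL).comp ht)⟩
    exact (((h.differentiableAt hΩ hx.2).hasFDerivAt.comp x hasFDerivAt_snd).fderiv).symm

theorem clm_comp_fderiv {f : P → ℝ} (hf : IsC2UpToBoundary Ω f) (hΩ : IsOpen Ω)
    (R : (P →L[ℝ] ℝ) →L[ℝ] H) : IsC1UpToBoundary Ω (fun p => R (fderiv ℝ f p)) where
  contDiffOn := R.contDiff.comp_contDiffOn (hf.2.1.fderiv_of_isOpen hΩ (by norm_num))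
  tendsto p hp := by
    obtain ⟨L, hL⟩ := tendsto_fderiv_of_tendsto_iteratedFDeriv_one (hf.2.2 1 (by norm_num) p hp)
    exact ⟨R L, (R.continuous.tendsto L).comp hL⟩
  tendsto_fderiv p hp := by
    obtain ⟨L, hL⟩ := tendsto_fderiv_fderiv_of_tendsto_iteratedFDeriv_two
      (hf.2.2 2 le_rfl p hp)
    refine ⟨R.comp L, tendsto_nhdsWithin_congr (fun x hx => ?_)
      (((ContinuousLinearMap.compL ℝ P (P →L[ℝ] ℝ) H R).continuous.tendsto L).comp hL)⟩
    have hd : DifferentiableAt ℝ (fderiv ℝ f) x :=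
      ((hf.2.1.fderiv_of_isOpen hΩ (m := 1) (by norm_num)).contDiffAt
        (hΩ.mem_nhds hx)).differentiableAt one_ne_zero
    exact ((R.hasFDerivAt.comp x hd.hasFDerivAt).fderiv).symm

theorem continuousOn_extendFrom (h : IsC1UpToBoundary Ω G) :
    ContinuousOn (extendFrom Ω G) (closure Ω) :=
  _root_.continuousOn_extendFrom Subset.rfl h.tendsto

theorem extendFrom_eq (h : IsC1UpToBoundary Ω G) {p : P} (hp : p ∈ Ω) :
    extendFrom Ω G p = G p :=
  extendFrom_extends h.contDiffOn.continuousOn p hp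

theorem exists_bound_fderiv (h : IsC1UpToBoundary Ω G) (hΩ : IsOpen Ω)
    (hc : IsCompact (closure Ω)) : ∃ K : ℝ, 0 ≤ K ∧ ∀ p ∈ Ω, ‖fderiv ℝ G p‖ ≤ K := by
  obtain ⟨K, hK⟩ := hc.exists_bound_of_continuousOn
    (_root_.continuousOn_extendFrom Subset.rfl h.tendsto_fderiv)
  refine ⟨max K 0, le_max_right _ _, fun p hp => le_max_of_le_left ?_⟩
  rw [← extendFrom_extends (h.contDiffOn.continuousOn_fderiv_of_isOpen hΩ le_rfl) p hp]
  exact hK p (subset_closure hp)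

end IsC1UpToBoundary

/-- The derivative extends continuously to a compact closure, hence is bounded; convexity of Y turns
this into a Lipschitz bound in y, uniform in q. -/
theorem exists_lipschitz_snd {A : Set Q} {Y : Set P} {G : Q × P → H}
    (h : IsC1UpToBoundary (A ×ˢ Y) G) (hA : IsOpen A) (hY : IsOpen Y) (hYc : Convex ℝ Y)
    (hc : IsCompact (closure (A ×ˢ Y))) :
    ∃ K : ℝ, 0 ≤ K ∧ ∀ q ∈ A, ∀ y ∈ Y, ∀ y' ∈ Y, ‖G (q, y') - G (q, y)‖ ≤ K * ‖y' - y‖ := by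
  obtain ⟨K, hK0, hK⟩ := h.exists_bound_fderiv (hA.prod hY) hc
  refine ⟨K, hK0, fun q hq y hy y' hy' => ?_⟩
  refine hYc.norm_image_sub_le_of_norm_hasFDerivWithin_le (f := fun y => G (q, y))
    (f' := fun y => (fderiv ℝ G (q, y)).comp (ContinuousLinearMap.inr ℝ Q P)) (fun z hz => ?_)
    (fun z hz => ?_) hy hy'
  · exact ((h.differentiableAt (hA.prod hY) (x := (q, z)) ⟨hq, hz⟩).hasFDerivAt.comp z
      (hasFDerivAt_prodMk_right q z)).hasFDerivWithinAt
  · refine (ContinuousLinearMap.opNorm_comp_le _ _).trans ?_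
    calc _ ≤ K * 1 := mul_le_mul (hK _ ⟨hq, hz⟩) (ContinuousLinearMap.norm_inr_le_one ℝ Q P)
          (norm_nonneg _) hK0
      _ = K := mul_one K

/-- A substitute for strict differentiability at a point whose y₀ may lie on the boundary of Y: the
limit L of the derivatives replaces the derivative. Only q varies, within a ball contained in A, so
the mean value inequality never leaves the domain. -/
theorem exists_approximation_fst {A : Set Q} {Y : Set P} {G : Q × P → H}
    (h : IsC1UpToBoundary (A ×ˢ Y) G) (hA : IsOpen A) (hY : IsOpen Y) {q₀ : Q} {y₀ : P}
    (hq₀ : q₀ ∈ A) {L : Q × P →L[ℝ] H}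
    (hL : Tendsto (fderiv ℝ G) (𝓝[A ×ˢ Y] (q₀, y₀)) (𝓝 L)) {η : ℝ} (hη : 0 < η) :
    ∃ δ > 0, Metric.ball q₀ δ ⊆ A ∧ ∀ q ∈ Metric.ball q₀ δ, ∀ q' ∈ Metric.ball q₀ δ,
      ∀ y ∈ Metric.ball y₀ δ, y ∈ Y →
        ‖G (q', y) - G (q, y) - L (q' - q, 0)‖ ≤ η * ‖q' - q‖ := by
  have h1 : ∀ᶠ p in 𝓝[A ×ˢ Y] (q₀, y₀), ‖fderiv ℝ G p - L‖ ≤ η := by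
    have := Metric.tendsto_nhds.1 hL η hη
    filter_upwards [this] with p hp
    rw [dist_eq_norm] at hp
    exact hp.le
  obtain ⟨δ₁, hδ₁, h2⟩ := Metric.mem_nhdsWithin_iff.1 h1
  obtain ⟨δ₂, hδ₂, h3⟩ := Metric.isOpen_iff.1 hA q₀ hq₀
  refine ⟨min δ₁ δ₂, lt_min hδ₁ hδ₂, (Metric.ball_subset_ball (min_le_right _ _)).trans h3, ?_⟩
  intro q hq q' hq' y hy hyY
  have := (convex_ball q₀ (min δ₁ δ₂)).norm_image_sub_le_of_norm_hasFDerivWithin_le'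
    (f := fun q => G (q, y)) (φ := L.comp (ContinuousLinearMap.inl ℝ Q P)) (C := η)
    (f' := fun q => (fderiv ℝ G (q, y)).comp (ContinuousLinearMap.inl ℝ Q P)) (fun z hz => ?_)
    (fun z hz => ?_) hq hq'
  · simpa using this
  · exact ((h.differentiableAt (hA.prod hY) (x := (z, y)) ⟨h3
      (Metric.ball_subset_ball (min_le_right _ _) hz), hyY⟩).hasFDerivAt.comp z
      (hasFDerivAt_prodMk_left z y)).hasFDerivWithinAt
  · have hmem : (z, y) ∈ Metric.ball (q₀, y₀) δ₁ ∩ A ×ˢ Y := by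
      refine ⟨?_, h3 (Metric.ball_subset_ball (min_le_right _ _) hz), hyY⟩
      rw [← ball_prod_same]
      exact ⟨Metric.ball_subset_ball (min_le_left _ _) hz,
        Metric.ball_subset_ball (min_le_left _ _) hy⟩
    have hb : ‖fderiv ℝ G (z, y) - L‖ ≤ η := h2 hmem
    rw [← ContinuousLinearMap.sub_comp]
    refine (ContinuousLinearMap.opNorm_comp_le _ _).trans ?_
    calc _ ≤ η * 1 := mul_le_mul hb (ContinuousLinearMap.norm_inl_le_one ℝ Q P)
          (norm_nonneg _) hη.le
      _ = η := mul_one η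

end Calculus

/-! ### Gradients and Hessians in coordinates -/

section PartialGradient

variable {n : ℕ} {P Q : Type*} [NormedAddCommGroup P] [NormedSpace ℝ P] [NormedAddCommGroup Q]
  [NormedSpace ℝ Q]

/-- The vector of the values of a functional at the images of the standard basis vectors. -/
noncomputable def dualCoords (ι : Euc n →L[ℝ] P) : (P →L[ℝ] ℝ) →L[ℝ] Euc n :=
  ((EuclideanSpace.equiv (Fin n) ℝ).symm : (Fin n → ℝ) →L[ℝ] Euc n).comp
    (ContinuousLinearMap.pi fun j =>
      ContinuousLinearMap.apply ℝ ℝ (ι (EuclideanSpace.single j (1 : ℝ))))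

theorem dualCoords_apply (ι : Euc n →L[ℝ] P) (l : P →L[ℝ] ℝ) (j : Fin n) :
    dualCoords ι l j = l (ι (EuclideanSpace.single j 1)) := rfl

theorem inner_gradient_eq (f : Euc n → ℝ) (y v : Euc n) :
    inner ℝ (gradient f y) v = fderiv ℝ f y v := by
  rw [gradient, InnerProductSpace.toDual_symm_apply]

theorem gradient_apply (f : Euc n → ℝ) (y : Euc n) (j : Fin n) :
    gradient f y j = fderiv ℝ f y (EuclideanSpace.single j 1) := by
  rw [← inner_gradient_eq, EuclideanSpace.inner_single_right]
  simp

theorem gradient_eq_dualCoords (f : Euc n → ℝ) (y : Euc n) :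
    gradient f y = dualCoords (ContinuousLinearMap.id ℝ (Euc n)) (fderiv ℝ f y) := by
  ext j
  rw [gradient_apply, dualCoords_apply]
  rfl

/-- The gradient in the second variable. -/
noncomputable def partialGradient (f : Q → Euc n → ℝ) (p : Q × Euc n) : Euc n :=
  gradient (f p.1) p.2

theorem isC1UpToBoundary_gradient {Y : Set (Euc n)} (hY : IsOpen Y) {V : Euc n → ℝ}
    (hV : IsC2UpToBoundary Y V) : IsC1UpToBoundary Y (gradient V) :=
  (IsC1UpToBoundary.clm_comp_fderiv hV hY _).congr hY fun y _ => gradient_eq_dualCoords V y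

theorem hasFDerivAt_curry {Ω : Set (Q × Euc n)} (hΩ : IsOpen Ω) {f : Q → Euc n → ℝ}
    (hf : ContDiffOn ℝ 2 (fun p : Q × Euc n => f p.1 p.2) Ω) {p : Q × Euc n} (hp : p ∈ Ω) :
    HasFDerivAt (f p.1) ((fderiv ℝ (fun p : Q × Euc n => f p.1 p.2) p).comp
      (ContinuousLinearMap.inr ℝ Q (Euc n))) p.2 :=
  HasFDerivAt.comp (g := fun p : Q × Euc n => f p.1 p.2) (f := fun y => (p.1, y)) p.2
    ((hf.contDiffAt (hΩ.mem_nhds hp)).differentiableAt two_ne_zero).hasFDerivAt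
    (hasFDerivAt_prodMk_right p.1 p.2)

theorem partialGradient_eq_dualCoords {Ω : Set (Q × Euc n)} (hΩ : IsOpen Ω) {f : Q → Euc n → ℝ}
    (hf : ContDiffOn ℝ 2 (fun p : Q × Euc n => f p.1 p.2) Ω) :
    EqOn (partialGradient f) (fun p => dualCoords (ContinuousLinearMap.inr ℝ Q (Euc n))
      (fderiv ℝ (fun p : Q × Euc n => f p.1 p.2) p)) Ω := by
  intro p hp
  ext j
  rw [partialGradient, gradient_apply, dualCoords_apply, (hasFDerivAt_curry hΩ hf hp).fderiv]
  rfl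

theorem isC1UpToBoundary_partialGradient {Ω : Set (Q × Euc n)} (hΩ : IsOpen Ω)
    {f : Q → Euc n → ℝ} (hf : IsC2UpToBoundary Ω (fun p : Q × Euc n => f p.1 p.2)) :
    IsC1UpToBoundary Ω (partialGradient f) :=
  (IsC1UpToBoundary.clm_comp_fderiv hf hΩ _).congr hΩ (partialGradient_eq_dualCoords hΩ hf.2.1)

theorem fderiv_euclidean_apply {G : P → Euc n} {p : P} (h : DifferentiableAt ℝ G p)
    (j : Fin n) (w : P) :
    fderiv ℝ (fun p => G p j) p w = fderiv ℝ G p w j := by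
  have := ((EuclideanSpace.proj (𝕜 := ℝ) j : Euc n →L[ℝ] ℝ).hasFDerivAt.comp p h.hasFDerivAt).fderiv
  change fderiv ℝ ((EuclideanSpace.proj (𝕜 := ℝ) j : Euc n →L[ℝ] ℝ) ∘ G) p w = _
  rw [this]
  rfl

theorem hessianMatrix_apply {f : Euc n → ℝ} {y : Euc n} (h : DifferentiableAt ℝ (gradient f) y)
    (i j : Fin n) :
    hessianMatrix f y i j = fderiv ℝ (gradient f) y (EuclideanSpace.single i 1) j := by
  rw [← fderiv_euclidean_apply h]
  simp only [hessianMatrix, Matrix.of_apply, gradient_apply]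

/-- The y-derivative is the inner one in the definition, so the matrix represents the x-derivative
of `partialGradient c`, with rows indexed by the source. -/
theorem mixedHessian_apply {m : ℕ} {c : Euc m → Euc n → ℝ} {p : Euc m × Euc n}
    (h : DifferentiableAt ℝ (partialGradient c) p) (i : Fin m) (j : Fin n) :
    mixedHessian c p.1 p.2 i j =
      fderiv ℝ (partialGradient c) p (EuclideanSpace.single i 1, 0) j := by
  have h' : DifferentiableAt ℝ (fun x => partialGradient c (x, p.2)) p.1 :=
    DifferentiableAt.comp (g := partialGradient c) (f := fun x => (x, p.2)) p.1 h
      (hasFDerivAt_prodMk_left p.1 p.2).differentiableAt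
  have h1 : fderiv ℝ (fun x => partialGradient c (x, p.2)) p.1 =
      (fderiv ℝ (partialGradient c) p).comp (ContinuousLinearMap.inl ℝ _ _) :=
    (HasFDerivAt.comp (g := partialGradient c) (f := fun x => (x, p.2)) p.1 h.hasFDerivAt
      (hasFDerivAt_prodMk_left p.1 p.2)).fderiv
  have h2 := fderiv_euclidean_apply h' j (EuclideanSpace.single i 1)
  rw [h1] at h2
  simp only [mixedHessian, Matrix.of_apply]
  simp only [partialGradient, gradient_apply] at h2
  exact h2

theorem sum_smul_single (v : Euc n) : ∑ i, v i • EuclideanSpace.single i (1 : ℝ) = v := by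
  ext j
  simp [Finset.sum_apply, Pi.single_apply]

theorem dotProduct_hessianMatrix_mulVec {f : Euc n → ℝ} {y : Euc n}
    (h : DifferentiableAt ℝ (gradient f) y) (v w : Euc n) :
    v.ofLp ⬝ᵥ (hessianMatrix f y).mulVec w.ofLp = inner ℝ (fderiv ℝ (gradient f) y v) w := by
  have hv : fderiv ℝ (gradient f) y v =
      ∑ i, v i • fderiv ℝ (gradient f) y (EuclideanSpace.single i 1) := by
    conv_lhs => rw [← sum_smul_single v, map_sum]
    simp
  rw [hv, sum_inner]
  simp only [dotProduct, Matrix.mulVec, hessianMatrix_apply h]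
  refine Finset.sum_congr rfl fun i _ => ?_
  rw [inner_smul_left, PiLp.inner_apply]
  congr 1
  refine Finset.sum_congr rfl fun j _ => ?_
  simp [mul_comm]

end PartialGradient

/-! ### Integration against measures concentrated on a compact set -/

section IntegralsOnCompactSets

theorem integrable_of_continuousOn_of_measure_compl {α H : Type*} [TopologicalSpace α]
    [T2Space α] [MeasurableSpace α] [OpensMeasurableSpace α] [NormedAddCommGroup H]
    [SecondCountableTopologyEither α H]
    {ν : Measure α} [IsFiniteMeasure ν] {S : Set α} (hS : IsCompact S) (hν : ν Sᶜ = 0)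
    {f : α → H} (hf : ContinuousOn f S) : Integrable f ν := by
  have : ν.restrict S = ν := Measure.restrict_eq_self_of_ae_mem (mem_ae_iff.2 hν)
  rw [← this]
  exact hf.integrableOn_compact hS

theorem continuousOn_integral_of_measure_compl {α β H : Type*} [TopologicalSpace α]
    [T2Space α] [MeasurableSpace α] [OpensMeasurableSpace α] [TopologicalSpace β]
    [FirstCountableTopology β] [NormedAddCommGroup H] [NormedSpace ℝ H]
    [SecondCountableTopologyEither α H]
    {ν : Measure α} [IsFiniteMeasure ν] {S : Set α} {S' : Set β} (hS : IsCompact S)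
    (hS' : IsCompact S') (hν : ν Sᶜ = 0) {w : α × β → H} (hw : ContinuousOn w (S ×ˢ S')) :
    ContinuousOn (fun y => ∫ z, w (z, y) ∂ν) S' := by
  obtain ⟨M, hM⟩ := (hS.prod hS').exists_bound_of_continuousOn hw
  have hae : ∀ᵐ z ∂ν, z ∈ S := mem_ae_iff.2 hν
  refine continuousOn_of_dominated (bound := fun _ => M) (fun y hy => ?_) (fun y hy => ?_)
    (integrable_const M) ?_
  · refine (integrable_of_continuousOn_of_measure_compl hS hν ?_).aestronglyMeasurable
    exact hw.comp (by fun_prop) fun z hz => ⟨hz, hy⟩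
  · filter_upwards [hae] with z hz using hM _ ⟨hz, hy⟩
  · filter_upwards [hae] with z hz
    exact hw.comp (by fun_prop) fun y hy => ⟨hz, hy⟩

end IntegralsOnCompactSets

/-! ### Quadratic bounds from monotonicity of the gradient -/

section FirstOrder

variable {n : ℕ}

/-- Along the segment from y to y' the derivative at time s exceeds its initial value by at most K s
‖y' - y‖², and this bound is integrated. -/
theorem le_of_gradient_one_sided_lipschitz {Y : Set (Euc n)} (hYc : Convex ℝ Y) {f : Euc n → ℝ}
    {G : Euc n → Euc n} (hf : ∀ y ∈ Y, HasGradientAt f (G y) y) {K : ℝ} {y y' : Euc n}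
    (hy : y ∈ Y) (hy' : y' ∈ Y)
    (hG : ∀ z ∈ Y, inner ℝ (G z - G y) (z - y) ≤ K * ‖z - y‖ ^ 2) :
    f y' ≤ f y + inner ℝ (G y) (y' - y) + K / 2 * ‖y' - y‖ ^ 2 := by
  set d := y' - y
  have hmem : ∀ s ∈ Icc (0 : ℝ) 1, y + s • d ∈ Y := fun s hs =>
    hYc.add_smul_sub_mem hy hy' hs
  have := le_of_deriv_le_affine (ψ := fun s => f (y + s • d))
    (ψ' := fun s => inner ℝ (G (y + s • d)) d) (a := inner ℝ (G y) d) (b := K * ‖d‖ ^ 2)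
    (fun s hs => by
      have h1 : HasDerivAt (fun s : ℝ => y + s • d) d s := by
        simpa using ((hasDerivAt_id s).smul_const d).const_add y
      have h2 := ((hf _ (hmem s hs)).hasFDerivAt).comp_hasDerivAt s h1
      simpa [Function.comp_def] using h2)
    (fun s hs => by
      rcases hs.1.eq_or_lt with rfl | h0
      · simp
      have h1 := hG _ (hmem s hs)
      rw [add_sub_cancel_left, inner_smul_right, inner_sub_left, norm_smul, mul_pow,
        Real.norm_of_nonneg hs.1] at h1
      have h2 : s * (inner ℝ (G (y + s • d)) d - inner ℝ (G y) d) ≤ s * (K * ‖d‖ ^ 2 * s) := by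
        linarith
      have := le_of_mul_le_mul_left h2 h0
      linarith)
  simp only [one_smul, zero_smul, add_zero] at this
  rw [show y + d = y' by simp [d]] at this
  linarith

theorem ge_of_gradient_strongly_monotone {Y : Set (Euc n)} (hYc : Convex ℝ Y) {f : Euc n → ℝ}
    {G : Euc n → Euc n} (hf : ∀ y ∈ Y, HasGradientAt f (G y) y) {C : ℝ} {y y' : Euc n}
    (hy : y ∈ Y) (hy' : y' ∈ Y)
    (hG : ∀ z ∈ Y, C * ‖z - y‖ ^ 2 ≤ inner ℝ (G z - G y) (z - y)) :
    f y + inner ℝ (G y) (y' - y) + C / 2 * ‖y' - y‖ ^ 2 ≤ f y' := by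
  have := le_of_gradient_one_sided_lipschitz hYc (f := fun y => -f y) (G := fun y => -G y)
    (K := -C) (fun y hy => by
      have := (hf y hy).hasFDerivAt.fun_neg
      rw [hasGradientAt_iff_hasFDerivAt]
      simpa using this) hy hy' (fun z hz => by
      have := hG z hz
      rw [show -G z - -G y = -(G z - G y) by abel, inner_neg_left]
      linarith)
  rw [inner_neg_left] at this
  linarith

theorem inner_sub_ge_of_hessian {Y : Set (Euc n)} (hYc : Convex ℝ Y) {G : Euc n → Euc n}
    (hG : ∀ y ∈ Y, DifferentiableAt ℝ G y) {C : ℝ}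
    (hH : ∀ y ∈ Y, ∀ v, C * ‖v‖ ^ 2 ≤ inner ℝ (fderiv ℝ G y v) v) {y z : Euc n} (hy : y ∈ Y)
    (hz : z ∈ Y) : C * ‖z - y‖ ^ 2 ≤ inner ℝ (G z - G y) (z - y) := by
  set d := z - y
  have hmem : ∀ s ∈ Icc (0 : ℝ) 1, y + s • d ∈ Y := fun s hs =>
    hYc.add_smul_sub_mem hy hz hs
  have := le_of_deriv_le_affine (ψ := fun s => -inner ℝ (G (y + s • d)) d)
    (ψ' := fun s => -inner ℝ (fderiv ℝ G (y + s • d) d) d) (a := -(C * ‖d‖ ^ 2)) (b := 0)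
    (fun s hs => by
      have h1 : HasDerivAt (fun s : ℝ => y + s • d) d s := by
        simpa using ((hasDerivAt_id s).smul_const d).const_add y
      have h2 := ((hG _ (hmem s hs)).hasFDerivAt).comp_hasDerivAt s h1
      have h3 := (h2.inner ℝ (hasDerivAt_const s d)).fun_neg
      simpa using h3)
    (fun s hs => by
      have := hH _ (hmem s hs) d
      linarith)
  simp only [one_smul, zero_smul, add_zero] at this
  rw [show y + d = z by simp [d]] at this
  rw [inner_sub_left]
  linarith

end FirstOrder

/-! ### Minimizers of the strongly convex landscapes -/

/-- The first order properties of the strongly convex functions `y ↦ c(x, y) + R(y)`, with gradient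
`g(x, y) + r(y)`, which determine their minimizers. -/
structure IsConvexLandscape {m n : ℕ} (X : Set (Euc m)) (Y : Set (Euc n)) (c : Euc m → Euc n → ℝ)
    (R : Euc n → ℝ) (g : Euc m × Euc n → Euc n) (r : Euc n → Euc n) (C K : ℝ) : Prop where
  pos : 0 < C
  nonneg : 0 ≤ K
  continuousOn_cost : ContinuousOn (fun p : Euc m × Euc n => c p.1 p.2) (closure X ×ˢ closure Y)
  continuousOn_R : ContinuousOn R (closure Y)
  continuousOn_g : ContinuousOn g (closure X ×ˢ closure Y)
  lower : ∀ x ∈ X, ∀ y ∈ closure Y, ∀ y' ∈ closure Y,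
    c x y + R y + inner ℝ (g (x, y) + r y) (y' - y) + C / 2 * ‖y' - y‖ ^ 2 ≤ c x y' + R y'
  upper : ∀ x ∈ X, ∀ y ∈ closure Y, ∀ y' ∈ closure Y,
    c x y' + R y' ≤ c x y + R y + inner ℝ (g (x, y) + r y) (y' - y) + K / 2 * ‖y' - y‖ ^ 2
  lipschitz : ∀ x ∈ X, ∀ y ∈ closure Y, ∀ y' ∈ closure Y,
    ‖(g (x, y') + r y') - (g (x, y) + r y)‖ ≤ K * ‖y' - y‖
  outward : ∀ x ∈ X, ∀ y ∈ frontier Y, ∀ e, IsOutwardUnitNormal Y y e →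
    0 ≤ inner ℝ (g (x, y) + r y) e

namespace IsConvexLandscape

variable {m n : ℕ} {X : Set (Euc m)} {Y : Set (Euc n)} {c : Euc m → Euc n → ℝ}
  {R : Euc n → ℝ} {g : Euc m × Euc n → Euc n} {r : Euc n → Euc n} {C K : ℝ}

theorem strongly_monotone (h : IsConvexLandscape X Y c R g r C K) {x : Euc m} (hx : x ∈ X)
    {y y' : Euc n} (hy : y ∈ closure Y) (hy' : y' ∈ closure Y) :
    C * ‖y' - y‖ ^ 2 ≤ inner ℝ ((g (x, y') + r y') - (g (x, y) + r y)) (y' - y) := by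
  have h1 := h.lower x hx y hy y' hy'
  have h2 := h.lower x hx y' hy' y hy
  rw [← neg_sub y' y, inner_neg_right, norm_neg] at h2
  rw [inner_sub_left]
  linarith

/-- Minimality gives ⟨p, y' - y⟩ ≥ 0 on the closure of Y for the gradient p at y. If p ≠ 0, an
interior y can be moved along -p, while at a boundary point -p/‖p‖ is an outward unit normal and the
outward condition would give -‖p‖ ≥ 0. -/
theorem gradient_eq_zero_of_isMin (h : IsConvexLandscape X Y c R g r C K) (hYo : IsOpen Y)
    (hYc : Convex ℝ Y) {x : Euc m} (hx : x ∈ X) {y : Euc n} (hy : y ∈ closure Y)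
    (hmin : ∀ y' ∈ closure Y, c x y + R y ≤ c x y' + R y') : g (x, y) + r y = 0 := by
  set p := g (x, y) + r y
  have hvar : ∀ y' ∈ closure Y, 0 ≤ inner ℝ p (y' - y) := by
    intro y' hy'
    by_contra! hneg
    -- The quadratic upper bound replaces differentiability, which is not available at boundary
    -- points: divide by t and let t tend to 0.
    have key : ∀ t ∈ Ioc (0 : ℝ) 1, 0 ≤ inner ℝ p (y' - y) + t * (K / 2 * ‖y' - y‖ ^ 2) := by
      intro t ht
      have hmem : y + t • (y' - y) ∈ closure Y :=
        hYc.closure.add_smul_sub_mem hy hy' ⟨ht.1.le, ht.2⟩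
      have h1 := h.upper x hx y hy _ hmem
      have h2 := hmin _ hmem
      rw [add_sub_cancel_left, inner_smul_right, norm_smul, mul_pow,
        Real.norm_of_nonneg ht.1.le] at h1
      have h3 : 0 ≤ t * (inner ℝ p (y' - y) + t * (K / 2 * ‖y' - y‖ ^ 2)) := by linarith
      exact nonneg_of_mul_nonneg_right h3 ht.1
    have hlim : Tendsto (fun t : ℝ => inner ℝ p (y' - y) + t * (K / 2 * ‖y' - y‖ ^ 2)) (𝓝[>] 0)
        (𝓝 (inner ℝ p (y' - y) + 0 * (K / 2 * ‖y' - y‖ ^ 2))) :=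
      (tendsto_const_nhds.add (tendsto_id.mul_const _)).mono_left nhdsWithin_le_nhds
    rw [zero_mul, add_zero] at hlim
    have := ge_of_tendsto hlim (by
      filter_upwards [Ioc_mem_nhdsGT (zero_lt_one' ℝ)] with t ht using key t ht)
    linarith
  by_contra hp
  have hp' : 0 < ‖p‖ := norm_pos_iff.2 hp
  by_cases hyY : y ∈ Y
  · obtain ⟨δ, hδ, hball⟩ := Metric.isOpen_iff.1 hYo y hyY
    have hmem : y - (δ / 2 / ‖p‖) • p ∈ Y := by
      refine hball ?_
      rw [Metric.mem_ball, dist_eq_norm, sub_sub_cancel_left, norm_neg, norm_smul,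
        Real.norm_of_nonneg (by positivity), div_mul_cancel₀ _ hp'.ne']
      linarith
    have := hvar _ (subset_closure hmem)
    rw [sub_sub_cancel_left, inner_neg_right, inner_smul_right, real_inner_self_eq_norm_sq] at this
    have h2 : 0 < δ / 2 / ‖p‖ * ‖p‖ ^ 2 := by positivity
    linarith
  · have hfr : y ∈ frontier Y := by
      rw [hYo.frontier_eq]
      exact ⟨hy, hyY⟩
    have hn : IsOutwardUnitNormal Y y (-(‖p‖⁻¹ • p)) := by
      refine ⟨by rw [norm_neg, norm_smul, norm_inv, norm_norm, inv_mul_cancel₀ hp'.ne'], ?_⟩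
      intro y' hy'
      rw [inner_neg_left, inner_smul_left]
      have := hvar y' (subset_closure hy')
      have h2 : 0 ≤ ‖p‖⁻¹ * inner ℝ p (y' - y) := by positivity
      simpa using h2
    have := h.outward x hx y hfr _ hn
    rw [inner_neg_right, inner_smul_right, real_inner_self_eq_norm_sq] at this
    have h2 : 0 < ‖p‖⁻¹ * ‖p‖ ^ 2 := by positivity
    linarith

/-- The minimizer map `T`, extended by a constant outside `X`. -/
theorem exists_argmin (h : IsConvexLandscape X Y c R g r C K) (hYb : Bornology.IsBounded Y)
    (hYo : IsOpen Y) (hYc : Convex ℝ Y) (hYne : Y.Nonempty) :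
    ∃ T : Euc m → Euc n, (∀ x, T x ∈ closure Y) ∧ ContinuousOn T X ∧
      (∀ x ∈ X, g (x, T x) + r (T x) = 0) ∧
      (∀ x ∈ X, ∀ y ∈ closure Y,
        c x (T x) + R (T x) + C / 2 * ‖y - T x‖ ^ 2 ≤ c x y + R y) ∧
      ∀ x ∈ X, ∀ y ∈ closure Y, g (x, y) + r y = 0 → y = T x := by
  have hcomp : IsCompact (closure Y) := hYb.isCompact_closure
  have hex : ∀ x, ∃ y ∈ closure Y, x ∈ X → ∀ y' ∈ closure Y, c x y + R y ≤ c x y' + R y' := by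
    intro x
    by_cases hx : x ∈ X
    · have hcont : ContinuousOn (fun y => c x y + R y) (closure Y) :=
        (h.continuousOn_cost.comp (f := fun y => (x, y)) (by fun_prop)
          fun y hy => ⟨subset_closure hx, hy⟩).add h.continuousOn_R
      obtain ⟨y, hy, hmin⟩ := hcomp.exists_isMinOn hYne.closure hcont
      exact ⟨y, hy, fun _ y' hy' => hmin hy'⟩
    · obtain ⟨y, hy⟩ := hYne
      exact ⟨y, subset_closure hy, fun hx' => absurd hx' hx⟩
  choose T hT hmin using hex
  have hzero : ∀ x ∈ X, g (x, T x) + r (T x) = 0 := fun x hx =>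
    h.gradient_eq_zero_of_isMin hYo hYc hx (hT x) (hmin x hx)
  refine ⟨T, hT, fun x hx => ?_, hzero, fun x hx y hy => ?_, fun x hx y hy h0 => ?_⟩
  -- Strong monotonicity at x' between T x and T x'. Both critical point equations enter, and r
  -- cancels.
  · have hest : ∀ x' ∈ X, C * ‖T x' - T x‖ ≤ ‖g (x', T x) - g (x, T x)‖ := by
      intro x' hx'
      rcases eq_or_ne (T x') (T x) with heq | hne
      · rw [heq, sub_self, norm_zero, mul_zero]
        exact norm_nonneg _
      have h1 := h.strongly_monotone hx' (hT x) (hT x')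
      rw [hzero x' hx', zero_sub] at h1
      have h2 : -(g (x', T x) + r (T x)) = -(g (x', T x) - g (x, T x)) := by
        rw [eq_neg_of_add_eq_zero_left (hzero x hx)]
        abel
      rw [h2] at h1
      have h3 := h1.trans (real_inner_le_norm _ _)
      rw [norm_neg, pow_two, ← mul_assoc] at h3
      exact le_of_mul_le_mul_right h3 (norm_pos_iff.2 (sub_ne_zero.2 hne))
    have hc : ContinuousWithinAt (fun x' => g (x', T x)) X x :=
      (h.continuousOn_g.comp (f := fun x' => (x', T x)) (s := X) (by fun_prop)
        fun x' hx' => ⟨subset_closure hx', hT x⟩) x hx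
    rw [ContinuousWithinAt, tendsto_iff_norm_sub_tendsto_zero] at hc ⊢
    have hc' := hc.const_mul C⁻¹
    rw [mul_zero] at hc'
    refine squeeze_zero' (Eventually.of_forall fun _ => norm_nonneg _) ?_ hc'
    filter_upwards [self_mem_nhdsWithin] with x' hx'
    have := hest x' hx'
    rwa [← div_eq_inv_mul, le_div_iff₀' h.pos]
  · have := h.lower x hx (T x) (hT x) y hy
    rw [hzero x hx, inner_zero_left, add_zero] at this
    exact this
  · have := h.strongly_monotone hx hy (hT x)
    rw [hzero x hx, h0, sub_zero, inner_zero_left] at this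
    have h2 : ‖T x - y‖ ^ 2 ≤ 0 := by
      by_contra! hlt
      have := mul_pos h.pos hlt
      linarith
    have h3 : ‖T x - y‖ = 0 := by
      rw [← sq_eq_zero_iff]
      exact le_antisymm h2 (sq_nonneg _)
    exact (sub_eq_zero.1 (norm_eq_zero.1 h3)).symm

end IsConvexLandscape

/-! ### The mean field as a convex landscape -/

section MeanField

variable {m n : ℕ}

/-- The function `V + ∫ W(z, ·) dν(z)`. -/
noncomputable def meanField (V : Euc n → ℝ) (W : Euc n → Euc n → ℝ) (ν : Measure (Euc n))
    (y : Euc n) : ℝ :=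
  V y + ∫ z, W z y ∂ν

/-- The gradient in `y` of `W(z, y) + V(y)`, as a function of `(z, y)`. -/
noncomputable def interactionGradient (V : Euc n → ℝ) (W : Euc n → Euc n → ℝ)
    (p : Euc n × Euc n) : Euc n :=
  partialGradient W p + gradient V p.2

/-- The gradient of `meanField` up to the boundary of `Y`. -/
noncomputable def meanFieldGradient (Y : Set (Euc n)) (V : Euc n → ℝ) (W : Euc n → Euc n → ℝ)
    (ν : Measure (Euc n)) (y : Euc n) : Euc n :=
  ∫ z, extendFrom (Y ×ˢ Y) (interactionGradient V W) (z, y) ∂ν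

theorem isC1UpToBoundary_interactionGradient {Y : Set (Euc n)} (hYo : IsOpen Y) {V : Euc n → ℝ}
    {W : Euc n → Euc n → ℝ} (hV : IsC2UpToBoundary Y V)
    (hW : IsC2UpToBoundary (Y ×ˢ Y) (fun p : Euc n × Euc n => W p.1 p.2)) :
    IsC1UpToBoundary (Y ×ˢ Y) (interactionGradient V W) :=
  (isC1UpToBoundary_partialGradient (hYo.prod hYo) hW).add
    ((isC1UpToBoundary_gradient hYo hV).comp_snd hYo) (hYo.prod hYo)

theorem hessianMatrix_congr {f f' : Euc n → ℝ} {y : Euc n} (h : f =ᶠ[𝓝 y] f') :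
    hessianMatrix f y = hessianMatrix f' y := by
  ext i j
  simp only [hessianMatrix, Matrix.of_apply]
  have : (fun y' => fderiv ℝ f y' (EuclideanSpace.single j 1)) =ᶠ[𝓝 y]
      fun y' => fderiv ℝ f' y' (EuclideanSpace.single j 1) := by
    filter_upwards [h.fderiv (𝕜 := ℝ)] with y' hy'
    rw [hy']
  rw [this.fderiv_eq]

theorem gradient_congr {f f' : Euc n → ℝ} {y : Euc n} (h : f =ᶠ[𝓝 y] f') :
    gradient f y = gradient f' y := by
  rw [gradient, gradient, h.fderiv_eq]

theorem eventuallyEq_swap {Y : Set (Euc n)} (hYo : IsOpen Y) {W : Euc n → Euc n → ℝ}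
    (hWsymm : ∀ y ∈ closure Y, ∀ z ∈ closure Y, W y z = W z y) {y z : Euc n} (hy : y ∈ Y)
    (hz : z ∈ Y) : (fun y' => W y' z) =ᶠ[𝓝 y] W z := by
  filter_upwards [hYo.mem_nhds hy] with y' hy'
  exact hWsymm y' (subset_closure hy') z (subset_closure hz)

theorem differentiableAt_curry_right {Q P H : Type*} [NormedAddCommGroup Q] [NormedSpace ℝ Q]
    [NormedAddCommGroup P] [NormedSpace ℝ P] [NormedAddCommGroup H] [NormedSpace ℝ H]
    {G : Q × P → H} {q : Q} {y : P} (h : DifferentiableAt ℝ G (q, y)) :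
    DifferentiableAt ℝ (fun y => G (q, y)) y :=
  DifferentiableAt.comp (g := G) (f := fun y => (q, y)) y h
    (hasFDerivAt_prodMk_right q y).differentiableAt

theorem hasGradientAt_curry {Q : Type*} [NormedAddCommGroup Q] [NormedSpace ℝ Q]
    {Ω : Set (Q × Euc n)} (hΩ : IsOpen Ω) {f : Q → Euc n → ℝ}
    (hf : ContDiffOn ℝ 2 (fun p : Q × Euc n => f p.1 p.2) Ω) {p : Q × Euc n} (hp : p ∈ Ω) :
    HasGradientAt (f p.1) (partialGradient f p) p.2 :=
  (hasFDerivAt_curry hΩ hf hp).differentiableAt.hasGradientAt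

variable {X : Set (Euc m)} {Y : Set (Euc n)} {c : Euc m → Euc n → ℝ} {V : Euc n → ℝ}
  {W : Euc n → Euc n → ℝ}

theorem inner_interaction_ge (hXo : IsOpen X) (hYo : IsOpen Y) (hYc : Convex ℝ Y)
    (hc : IsC2UpToBoundary (X ×ˢ Y) (fun p : Euc m × Euc n => c p.1 p.2))
    (hV : IsC2UpToBoundary Y V)
    (hW : IsC2UpToBoundary (Y ×ˢ Y) (fun p : Euc n × Euc n => W p.1 p.2))
    (hWsymm : ∀ y ∈ closure Y, ∀ z ∈ closure Y, W y z = W z y) {C : ℝ}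
    (hC : ∀ x ∈ X, ∀ y ∈ Y, ∀ z ∈ Y,
    (hessianMatrix (fun y' => c x y') y + hessianMatrix V y + hessianMatrix (fun y' => W y' z) y
      - C • (1 : Matrix (Fin n) (Fin n) ℝ)).PosSemidef)
    {x : Euc m} (hx : x ∈ X) {z : Euc n} (hz : z ∈ Y) {y y' : Euc n} (hy : y ∈ Y) (hy' : y' ∈ Y) :
    C * ‖y' - y‖ ^ 2 ≤ inner ℝ ((partialGradient c (x, y') + interactionGradient V W (z, y')) -
      (partialGradient c (x, y) + interactionGradient V W (z, y))) (y' - y) := by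
  have hcd : ∀ y ∈ Y, DifferentiableAt ℝ (gradient (c x)) y := fun y hy =>
    differentiableAt_curry_right ((isC1UpToBoundary_partialGradient (hXo.prod hYo)
      hc).differentiableAt (hXo.prod hYo) (x := (x, y)) ⟨hx, hy⟩)
  have hWd : ∀ y ∈ Y, DifferentiableAt ℝ (gradient (W z)) y := fun y hy =>
    differentiableAt_curry_right ((isC1UpToBoundary_partialGradient (hYo.prod hYo)
      hW).differentiableAt (hYo.prod hYo) (x := (z, y)) ⟨hz, hy⟩)
  have hVd : ∀ y ∈ Y, DifferentiableAt ℝ (gradient V) y := fun y hy =>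
    (isC1UpToBoundary_gradient hYo hV).differentiableAt hYo hy
  refine inner_sub_ge_of_hessian hYc
    (G := fun y => gradient (c x) y + (gradient (W z) y + gradient V y))
    (fun y hy => (hcd y hy).add ((hWd y hy).add (hVd y hy))) (fun y hy v => ?_) hy hy'
  have hfd : fderiv ℝ (fun y => gradient (c x) y + (gradient (W z) y + gradient V y)) y =
      fderiv ℝ (gradient (c x)) y + (fderiv ℝ (gradient (W z)) y + fderiv ℝ (gradient V) y) :=
    ((hcd y hy).hasFDerivAt.add ((hWd y hy).hasFDerivAt.add (hVd y hy).hasFDerivAt)).fderiv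
  have h1 := (hC x hx y hy z hz).dotProduct_mulVec_nonneg v.ofLp
  rw [hessianMatrix_congr (eventuallyEq_swap hYo hWsymm hy hz), Matrix.sub_mulVec,
    Matrix.add_mulVec, Matrix.add_mulVec, dotProduct_sub, dotProduct_add, dotProduct_add,
    star_trivial, dotProduct_hessianMatrix_mulVec (hcd y hy),
    dotProduct_hessianMatrix_mulVec (hVd y hy), dotProduct_hessianMatrix_mulVec (hWd y hy),
    Matrix.smul_mulVec, Matrix.one_mulVec, dotProduct_smul] at h1
  have h2 : v.ofLp ⬝ᵥ v.ofLp = ‖v‖ ^ 2 := by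
    rw [EuclideanSpace.real_norm_sq_eq]
    simp [dotProduct, pow_two]
  rw [h2, smul_eq_mul] at h1
  rw [hfd]
  simp only [add_apply, inner_add_left]
  linarith

theorem sub_le_integral_of_le {α : Type*} [MeasurableSpace α] {ν : Measure α}
    [IsProbabilityMeasure ν] {h : α → ℝ} {a : ℝ} (hi : Integrable h ν) (ha : ∀ᵐ z ∂ν, a ≤ h z) :
    a ≤ ∫ z, h z ∂ν := by
  have := integral_mono_ae (integrable_const a) hi ha
  simpa using this

/-- For fixed z all the bounds hold for c(x, ·) + W(z, ·) + V at interior points. They extend by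
continuity to boundary values of z, y and y', and are then averaged in z against the probability
measure ν. The extension in z matters because at this stage ν is only known to live on the closure
of Y. -/
theorem exists_isConvexLandscape (hXo : IsOpen X) (hXb : Bornology.IsBounded X)
    (hYo : IsOpen Y) (hYb : Bornology.IsBounded Y) (hYc : Convex ℝ Y)
    (hc : IsC2UpToBoundary (X ×ˢ Y) (fun p : Euc m × Euc n => c p.1 p.2))
    (hV : IsC2UpToBoundary Y V)
    (hW : IsC2UpToBoundary (Y ×ˢ Y) (fun p : Euc n × Euc n => W p.1 p.2))
    (hWsymm : ∀ y ∈ closure Y, ∀ z ∈ closure Y, W y z = W z y)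
    (hconv : IsUniformlyConvexSum X Y c V W) (hout : HasOutwardGradient X Y c V W)
    {ν : Measure (Euc n)} (hν : IsProbabilityOn (closure Y) ν) :
    ∃ C K, IsConvexLandscape X Y c (meanField V W ν)
      (extendFrom (X ×ˢ Y) (partialGradient c)) (meanFieldGradient Y V W ν) C K := by
  have := hν.1
  have hcX : IsCompact (closure X) := hXb.isCompact_closure
  have hcY : IsCompact (closure Y) := hYb.isCompact_closure
  have hgc := isC1UpToBoundary_partialGradient (hXo.prod hYo) hc
  have hgw := isC1UpToBoundary_interactionGradient hYo hV hW
  obtain ⟨C, hC0, hC⟩ := hconv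
  obtain ⟨K₁, hK₁0, hK₁⟩ := exists_lipschitz_snd hgc hXo hYo hYc
    (by rw [closure_prod_eq]; exact hcX.prod hcY)
  obtain ⟨K₂, hK₂0, hK₂⟩ := exists_lipschitz_snd hgw hYo hYo hYc
    (by rw [closure_prod_eq]; exact hcY.prod hcY)
  set gc := extendFrom (X ×ˢ Y) (partialGradient c)
  set gw := extendFrom (Y ×ˢ Y) (interactionGradient V W) with hgw_def
  have hgc_cont : ContinuousOn gc (closure X ×ˢ closure Y) := by
    rw [← closure_prod_eq]; exact hgc.continuousOn_extendFrom
  have hgw_cont : ContinuousOn gw (closure Y ×ˢ closure Y) := by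
    rw [← closure_prod_eq]; exact hgw.continuousOn_extendFrom
  have hgc_eq : ∀ x ∈ X, ∀ y ∈ Y, gc (x, y) = partialGradient c (x, y) := fun x hx y hy =>
    hgc.extendFrom_eq ⟨hx, hy⟩
  have hgw_eq : ∀ z ∈ Y, ∀ y ∈ Y, gw (z, y) = interactionGradient V W (z, y) := fun z hz y hy =>
    hgw.extendFrom_eq ⟨hz, hy⟩
  have hc_cont : ContinuousOn (fun p : Euc m × Euc n => c p.1 p.2) (closure X ×ˢ closure Y) := by
    rw [← closure_prod_eq]; exact hc.1
  have hW_cont : ContinuousOn (fun p : Euc n × Euc n => W p.1 p.2) (closure Y ×ˢ closure Y) := by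
    rw [← closure_prod_eq]; exact hW.1
  have hgrad : ∀ x ∈ X, ∀ z ∈ Y, ∀ y ∈ Y, HasGradientAt (fun y => c x y + (W z y + V y))
      (partialGradient c (x, y) + interactionGradient V W (z, y)) y := by
    intro x hx z hz y hy
    have h1 := hasGradientAt_curry (hXo.prod hYo) hc.2.1 (p := (x, y)) ⟨hx, hy⟩
    have h2 := hasGradientAt_curry (hYo.prod hYo) hW.2.1 (p := (z, y)) ⟨hz, hy⟩
    have h3 : HasGradientAt V (gradient V y) y := ((hV.2.1.contDiffAt
      (hYo.mem_nhds hy)).differentiableAt two_ne_zero).hasGradientAt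
    have := h1.hasFDerivAt.add (h2.hasFDerivAt.add h3.hasFDerivAt)
    rw [hasGradientAt_iff_hasFDerivAt, interactionGradient, map_add, map_add]
    exact this
  have hLip : ∀ x ∈ X, ∀ z ∈ Y, ∀ y ∈ Y, ∀ y' ∈ Y,
      ‖(gc (x, y') + gw (z, y')) - (gc (x, y) + gw (z, y))‖ ≤ (K₁ + K₂) * ‖y' - y‖ := by
    intro x hx z hz y hy y' hy'
    rw [hgc_eq x hx y hy, hgc_eq x hx y' hy', hgw_eq z hz y hy, hgw_eq z hz y' hy']
    rw [add_sub_add_comm, add_mul]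
    exact (norm_add_le _ _).trans (add_le_add (hK₁ x hx y hy y' hy') (hK₂ z hz y hy y' hy'))
  have hLow : ∀ x ∈ X, ∀ z ∈ Y, ∀ y ∈ Y, ∀ y' ∈ Y, c x y + (W z y + V y) +
      inner ℝ (gc (x, y) + gw (z, y)) (y' - y) + C / 2 * ‖y' - y‖ ^ 2 ≤
        c x y' + (W z y' + V y') := by
    intro x hx z hz y hy y' hy'
    rw [hgc_eq x hx y hy, hgw_eq z hz y hy]
    exact ge_of_gradient_strongly_monotone hYc (hgrad x hx z hz) hy hy' fun w hw =>
      inner_interaction_ge hXo hYo hYc hc hV hW hWsymm hC hx hz hy hw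
  have hUp : ∀ x ∈ X, ∀ z ∈ Y, ∀ y ∈ Y, ∀ y' ∈ Y, c x y' + (W z y' + V y') ≤
      c x y + (W z y + V y) + inner ℝ (gc (x, y) + gw (z, y)) (y' - y) +
        (K₁ + K₂) / 2 * ‖y' - y‖ ^ 2 := by
    intro x hx z hz y hy y' hy'
    rw [hgc_eq x hx y hy, hgw_eq z hz y hy]
    refine le_of_gradient_one_sided_lipschitz hYc (hgrad x hx z hz) hy hy' fun w hw => ?_
    have := hLip x hx z hz y hy w hw
    rw [hgc_eq x hx y hy, hgw_eq z hz y hy, hgc_eq x hx w hw, hgw_eq z hz w hw] at this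
    refine (real_inner_le_norm _ _).trans ?_
    calc _ ≤ (K₁ + K₂) * ‖w - y‖ * ‖w - y‖ := by gcongr
      _ = _ := by ring
  -- The triples are (z, y, y'); every inequality is closed and passes from S to its closure.
  set S : Set (Euc n × Euc n × Euc n) := Y ×ˢ Y ×ˢ Y
  have hScl : closure S = closure Y ×ˢ closure Y ×ˢ closure Y := by
    simp only [S, closure_prod_eq]
  have ext_le : ∀ {f₁ f₂ : Euc n × Euc n × Euc n → ℝ}, ContinuousOn f₁ (closure S) →
      ContinuousOn f₂ (closure S) → (∀ p ∈ S, f₁ p ≤ f₂ p) → ∀ p ∈ closure S, f₁ p ≤ f₂ p :=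
    fun h₁ h₂ h p hp => ContinuousWithinAt.closure_le hp
      ((h₁ p hp).mono subset_closure) ((h₂ p hp).mono subset_closure) h
  have cc : ∀ x ∈ X, ContinuousOn (c x) (closure Y) := fun x hx =>
    hc_cont.comp (f := fun y => (x, y)) (by fun_prop) fun y hy => ⟨subset_closure hx, hy⟩
  have cg : ∀ x ∈ X, ContinuousOn (fun y => gc (x, y)) (closure Y) := fun x hx =>
    hgc_cont.comp (f := fun y => (x, y)) (by fun_prop) fun y hy => ⟨subset_closure hx, hy⟩
  have m1 : MapsTo (fun p : Euc n × Euc n × Euc n => p.2.1) (closure S) (closure Y) := by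
    rw [hScl]; exact fun p hp => hp.2.1
  have m2 : MapsTo (fun p : Euc n × Euc n × Euc n => p.2.2) (closure S) (closure Y) := by
    rw [hScl]; exact fun p hp => hp.2.2
  have k1 : ∀ x ∈ X, ContinuousOn (fun p : Euc n × Euc n × Euc n => c x p.2.1) (closure S) :=
    fun x hx => (cc x hx).comp (by fun_prop) m1
  have k2 : ∀ x ∈ X, ContinuousOn (fun p : Euc n × Euc n × Euc n => c x p.2.2) (closure S) :=
    fun x hx => (cc x hx).comp (by fun_prop) m2
  have k3 : ContinuousOn (fun p : Euc n × Euc n × Euc n => V p.2.1) (closure S) :=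
    hV.1.comp (by fun_prop) m1
  have k4 : ContinuousOn (fun p : Euc n × Euc n × Euc n => V p.2.2) (closure S) :=
    hV.1.comp (by fun_prop) m2
  have k5 : ContinuousOn (fun p : Euc n × Euc n × Euc n => W p.1 p.2.1) (closure S) :=
    hW_cont.comp (f := fun p : Euc n × Euc n × Euc n => (p.1, p.2.1)) (by fun_prop)
      (by rw [hScl]; exact fun p hp => ⟨hp.1, hp.2.1⟩)
  have k6 : ContinuousOn (fun p : Euc n × Euc n × Euc n => W p.1 p.2.2) (closure S) :=
    hW_cont.comp (f := fun p : Euc n × Euc n × Euc n => (p.1, p.2.2)) (by fun_prop)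
      (by rw [hScl]; exact fun p hp => ⟨hp.1, hp.2.2⟩)
  have k7 : ContinuousOn (fun p : Euc n × Euc n × Euc n => gw (p.1, p.2.1)) (closure S) :=
    hgw_cont.comp (f := fun p : Euc n × Euc n × Euc n => (p.1, p.2.1)) (by fun_prop)
      (by rw [hScl]; exact fun p hp => ⟨hp.1, hp.2.1⟩)
  have k8 : ContinuousOn (fun p : Euc n × Euc n × Euc n => gw (p.1, p.2.2)) (closure S) :=
    hgw_cont.comp (f := fun p : Euc n × Euc n × Euc n => (p.1, p.2.2)) (by fun_prop)
      (by rw [hScl]; exact fun p hp => ⟨hp.1, hp.2.2⟩)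
  have k9 : ∀ x ∈ X, ContinuousOn (fun p : Euc n × Euc n × Euc n => gc (x, p.2.1)) (closure S) :=
    fun x hx => (cg x hx).comp (by fun_prop) m1
  have k10 : ∀ x ∈ X, ContinuousOn (fun p : Euc n × Euc n × Euc n => gc (x, p.2.2)) (closure S) :=
    fun x hx => (cg x hx).comp (by fun_prop) m2
  have hLip' : ∀ x ∈ X, ∀ p ∈ closure S,
      ‖(gc (x, p.2.2) + gw (p.1, p.2.2)) - (gc (x, p.2.1) + gw (p.1, p.2.1))‖ ≤
        (K₁ + K₂) * ‖p.2.2 - p.2.1‖ := fun x hx =>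
    ext_le (((k10 x hx).add k8).sub ((k9 x hx).add k7)).norm (by fun_prop)
      fun p hp => hLip x hx p.1 hp.1 p.2.1 hp.2.1 p.2.2 hp.2.2
  have hLow' : ∀ x ∈ X, ∀ p ∈ closure S, c x p.2.1 + (W p.1 p.2.1 + V p.2.1) +
      inner ℝ (gc (x, p.2.1) + gw (p.1, p.2.1)) (p.2.2 - p.2.1) + C / 2 * ‖p.2.2 - p.2.1‖ ^ 2 ≤
        c x p.2.2 + (W p.1 p.2.2 + V p.2.2) := fun x hx =>
    ext_le ((((k1 x hx).add (k5.add k3)).add (((k9 x hx).add k7).inner (𝕜 := ℝ) (by fun_prop))).add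
      (by fun_prop)) ((k2 x hx).add (k6.add k4))
      fun p hp => hLow x hx p.1 hp.1 p.2.1 hp.2.1 p.2.2 hp.2.2
  have hUp' : ∀ x ∈ X, ∀ p ∈ closure S, c x p.2.2 + (W p.1 p.2.2 + V p.2.2) ≤
      c x p.2.1 + (W p.1 p.2.1 + V p.2.1) +
      inner ℝ (gc (x, p.2.1) + gw (p.1, p.2.1)) (p.2.2 - p.2.1) +
        (K₁ + K₂) / 2 * ‖p.2.2 - p.2.1‖ ^ 2 := fun x hx =>
    ext_le ((k2 x hx).add (k6.add k4)) ((((k1 x hx).add (k5.add k3)).add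
      (((k9 x hx).add k7).inner (𝕜 := ℝ) (by fun_prop))).add (by fun_prop))
      fun p hp => hUp x hx p.1 hp.1 p.2.1 hp.2.1 p.2.2 hp.2.2
  rw [hScl] at hLip' hLow' hUp'
  have hae : ∀ᵐ z ∂ν, z ∈ closure Y := mem_ae_iff.2 hν.2
  have iW : ∀ y ∈ closure Y, Integrable (fun z => W z y) ν := fun y hy =>
    integrable_of_continuousOn_of_measure_compl hcY hν.2
      (hW_cont.comp (f := fun z => (z, y)) (by fun_prop) fun z hz => ⟨hz, hy⟩)
  have ig : ∀ y ∈ closure Y, Integrable (fun z => gw (z, y)) ν := fun y hy =>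
    integrable_of_continuousOn_of_measure_compl hcY hν.2
      (hgw_cont.comp (f := fun z => (z, y)) (by fun_prop) fun z hz => ⟨hz, hy⟩)
  have igi : ∀ y ∈ closure Y, ∀ v : Euc n, Integrable (fun z => inner ℝ (gw (z, y)) v) ν :=
    fun y hy v => (ig y hy).inner_const v
  have hint : ∀ y ∈ closure Y, ∀ v : Euc n,
      ∫ z, inner ℝ (gw (z, y)) v ∂ν = inner ℝ (meanFieldGradient Y V W ν y) v := by
    intro y hy v
    simp_rw [real_inner_comm v]
    exact (integral_inner (ig y hy) v)
  have hcomb : ∀ y ∈ closure Y, ∀ y' ∈ closure Y,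
      ∫ z, (W z y' - W z y - inner ℝ (gw (z, y)) (y' - y)) ∂ν =
        (∫ z, W z y' ∂ν) - (∫ z, W z y ∂ν) -
          inner ℝ (meanFieldGradient Y V W ν y) (y' - y) := by
    intro y hy y' hy'
    have e1 := integral_sub (f := fun z => W z y' - W z y) ((iW y' hy').sub (iW y hy))
      (igi y hy (y' - y))
    rw [e1, integral_sub (iW y' hy') (iW y hy), hint y hy]
  refine ⟨C, K₁ + K₂, hC0, add_nonneg hK₁0 hK₂0, hc_cont, ?_, hgc_cont, ?_, ?_, ?_, ?_⟩
  · exact hV.1.add (continuousOn_integral_of_measure_compl hcY hcY hν.2 hW_cont)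
  · intro x hx y hy y' hy'
    -- The terms that do not depend on z form the constant a, which survives averaging because ν has
    -- mass one.
    have := sub_le_integral_of_le (a := c x y + V y + inner ℝ (gc (x, y)) (y' - y) +
      C / 2 * ‖y' - y‖ ^ 2 - c x y' - V y')
      (((iW y' hy').sub (iW y hy)).sub (igi y hy (y' - y)))
      (hae.mono fun z hz => by
        have := hLow' x hx (z, y, y') ⟨hz, hy, hy'⟩
        simp only [inner_add_left] at this
        simp only [Pi.sub_apply]
        linarith)
    simp only [Pi.sub_apply] at this
    rw [hcomb y hy y' hy'] at this
    simp only [meanField, inner_add_left]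
    linarith
  · intro x hx y hy y' hy'
    have := sub_le_integral_of_le (a := -(c x y + V y + inner ℝ (gc (x, y)) (y' - y) +
      (K₁ + K₂) / 2 * ‖y' - y‖ ^ 2 - c x y' - V y'))
      (((iW y' hy').sub (iW y hy)).sub (igi y hy (y' - y))).neg
      (hae.mono fun z hz => by
        have := hUp' x hx (z, y, y') ⟨hz, hy, hy'⟩
        simp only [inner_add_left] at this
        simp only [Pi.sub_apply, Pi.neg_apply]
        linarith)
    simp only [Pi.sub_apply, Pi.neg_apply] at this
    rw [integral_neg, hcomb y hy y' hy'] at this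
    simp only [meanField, inner_add_left]
    linarith
  · intro x hx y hy y' hy'
    have h1 : (gc (x, y') + meanFieldGradient Y V W ν y') -
        (gc (x, y) + meanFieldGradient Y V W ν y) =
        ∫ z, ((gc (x, y') + gw (z, y')) - (gc (x, y) + gw (z, y))) ∂ν := by
      rw [integral_sub (f := fun z => gc (x, y') + gw (z, y'))
        (g := fun z => gc (x, y) + gw (z, y)) ((integrable_const _).add (ig y' hy'))
        ((integrable_const _).add (ig y hy)), integral_add (integrable_const _) (ig y' hy'),
        integral_add (integrable_const _) (ig y hy)]
      simp [meanFieldGradient, gw]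
    rw [h1]
    have := norm_integral_le_of_norm_le_const (μ := ν)
      (f := fun z => (gc (x, y') + gw (z, y')) - (gc (x, y) + gw (z, y)))
      (C := (K₁ + K₂) * ‖y' - y‖) (hae.mono fun z hz => hLip' x hx (z, y, y') ⟨hz, hy, hy'⟩)
    simpa using this
  · intro x hx y hy e he
    have hycl : y ∈ closure Y := frontier_subset_closure hy
    have hpt : ∀ z ∈ Y, 0 ≤ inner ℝ (gc (x, y) + gw (z, y)) e := by
      intro z hz
      have h1 := hout x hx z hz y hy e he
      -- The boundary value of the summed gradient is the sum of the separate extensions, by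
      -- uniqueness of limits; the symmetry of W exchanges its two arguments.
      rwa [_root_.extendFrom_eq hycl (y := gc (x, y) + gw (z, y))] at h1
      have h2 : ContinuousWithinAt (fun w => gc (x, w) + gw (z, w)) Y y :=
        (((cg x hx) y hycl).mono subset_closure).add
          ((hgw_cont.comp (f := fun w => (z, w)) (s := closure Y) (by fun_prop) (fun w hw =>
            ⟨subset_closure hz, hw⟩) y hycl).mono subset_closure)
      refine tendsto_nhdsWithin_congr (fun w hw => ?_) h2
      rw [hgc_eq x hx w hw, hgw_eq z hz w hw, interactionGradient, partialGradient,
        partialGradient, gradient_congr (eventuallyEq_swap hYo hWsymm hw hz)]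
      simp only
      abel
    have hpt' : ∀ z ∈ closure Y, 0 ≤ inner ℝ (gc (x, y) + gw (z, y)) e := by
      intro z hz
      refine ContinuousWithinAt.closure_le (f := fun _ => (0 : ℝ))
        (g := fun z => inner ℝ (gc (x, y) + gw (z, y)) e) hz continuousWithinAt_const
        ?_ hpt
      have h2 : ContinuousOn (fun z => gw (z, y)) (closure Y) :=
        hgw_cont.comp (f := fun z => (z, y)) (by fun_prop) fun w hw => ⟨hw, hycl⟩
      exact ((continuousWithinAt_const.add ((h2 z hz).mono subset_closure)).inner (𝕜 := ℝ)
        continuousWithinAt_const)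
    rw [inner_add_left, ← hint y hycl]
    have := sub_le_integral_of_le (a := -inner ℝ (gc (x, y)) e) (igi y hycl e)
      (hae.mono fun z hz => by
        have := hpt' z hz
        rw [inner_add_left] at this
        linarith)
    linarith

end MeanField

/-! ### First variation and identification of the minimizer -/

section Couplings

variable {m n : ℕ} {X : Set (Euc m)} {Y : Set (Euc n)} {c : Euc m → Euc n → ℝ}
  {V : Euc n → ℝ} {W : Euc n → Euc n → ℝ} {μ : Measure (Euc m)} {ν : Measure (Euc n)}

theorem isProbabilityMeasure_of_fst {α β : Type*} [MeasurableSpace α] [MeasurableSpace β]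
    {μ : Measure α} [IsProbabilityMeasure μ] {γ : Measure (α × β)} (h : γ.fst = μ) :
    IsProbabilityMeasure γ :=
  ⟨by rw [← Measure.fst_univ, h, measure_univ]⟩

theorem ae_mem_of_fst {α β : Type*} [MeasurableSpace α] [MeasurableSpace β]
    {μ : Measure α} {γ : Measure (α × β)} (h : γ.fst = μ) {p : α → Prop} (hp : ∀ᵐ x ∂μ, p x) :
    ∀ᵐ q ∂γ, p q.1 := by
  rw [← h] at hp
  exact ae_of_ae_map measurable_fst.aemeasurable hp

theorem ae_mem_of_snd {α β : Type*} [MeasurableSpace α] [MeasurableSpace β]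
    {ν : Measure β} {γ : Measure (α × β)} (h : γ.snd = ν) {p : β → Prop} (hp : ∀ᵐ x ∂ν, p x) :
    ∀ᵐ q ∂γ, p q.2 := by
  rw [← h] at hp
  exact ae_of_ae_map measurable_snd.aemeasurable hp

theorem measure_compl_prod_eq_zero {α β : Type*} [MeasurableSpace α] [MeasurableSpace β]
    {μ : Measure α} {ν : Measure β} {γ : Measure (α × β)} (h : γ.fst = μ) (h' : γ.snd = ν)
    {s : Set α} {t : Set β} (hs : μ sᶜ = 0) (ht : ν tᶜ = 0) : γ (s ×ˢ t)ᶜ = 0 := by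
  rw [← mem_ae_iff]
  filter_upwards [ae_mem_of_fst h (p := (· ∈ s)) (mem_ae_iff.2 hs),
    ae_mem_of_snd h' (p := (· ∈ t)) (mem_ae_iff.2 ht)] with q h1 h2 using ⟨h1, h2⟩

theorem bddBelow_transportCost (hXb : Bornology.IsBounded X) (hYb : Bornology.IsBounded Y)
    (hc : ContinuousOn (fun p : Euc m × Euc n => c p.1 p.2) (closure X ×ˢ closure Y))
    (hμ : IsProbabilityOn X μ) (hν : IsProbabilityOn (closure Y) ν) :
    BddBelow ((fun γ : Measure (Euc m × Euc n) => ∫ p, c p.1 p.2 ∂γ) ''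
      {γ | γ.fst = μ ∧ γ.snd = ν}) := by
  have := hμ.1
  have hcomp := hXb.isCompact_closure.prod hYb.isCompact_closure
  obtain ⟨M, hM⟩ := hcomp.exists_bound_of_continuousOn hc
  refine ⟨-M, ?_⟩
  rintro _ ⟨γ, ⟨h1, h2⟩, rfl⟩
  have := isProbabilityMeasure_of_fst h1
  have h0 := measure_compl_prod_eq_zero h1 h2
    (measure_mono_null (compl_subset_compl.2 subset_closure) hμ.2) hν.2
  refine sub_le_integral_of_le (integrable_of_continuousOn_of_measure_compl hcomp h0 hc) ?_
  filter_upwards [mem_ae_iff.2 h0] with p hp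
  exact neg_le_of_abs_le (hM p hp)

/-- The graph coupling `(id, T)_# μ`. -/
theorem fst_snd_map_graph {T : Euc m → Euc n} (hT : Measurable T) :
    (μ.map fun x => (x, T x)).fst = μ ∧ (μ.map fun x => (x, T x)).snd = μ.map T := by
  constructor
  · rw [Measure.fst, Measure.map_map measurable_fst (by fun_prop)]
    exact Measure.map_id
  · rw [Measure.snd, Measure.map_map measurable_snd (by fun_prop)]
    rfl

theorem integral_convexCombination {α : Type*} [MeasurableSpace α] {ν ν' : Measure α} {f : α → ℝ}
    (h : Integrable f ν) (h' : Integrable f ν') {ε : ℝ} (hε : ε ∈ Icc (0 : ℝ) 1) :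
    ∫ y, f y ∂(ENNReal.ofReal (1 - ε) • ν + ENNReal.ofReal ε • ν') =
      (1 - ε) * ∫ y, f y ∂ν + ε * ∫ y, f y ∂ν' := by
  rw [integral_add_measure (h.smul_measure ENNReal.ofReal_ne_top)
    (h'.smul_measure ENNReal.ofReal_ne_top), integral_smul_measure, integral_smul_measure,
    ENNReal.toReal_ofReal (by linarith [hε.2]), ENNReal.toReal_ofReal hε.1, smul_eq_mul,
    smul_eq_mul]

theorem isProbabilityOn_convexCombination {d : ℕ} {S : Set (Euc d)} {ν ν' : Measure (Euc d)}
    (h : IsProbabilityOn S ν) (h' : IsProbabilityOn S ν') {ε : ℝ} (hε : ε ∈ Icc (0 : ℝ) 1) :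
    IsProbabilityOn S (ENNReal.ofReal (1 - ε) • ν + ENNReal.ofReal ε • ν') := by
  have := h.1
  have := h'.1
  refine ⟨⟨?_⟩, by simp [h.2, h'.2]⟩
  simp only [Measure.add_apply, Measure.smul_apply, measure_univ, smul_eq_mul, mul_one]
  rw [← ENNReal.ofReal_add (by linarith [hε.2]) hε.1]
  simp

theorem isProbabilityOn_map {T : Euc m → Euc n} (hT : Measurable T) (hTY : ∀ x, T x ∈ closure Y)
    (hμ : IsProbabilityOn X μ) : IsProbabilityOn (closure Y) (μ.map T) := by
  have := hμ.1
  refine ⟨Measure.isProbabilityMeasure_map hT.aemeasurable, ?_⟩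
  rw [Measure.map_apply hT isClosed_closure.isOpen_compl.measurableSet,
    show T ⁻¹' (closure Y)ᶜ = ∅ by ext x; simp [hTY x]]
  exact measure_empty

/-- The inequality which expresses that the derivative of the functional along the segment from
the minimizer to `T_# μ` is nonnegative. -/
theorem first_variation (hXb : Bornology.IsBounded X) (hYb : Bornology.IsBounded Y)
    (hc : ContinuousOn (fun p : Euc m × Euc n => c p.1 p.2) (closure X ×ˢ closure Y))
    (hV : ContinuousOn V (closure Y))
    (hW : ContinuousOn (fun p : Euc n × Euc n => W p.1 p.2) (closure Y ×ˢ closure Y))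
    (hWsymm : ∀ y ∈ closure Y, ∀ z ∈ closure Y, W y z = W z y)
    (hμ : IsProbabilityOn X μ) (hν : IsInteractionMinimizer Y c V W μ ν) {T : Euc m → Euc n}
    (hT : Measurable T) (hTY : ∀ x, T x ∈ closure Y) :
    transportCost c μ ν + ∫ y, meanField V W ν y ∂ν ≤
      ∫ x, c x (T x) ∂μ + ∫ x, meanField V W ν (T x) ∂μ := by
  have := hμ.1
  have := hν.1.1
  have hcY : IsCompact (closure Y) := hYb.isCompact_closure
  have hcomp := hXb.isCompact_closure.prod hYb.isCompact_closure
  set ν' := μ.map T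
  set γ' := μ.map fun x => (x, T x)
  have hν' : IsProbabilityOn (closure Y) ν' := isProbabilityOn_map hT hTY hμ
  have := hν'.1
  obtain ⟨hγ'1, hγ'2⟩ := fst_snd_map_graph (μ := μ) hT
  have hXc : μ (closure X)ᶜ = 0 := measure_mono_null (compl_subset_compl.2 subset_closure) hμ.2
  have ic : ∀ (ρ : Measure (Euc n)), ρ (closure Y)ᶜ = 0 → ∀ γ : Measure (Euc m × Euc n),
      γ.fst = μ → γ.snd = ρ → Integrable (fun p : Euc m × Euc n => c p.1 p.2) γ := by
    intro ρ hρ γ h1 h2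
    have := isProbabilityMeasure_of_fst h1
    exact integrable_of_continuousOn_of_measure_compl hcomp
      (measure_compl_prod_eq_zero h1 h2 hXc hρ) hc
  have iV : ∀ ρ : Measure (Euc n), [IsFiniteMeasure ρ] → ρ (closure Y)ᶜ = 0 → Integrable V ρ :=
    fun ρ _ hρ => integrable_of_continuousOn_of_measure_compl hcY hρ hV
  have iW : ∀ ρ : Measure (Euc n), [IsFiniteMeasure ρ] → ρ (closure Y)ᶜ = 0 → ∀ y ∈ closure Y,
      Integrable (fun z => W y z) ρ := fun ρ _ hρ y hy =>
    integrable_of_continuousOn_of_measure_compl hcY hρ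
      (hW.comp (f := fun z => (y, z)) (by fun_prop) fun z hz => ⟨hy, hz⟩)
  have hWs : ContinuousOn (fun p : Euc n × Euc n => W p.2 p.1) (closure Y ×ˢ closure Y) :=
    hW.comp (f := Prod.swap) (by fun_prop) fun p hp => ⟨hp.2, hp.1⟩
  have iWW : ∀ ρ ρ' : Measure (Euc n), [IsFiniteMeasure ρ] → [IsFiniteMeasure ρ'] →
      ρ (closure Y)ᶜ = 0 → ρ' (closure Y)ᶜ = 0 → Integrable (fun y => ∫ z, W y z ∂ρ) ρ' :=
    fun ρ ρ' _ _ hρ hρ' => integrable_of_continuousOn_of_measure_compl hcY hρ'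
      (continuousOn_integral_of_measure_compl hcY hcY hρ hWs)
  have hae : ∀ᵐ y ∂ν, y ∈ closure Y := mem_ae_iff.2 hν.1.2
  have hae' : ∀ᵐ y ∂ν', y ∈ closure Y := mem_ae_iff.2 hν'.2
  set B : Measure (Euc n) → Measure (Euc n) → ℝ := fun ρ ρ' => ∫ y, ∫ z, W y z ∂ρ ∂ρ'
  have hswap : B ν' ν = B ν ν' := by
    have hi : Integrable (Function.uncurry W) (ν.prod ν') := by
      refine integrable_of_continuousOn_of_measure_compl (hcY.prod hcY) ?_ hW
      exact measure_compl_prod_eq_zero (by simp) (by simp) hν.1.2 hν'.2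
    simp only [B]
    rw [integral_integral_swap hi]
    refine integral_congr_ae (hae'.mono fun y hy => ?_)
    exact integral_congr_ae (hae.mono fun z hz => hWsymm z hz y hy)
  -- Along the segment from ν to ν' the interaction is a quadratic polynomial in ε, the two cross
  -- terms being equal by the symmetry of W.
  have hB : ∀ ε ∈ Icc (0 : ℝ) 1, B (ENNReal.ofReal (1 - ε) • ν + ENNReal.ofReal ε • ν')
      (ENNReal.ofReal (1 - ε) • ν + ENNReal.ofReal ε • ν') =
      (1 - ε) ^ 2 * B ν ν + 2 * (ε * (1 - ε)) * B ν ν' + ε ^ 2 * B ν' ν' := by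
    intro ε hε
    have hρ := isProbabilityOn_convexCombination hν.1 hν' hε
    set ρ := ENNReal.ofReal (1 - ε) • ν + ENNReal.ofReal ε • ν'
    have := hρ.1
    have haeρ : ∀ᵐ y ∂ρ, y ∈ closure Y := mem_ae_iff.2 hρ.2
    have h1 : ∀ ρ' : Measure (Euc n), [IsFiniteMeasure ρ'] → ρ' (closure Y)ᶜ = 0 →
        B ρ ρ' = (1 - ε) * B ν ρ' + ε * B ν' ρ' := by
      intro ρ' _ hρ'
      simp only [B]
      rw [← integral_const_mul, ← integral_const_mul, ← integral_add
        ((iWW ν ρ' hν.1.2 hρ').const_mul _) ((iWW ν' ρ' hν'.2 hρ').const_mul _)]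
      refine integral_congr_ae ?_
      filter_upwards [mem_ae_iff.2 hρ'] with y hy
      exact integral_convexCombination (iW ν hν.1.2 y hy) (iW ν' hν'.2 y hy) hε
    have h2 : B ρ ρ = (1 - ε) * B ρ ν + ε * B ρ ν' :=
      integral_convexCombination (iWW ρ ν hρ.2 hν.1.2) (iWW ρ ν' hρ.2 hν'.2) hε
    rw [h2, h1 ν hν.1.2, h1 ν' hν'.2, hswap]
    ring
  have hcγ' : ∫ p, c p.1 p.2 ∂γ' = ∫ x, c x (T x) ∂μ :=
    integral_map (measurable_id.prodMk hT).aemeasurable (ic ν' hν'.2 γ' hγ'1 hγ'2).1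
  set S := (fun γ : Measure (Euc m × Euc n) => ∫ p, c p.1 p.2 ∂γ) '' {γ | γ.fst = μ ∧ γ.snd = ν}
  have hSne : S.Nonempty := ⟨_, μ.prod ν, ⟨by simp, by simp⟩, rfl⟩
  -- The competitor coupling mixes a δ-optimal coupling of μ and ν with the graph coupling, so no
  -- optimal coupling has to exist.
  have key : ∀ ε ∈ Icc (0 : ℝ) 1, transportCost c μ ν + ∫ y, V y ∂ν + 1 / 2 * B ν ν ≤
      ((1 - ε) * transportCost c μ ν + ε * ∫ x, c x (T x) ∂μ) +
      ((1 - ε) * ∫ y, V y ∂ν + ε * ∫ y, V y ∂ν') +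
      1 / 2 * ((1 - ε) ^ 2 * B ν ν + 2 * (ε * (1 - ε)) * B ν ν' + ε ^ 2 * B ν' ν') := by
    intro ε hε
    refine le_of_forall_pos_le_add fun δ hδ => ?_
    obtain ⟨_, ⟨γ, ⟨hγ1, hγ2⟩, rfl⟩, hγ⟩ := exists_lt_of_csInf_lt hSne (lt_add_of_pos_right _ hδ)
    have hγ : ∫ p, c p.1 p.2 ∂γ < transportCost c μ ν + δ := hγ
    have hρ := isProbabilityOn_convexCombination hν.1 hν' hε
    have hmin := hν.2 _ hρ
    have hcomb := integral_convexCombination (ic ν hν.1.2 γ hγ1 hγ2) (ic ν' hν'.2 γ' hγ'1 hγ'2) hε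
    have hle : transportCost c μ (ENNReal.ofReal (1 - ε) • ν + ENNReal.ofReal ε • ν') ≤
        (1 - ε) * ∫ p, c p.1 p.2 ∂γ + ε * ∫ p, c p.1 p.2 ∂γ' := by
      rw [← hcomb]
      refine csInf_le (bddBelow_transportCost hXb hYb hc hμ hρ) ⟨_, ⟨?_, ?_⟩, rfl⟩
      · rw [Measure.fst, Measure.map_add _ _ measurable_fst, Measure.map_smul, Measure.map_smul]
        change ENNReal.ofReal (1 - ε) • γ.fst + ENNReal.ofReal ε • γ'.fst = μ
        rw [hγ1, hγ'1, ← add_smul, ← ENNReal.ofReal_add (by linarith [hε.2]) hε.1]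
        simp
      · rw [Measure.snd, Measure.map_add _ _ measurable_snd, Measure.map_smul, Measure.map_smul]
        change ENNReal.ofReal (1 - ε) • γ.snd + ENNReal.ofReal ε • γ'.snd = _
        rw [hγ2, hγ'2]
    simp only [interactionFunctional] at hmin
    have hB' := hB ε hε
    simp only [B] at hB' ⊢
    rw [hB', integral_convexCombination (iV ν hν.1.2) (iV ν' hν'.2) hε] at hmin
    rw [hcγ'] at hle
    have h3 : (1 - ε) * ∫ p, c p.1 p.2 ∂γ ≤ (1 - ε) * transportCost c μ ν + δ := by
      have h4 : (1 - ε) * ∫ p, c p.1 p.2 ∂γ ≤ (1 - ε) * (transportCost c μ ν + δ) :=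
        mul_le_mul_of_nonneg_left hγ.le (by linarith [hε.2])
      nlinarith [hε.1]
    linarith
  have hlin : transportCost c μ ν + ∫ y, V y ∂ν + B ν ν ≤
      ∫ x, c x (T x) ∂μ + ∫ y, V y ∂ν' + B ν ν' := by
    -- The gain along the segment is ε(l + εq) ≥ 0. Dividing by ε and letting ε tend to 0 gives l ≥
    -- 0; the factor 1/2 in the functional cancels against the two cross terms.
    set q := 1 / 2 * (B ν ν - 2 * B ν ν' + B ν' ν')
    set l := ∫ x, c x (T x) ∂μ + ∫ y, V y ∂ν' + B ν ν' -
      (transportCost c μ ν + ∫ y, V y ∂ν + B ν ν) with hl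
    have h1 : ∀ ε ∈ Ioc (0 : ℝ) 1, 0 ≤ l + ε * q := by
      intro ε hε
      have h2 : 0 ≤ ε * (l + ε * q) := by
        have := key ε ⟨hε.1.le, hε.2⟩
        simp only [l, q]
        nlinarith
      exact nonneg_of_mul_nonneg_right h2 hε.1
    have hlim : Tendsto (fun ε : ℝ => l + ε * q) (𝓝[>] 0) (𝓝 (l + 0 * q)) :=
      (tendsto_const_nhds.add (tendsto_id.mul_const _)).mono_left nhdsWithin_le_nhds
    rw [zero_mul, add_zero] at hlim
    have := ge_of_tendsto hlim (by
      filter_upwards [Ioc_mem_nhdsGT (zero_lt_one' ℝ)] with ε hε using h1 ε hε)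
    linarith
  have hR : ∀ ρ : Measure (Euc n), [IsFiniteMeasure ρ] → ρ (closure Y)ᶜ = 0 →
      ∫ y, meanField V W ν y ∂ρ = ∫ y, V y ∂ρ + B ν ρ := by
    intro ρ _ hρ
    rw [← integral_add (iV ρ hρ) (iWW ν ρ hν.1.2 hρ)]
    refine integral_congr_ae ?_
    filter_upwards [mem_ae_iff.2 hρ] with y hy
    simp only [meanField]
    congr 1
    exact integral_congr_ae (hae.mono fun z hz => hWsymm z hz y hy)
  have hRT : ∫ x, meanField V W ν (T x) ∂μ = ∫ y, meanField V W ν y ∂ν' := by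
    refine (integral_map hT.aemeasurable ?_).symm
    refine (integrable_of_continuousOn_of_measure_compl hcY hν'.2 ?_).1
    exact hV.add (continuousOn_integral_of_measure_compl hcY hcY hν.1.2 hW)
  rw [hRT, hR ν hν.1.2, hR ν' hν'.2]
  linarith

/-- Nearby points are handled by uniform continuity; for points at distance at least δ the quadratic
term already dominates the oscillation of f. This turns L² closeness into closeness of integrals of
test functions. -/
theorem exists_quadratic_modulus {d : ℕ} {S : Set (Euc d)} (hS : IsCompact S) {f : Euc d → ℝ}
    (hf : ContinuousOn f S) {η : ℝ} (hη : 0 < η) :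
    ∃ M, 0 ≤ M ∧ ∀ y ∈ S, ∀ y' ∈ S, |f y - f y'| ≤ η + M * ‖y - y'‖ ^ 2 := by
  obtain ⟨B, hB⟩ := hS.exists_bound_of_continuousOn hf
  obtain ⟨δ, hδ, h⟩ := Metric.uniformContinuousOn_iff.1
    (hS.uniformContinuousOn_of_continuous hf) η hη
  refine ⟨2 * |B| / δ ^ 2, by positivity, fun y hy y' hy' => ?_⟩
  by_cases hd : dist y y' < δ
  · have h1 := (h y hy y' hy' hd).le
    rw [Real.dist_eq] at h1
    have : 0 ≤ 2 * |B| / δ ^ 2 * ‖y - y'‖ ^ 2 := by positivity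
    linarith
  · rw [not_lt, dist_eq_norm] at hd
    have h1 : |f y - f y'| ≤ 2 * |B| := by
      have e1 : |f y| ≤ |B| := (hB y hy).trans (le_abs_self B)
      have e2 : |f y'| ≤ |B| := (hB y' hy').trans (le_abs_self B)
      have := abs_sub (f y) (f y')
      linarith
    have h2 : 2 * |B| ≤ 2 * |B| / δ ^ 2 * ‖y - y'‖ ^ 2 := by
      rw [div_mul_eq_mul_div, le_div_iff₀ (by positivity)]
      gcongr
    linarith

/-- A minimizer is the image of `μ` under the map of minimizers of the landscape. -/
theorem minimizer_eq_map {R : Euc n → ℝ} {g : Euc m × Euc n → Euc n} {r : Euc n → Euc n} {C K : ℝ}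
    (hR : R = meanField V W ν)
    (h : IsConvexLandscape X Y c R g r C K) (hXb : Bornology.IsBounded X)
    (hYb : Bornology.IsBounded Y) (hV : ContinuousOn V (closure Y))
    (hW : ContinuousOn (fun p : Euc n × Euc n => W p.1 p.2) (closure Y ×ˢ closure Y))
    (hWsymm : ∀ y ∈ closure Y, ∀ z ∈ closure Y, W y z = W z y)
    (hμ : IsProbabilityOn X μ) (hν : IsInteractionMinimizer Y c V W μ ν) {T : Euc m → Euc n}
    (hT : Measurable T) (hTY : ∀ x, T x ∈ closure Y)
    (hTmin : ∀ x ∈ X, ∀ y ∈ closure Y,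
      c x (T x) + R (T x) + C / 2 * ‖y - T x‖ ^ 2 ≤ c x y + R y) :
    ν = μ.map T := by
  have := hμ.1
  have := hν.1.1
  have hcY : IsCompact (closure Y) := hYb.isCompact_closure
  have hcomp := hXb.isCompact_closure.prod hYb.isCompact_closure
  have hXc : μ (closure X)ᶜ = 0 := measure_mono_null (compl_subset_compl.2 subset_closure) hμ.2
  have hν' : IsProbabilityOn (closure Y) (μ.map T) := isProbabilityOn_map hT hTY hμ
  have := hν'.1
  have hfv := first_variation hXb hYb h.continuousOn_cost hV hW hWsymm hμ hν hT hTY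
  rw [← hR] at hfv
  have hSne : ((fun γ : Measure (Euc m × Euc n) => ∫ p, c p.1 p.2 ∂γ) ''
      {γ | γ.fst = μ ∧ γ.snd = ν}).Nonempty := ⟨_, μ.prod ν, ⟨by simp, by simp⟩, rfl⟩
  have iR : Integrable R ν :=
    integrable_of_continuousOn_of_measure_compl hcY hν.1.2 h.continuousOn_R
  have iR' : Integrable R (μ.map T) :=
    integrable_of_continuousOn_of_measure_compl hcY hν'.2 h.continuousOn_R
  obtain ⟨hγ'1, hγ'2⟩ := fst_snd_map_graph (μ := μ) hT
  have icT : Integrable (fun x => c x (T x)) μ := by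
    have := isProbabilityMeasure_of_fst hγ'1
    have := integrable_of_continuousOn_of_measure_compl hcomp
      (measure_compl_prod_eq_zero hγ'1 hγ'2 hXc hν'.2) h.continuousOn_cost
    exact this.comp_measurable (measurable_id.prodMk hT)
  have iRT : Integrable (fun x => R (T x)) μ := iR'.comp_measurable hT
  -- Strong convexity bounds the squared deviation from the graph of T by the excess of c + R, whose
  -- integral is at most δ by the first variation and the δ-optimality of γ.
  have hdev : ∀ δ > 0, ∃ γ : Measure (Euc m × Euc n), γ.fst = μ ∧ γ.snd = ν ∧
      Integrable (fun p : Euc m × Euc n => ‖p.2 - T p.1‖ ^ 2) γ ∧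
      C / 2 * ∫ p, ‖p.2 - T p.1‖ ^ 2 ∂γ ≤ δ := by
    intro δ hδ
    obtain ⟨_, ⟨γ, ⟨hγ1, hγ2⟩, rfl⟩, hγ⟩ := exists_lt_of_csInf_lt hSne (lt_add_of_pos_right _ hδ)
    have hγ : ∫ p, c p.1 p.2 ∂γ < transportCost c μ ν + δ := hγ
    have := isProbabilityMeasure_of_fst hγ1
    have h0 := measure_compl_prod_eq_zero hγ1 hγ2 hXc hν.1.2
    have icγ := integrable_of_continuousOn_of_measure_compl hcomp h0 h.continuousOn_cost
    have iRγ : Integrable (fun p : Euc m × Euc n => R p.2) γ := by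
      rw [← hγ2] at iR
      exact iR.comp_measurable measurable_snd
    have icTγ : Integrable (fun p : Euc m × Euc n => c p.1 (T p.1)) γ := by
      rw [← hγ1] at icT
      exact icT.comp_measurable measurable_fst
    have iRTγ : Integrable (fun p : Euc m × Euc n => R (T p.1)) γ := by
      rw [← hγ1] at iRT
      exact iRT.comp_measurable measurable_fst
    have hptw : ∀ᵐ p ∂γ, C / 2 * ‖p.2 - T p.1‖ ^ 2 ≤
        (c p.1 p.2 + R p.2) - (c p.1 (T p.1) + R (T p.1)) := by
      filter_upwards [ae_mem_of_fst hγ1 (p := (· ∈ X)) (mem_ae_iff.2 hμ.2),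
        ae_mem_of_snd hγ2 (p := (· ∈ closure Y)) (mem_ae_iff.2 hν.1.2)] with p h1 h2
      have := hTmin p.1 h1 p.2 h2
      linarith
    have hi : Integrable (fun p : Euc m × Euc n => C / 2 * ‖p.2 - T p.1‖ ^ 2) γ := by
      refine ((icγ.add iRγ).sub (icTγ.add iRTγ)).mono' ?_ ?_
      · exact (by fun_prop : Measurable fun p : Euc m × Euc n =>
          C / 2 * ‖p.2 - T p.1‖ ^ 2).aestronglyMeasurable
      · filter_upwards [hptw] with p hp
        have hpos : 0 ≤ C / 2 * ‖p.2 - T p.1‖ ^ 2 := by have := h.pos; positivity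
        rw [Real.norm_of_nonneg hpos]
        exact hp
    refine ⟨γ, hγ1, hγ2, ?_, ?_⟩
    · have hC0 : C / 2 ≠ 0 := by have := h.pos; positivity
      have := hi.const_mul (C / 2)⁻¹
      simp only [← mul_assoc, inv_mul_cancel₀ hC0, one_mul] at this
      exact this
    · rw [← integral_const_mul]
      refine (integral_mono_ae hi ((icγ.add iRγ).sub (icTγ.add iRTγ)) hptw).trans ?_
      have e1 := integral_sub (f := fun p : Euc m × Euc n => c p.1 p.2 + R p.2)
        (g := fun p : Euc m × Euc n => c p.1 (T p.1) + R (T p.1))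
        (icγ.add iRγ) (icTγ.add iRTγ)
      have e2 : ∫ p : Euc m × Euc n, R p.2 ∂γ = ∫ y, R y ∂ν := by
        rw [← hγ2] at iR ⊢
        exact (integral_map measurable_snd.aemeasurable iR.1).symm
      have e3 : ∫ p : Euc m × Euc n, c p.1 (T p.1) ∂γ = ∫ x, c x (T x) ∂μ := by
        have := icT.1
        rw [← hγ1] at this ⊢
        exact (integral_map (φ := Prod.fst) (f := fun x => c x (T x))
          measurable_fst.aemeasurable this).symm
      have e4 : ∫ p : Euc m × Euc n, R (T p.1) ∂γ = ∫ x, R (T x) ∂μ := by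
        have := iRT.1
        rw [← hγ1] at this ⊢
        exact (integral_map (φ := Prod.fst) (f := fun x => R (T x))
          measurable_fst.aemeasurable this).symm
      change ∫ p : Euc m × Euc n, ((c p.1 p.2 + R p.2) - (c p.1 (T p.1) + R (T p.1))) ∂γ ≤ δ
      rw [e1, integral_add icγ iRγ, integral_add icTγ iRTγ, e2, e3, e4]
      linarith
  refine ext_of_forall_integral_eq_of_IsFiniteMeasure fun f => ?_
  have hfY : ContinuousOn f (closure Y) := f.continuous.continuousOn
  have hfi : ∀ ρ : Measure (Euc n), [IsFiniteMeasure ρ] → Integrable f ρ :=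
    fun ρ _ => f.integrable ρ
  refine eq_of_forall_dist_le fun ε hε => ?_
  rw [Real.dist_eq]
  obtain ⟨M, hM0, hM⟩ := exists_quadratic_modulus hcY hfY (half_pos hε)
  have hC := h.pos
  -- Chosen so that M times the mean squared deviation is at most ε/2; M + 1 avoids division by
  -- zero.
  obtain ⟨γ, hγ1, hγ2, hγi, hγ⟩ := hdev (C / 2 * (ε / 2 / (M + 1))) (by positivity)
  have := isProbabilityMeasure_of_fst hγ1
  have hγ' := le_of_mul_le_mul_left hγ (by positivity)
  have e1 : ∫ y, f y ∂ν = ∫ p, f p.2 ∂γ := by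
    rw [← hγ2]
    exact integral_map measurable_snd.aemeasurable (hfi _).1
  have e2 : ∫ y, f y ∂(μ.map T) = ∫ p, f (T p.1) ∂γ := by
    rw [integral_map hT.aemeasurable (hfi _).1]
    conv_lhs => rw [← hγ1]
    exact integral_map (φ := Prod.fst) (f := fun x => f (T x)) measurable_fst.aemeasurable
      (f.continuous.measurable.comp hT).aestronglyMeasurable
  have i1 : Integrable (fun p : Euc m × Euc n => f p.2) γ :=
    (hfi (γ.map Prod.snd)).comp_measurable measurable_snd
  have i2 : Integrable (fun p : Euc m × Euc n => f (T p.1)) γ :=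
    (hfi (γ.map (T ∘ Prod.fst))).comp_measurable (hT.comp measurable_fst)
  rw [e1, e2, ← integral_sub i1 i2]
  refine (abs_integral_le_integral_abs).trans ?_
  have hle : ∫ p, |f p.2 - f (T p.1)| ∂γ ≤ ∫ p, (ε / 2 + M * ‖p.2 - T p.1‖ ^ 2) ∂γ := by
    refine integral_mono_ae (i1.sub i2).abs ((integrable_const _).add (hγi.const_mul M)) ?_
    filter_upwards [ae_mem_of_snd hγ2 (p := (· ∈ closure Y)) (mem_ae_iff.2 hν.1.2)] with p h2
    exact hM _ h2 _ (hTY _)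
  refine hle.trans ?_
  rw [integral_add (integrable_const _) (hγi.const_mul M), integral_const_mul]
  simp only [integral_const, probReal_univ, smul_eq_mul, one_mul]
  have h5 : M * ∫ p, ‖p.2 - T p.1‖ ^ 2 ∂γ ≤ M * (ε / 2 / (M + 1)) :=
    mul_le_mul_of_nonneg_left hγ' hM0
  have h6 : M * (ε / 2 / (M + 1)) ≤ ε / 2 := by
    rw [mul_div_assoc', div_le_iff₀ (by positivity)]
    nlinarith
  linarith

end Couplings

/-! ### Null sets and maps with Lipschitz inverse -/

section NullPreimages

/-- The map Ψ sends the set into the null set N × K, and its inverse on the image is Lipschitz, so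
the set itself is null. -/
theorem measure_inter_preimage_fst_eq_zero {E F K : Type*} [NormedAddCommGroup E]
    [InnerProductSpace ℝ E] [FiniteDimensional ℝ E] [NormedAddCommGroup F] [InnerProductSpace ℝ F]
    [FiniteDimensional ℝ F] [NormedAddCommGroup K] [InnerProductSpace ℝ K] [FiniteDimensional ℝ K]
    [MeasurableSpace E] [BorelSpace E] [MeasurableSpace F] [BorelSpace F]
    [MeasurableSpace K] [BorelSpace K]
    (hdim : Module.finrank ℝ E = Module.finrank ℝ F + Module.finrank ℝ K) {A : Set E}
    {Ψ : E → F × K} {M : ℝ} (hM : 0 ≤ M)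
    (hΨ : ∀ x ∈ A, ∀ x' ∈ A, ‖x - x'‖ ≤ M * ‖Ψ x - Ψ x'‖) {N : Set F} (hN : volume N = 0) :
    volume (A ∩ {x | (Ψ x).1 ∈ N}) = 0 := by
  obtain ⟨ι⟩ := exists_isometry_withLp_prod hdim
  set e := prodEquivOfIsometry ι
  set S := A ∩ {x | (Ψ x).1 ∈ N}
  set B : ℝ := M * ‖(e.symm : E →L[ℝ] F × K)‖
  have hB : 0 ≤ B := by positivity
  obtain ⟨B', hB'⟩ : ∃ B' : NNReal, (B' : ℝ) = B := ⟨⟨B, hB⟩, rfl⟩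
  have h1 : μHE[Module.finrank ℝ E] (id '' S) ≤ (B' : ℝ≥0∞) ^ Module.finrank ℝ E *
      μHE[Module.finrank ℝ E] ((fun x => e (Ψ x)) '' S) := by
    refine euclideanHausdorffMeasure_image_le_of_edist_le _ fun a ha b hb => ?_
    rw [edist_dist, edist_dist, ← ENNReal.ofReal_coe_nnreal, hB', ← ENNReal.ofReal_mul hB]
    refine ENNReal.ofReal_le_ofReal ?_
    rw [dist_eq_norm, dist_eq_norm]
    calc ‖a - b‖ ≤ M * ‖Ψ a - Ψ b‖ := hΨ a ha.1 b hb.1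
      _ = M * ‖(e.symm : E →L[ℝ] F × K) (e (Ψ a) - e (Ψ b))‖ := by simp [map_sub]
      _ ≤ M * (‖(e.symm : E →L[ℝ] F × K)‖ * ‖e (Ψ a) - e (Ψ b)‖) := by
          gcongr
          exact ContinuousLinearMap.le_opNorm _ _
      _ = _ := by simp [B, mul_assoc]
  rw [image_id, InnerProductSpace.euclideanHausdorffMeasure_eq_volume] at h1
  have h2 : volume ((fun x => e (Ψ x)) '' S) = 0 := by
    have hemb : MeasurableEmbedding e := e.toHomeomorph.measurableEmbedding
    have hsub : (fun x => e (Ψ x)) '' S ⊆ e '' (N ×ˢ univ) := by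
      rintro _ ⟨x, hx, rfl⟩
      exact ⟨Ψ x, ⟨hx.2, mem_univ _⟩, rfl⟩
    refine measure_mono_null hsub ?_
    rw [← (measurePreserving_prodEquivOfIsometry ι).measure_preimage_emb hemb,
      preimage_image_eq _ e.injective, Measure.volume_eq_prod, Measure.prod_prod, hN, zero_mul]
  rw [h2, mul_zero] at h1
  exact le_antisymm h1 zero_le

end NullPreimages

/-! ### Non-degeneracy and null preimages of the map of minimizers -/

section Nondegeneracy

variable {m n : ℕ} {X : Set (Euc m)} {Y : Set (Euc n)} {c : Euc m → Euc n → ℝ}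

theorem surjective_of_rank_eq {A : Euc m →L[ℝ] Euc n}
    (h : (Matrix.of fun (i : Fin m) (j : Fin n) => A (EuclideanSpace.single i 1) j).rank = n) :
    Function.Surjective A := by
  set M := Matrix.of fun (i : Fin m) (j : Fin n) => A (EuclideanSpace.single i 1) j
  have hA : ∀ w : Euc m, (A w).ofLp = Mᵀ.mulVec w.ofLp := by
    intro w
    ext j
    conv_lhs => rw [← sum_smul_single w, map_sum]
    simp [Matrix.mulVec, dotProduct, M, mul_comm]
  rw [← Matrix.rank_transpose] at h
  have hr : LinearMap.range Mᵀ.mulVecLin = ⊤ := by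
    apply Submodule.eq_top_of_finrank_eq
    rw [Module.finrank_fin_fun]
    exact h
  intro y
  obtain ⟨w, hw⟩ := LinearMap.range_eq_top.1 hr y.ofLp
  refine ⟨WithLp.toLp 2 w, ?_⟩
  ext j
  rw [hA]
  exact congrFun hw j

theorem surjective_of_isNondegenerate (hXo : IsOpen X) (hYo : IsOpen Y)
    (hgc : IsC1UpToBoundary (X ×ˢ Y) (partialGradient c)) (hnd : IsNondegenerate X Y c)
    {x : Euc m} {y : Euc n} (hx : x ∈ closure X) (hy : y ∈ closure Y)
    {L : Euc m × Euc n →L[ℝ] Euc n}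
    (hL : Tendsto (fderiv ℝ (partialGradient c)) (𝓝[X ×ˢ Y] (x, y)) (𝓝 L)) :
    Function.Surjective (L.comp (ContinuousLinearMap.inl ℝ (Euc m) (Euc n))) := by
  refine surjective_of_rank_eq (Eq.trans (congrArg Matrix.rank ?_) (hnd x hx y hy))
  symm
  refine extendFrom_eq (by rw [closure_prod_eq]; exact ⟨hx, hy⟩) ?_
  have h1 : Tendsto (fun p => Matrix.of fun (i : Fin m) (j : Fin n) =>
      fderiv ℝ (partialGradient c) p (EuclideanSpace.single i 1, 0) j) (𝓝[X ×ˢ Y] (x, y))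
      (𝓝 (Matrix.of fun (i : Fin m) (j : Fin n) => L (EuclideanSpace.single i 1, 0) j)) := by
    refine tendsto_pi_nhds.2 fun i => tendsto_pi_nhds.2 fun j => ?_
    have hcont : Continuous fun A : Euc m × Euc n →L[ℝ] Euc n =>
        A (EuclideanSpace.single i 1, 0) j := by fun_prop
    exact (hcont.tendsto L).comp hL
  refine tendsto_nhdsWithin_congr (fun p hp => ?_) h1
  ext i j
  rw [mixedHessian_apply (hgc.differentiableAt (hXo.prod hYo) hp)]
  rfl

variable {R : Euc n → ℝ} {r : Euc n → Euc n} {C K : ℝ}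

/-- The map of minimizers pulls back Lebesgue null sets to null sets. -/
theorem volume_inter_preimage_eq_zero (hnm : n ≤ m) (hXo : IsOpen X) (hYo : IsOpen Y)
    (hc : IsC2UpToBoundary (X ×ˢ Y) (fun p : Euc m × Euc n => c p.1 p.2))
    (hnd : IsNondegenerate X Y c)
    (h : IsConvexLandscape X Y c R (extendFrom (X ×ˢ Y) (partialGradient c)) r C K)
    {T : Euc m → Euc n} (hTY : ∀ x, T x ∈ closure Y) (hTc : ContinuousOn T X)
    (hT0 : ∀ x ∈ X, extendFrom (X ×ˢ Y) (partialGradient c) (x, T x) + r (T x) = 0)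
    {N : Set (Euc n)} (hN : volume N = 0) : volume (X ∩ T ⁻¹' N) = 0 := by
  have hgc := isC1UpToBoundary_partialGradient (hXo.prod hYo) hc
  set g := extendFrom (X ×ˢ Y) (partialGradient c)
  refine measure_null_of_locally_null _ fun x₀ hx₀ => ?_
  have hx₀X : x₀ ∈ X := hx₀.1
  obtain ⟨L₀, hL₀⟩ := hgc.tendsto_fderiv (x₀, T x₀)
    (by rw [closure_prod_eq]; exact ⟨subset_closure hx₀X, hTY _⟩)
  set M₀ : Euc m →L[ℝ] Euc n := L₀.comp (ContinuousLinearMap.inl ℝ (Euc m) (Euc n))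
  have hdim : Module.finrank ℝ (Euc m) = Module.finrank ℝ (Euc n) +
      Module.finrank ℝ (Euc (m - n)) := by simp; omega
  obtain ⟨L, hL⟩ := exists_complementary_map (K := Euc (m - n)) hdim
    (surjective_of_isNondegenerate hXo hYo hgc hnd (subset_closure hx₀X) (hTY x₀) hL₀)
  obtain ⟨C₀, hC₀, hanti⟩ :=
    (LinearMap.injective_iff_antilipschitz ((M₀.prod L : Euc m →L[ℝ] Euc n × Euc (m - n)) :
      Euc m →ₗ[ℝ] Euc n × Euc (m - n))).1 hL
  have hC₀' : (0 : ℝ) < C₀ := by exact_mod_cast hC₀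
  -- With η = 1/(2C₀) the linearization error amounts to ‖x' - x‖/2 in the final estimate and is
  -- absorbed on the left.
  obtain ⟨δ, hδ, hball, happ⟩ := exists_approximation_fst hgc hXo hYo hx₀X hL₀
    (η := 1 / (2 * C₀)) (by positivity)
  set A := (X ∩ T ⁻¹' Metric.ball (T x₀) δ) ∩ Metric.ball x₀ δ
  have hA : A ∈ 𝓝 x₀ :=
    inter_mem ((hTc.isOpen_inter_preimage hXo Metric.isOpen_ball).mem_nhds
      ⟨hx₀X, Metric.mem_ball_self hδ⟩) (Metric.ball_mem_nhds _ hδ)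
  -- The values of T may still lie on the boundary of Y, so the approximation is extended to the
  -- closure.
  have happ' : ∀ q ∈ Metric.ball x₀ δ, ∀ q' ∈ Metric.ball x₀ δ, ∀ y ∈ Metric.ball (T x₀) δ,
      y ∈ closure Y → ‖g (q', y) - g (q, y) - M₀ (q' - q)‖ ≤ 1 / (2 * C₀) * ‖q' - q‖ := by
    intro q hq q' hq' y hy hyY
    have hcl : y ∈ closure (Metric.ball (T x₀) δ ∩ Y) :=
      Metric.isOpen_ball.inter_closure ⟨hy, hyY⟩
    have hgq : ∀ q ∈ Metric.ball x₀ δ,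
        ContinuousWithinAt (fun y => g (q, y)) (Metric.ball (T x₀) δ ∩ Y) y := fun q hq =>
      ((h.continuousOn_g.comp (f := fun y => (q, y)) (s := closure Y) (by fun_prop) fun y hy =>
        ⟨subset_closure (hball hq), hy⟩) y hyY).mono (inter_subset_right.trans subset_closure)
    refine ContinuousWithinAt.closure_le
      (f := fun y => ‖g (q', y) - g (q, y) - M₀ (q' - q)‖) (g := fun _ => 1 / (2 * C₀) * ‖q' - q‖)
      hcl (((hgq q' hq').sub (hgq q hq)).sub continuousWithinAt_const).norm
      continuousWithinAt_const fun y hy => ?_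
    have e1 : g (q', y) = partialGradient c (q', y) := hgc.extendFrom_eq ⟨hball hq', hy.2⟩
    have e2 : g (q, y) = partialGradient c (q, y) := hgc.extendFrom_eq ⟨hball hq, hy.2⟩
    rw [e1, e2]
    exact happ q hq q' hq' y hy.1 hy.2
  refine ⟨A ∩ {x | ((fun x => (T x, L x)) x).1 ∈ N}, ?_, ?_⟩
  · exact inter_mem (mem_nhdsWithin_of_mem_nhds hA)
      (mem_of_superset self_mem_nhdsWithin fun x hx => hx.2)
  refine measure_inter_preimage_fst_eq_zero hdim (M := 2 * C₀ * (K + 1))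
    (by have := h.nonneg; positivity) (fun x hx x' hx' => ?_) hN
  have h1 := happ' x hx.2 x' hx'.2 (T x) hx.1.2 (hTY x)
  -- Since g(x, T x) = -r(T x), the difference is the landscape gradient of x' at T x. That gradient
  -- vanishes at T x' and is K-Lipschitz.
  have h2 : ‖g (x', T x) - g (x, T x)‖ ≤ K * ‖T x - T x'‖ := by
    have := h.lipschitz x' hx'.1.1 (T x') (hTY x') (T x) (hTY x)
    rw [hT0 x' hx'.1.1, sub_zero] at this
    have e : g (x', T x) - g (x, T x) = g (x', T x) + r (T x) := by
      rw [eq_neg_of_add_eq_zero_left (hT0 x hx.1.1)]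
      abel
    rwa [e]
  have h3 : ‖x' - x‖ ≤ C₀ * ‖(M₀ (x' - x), L (x' - x))‖ := by
    have := hanti.le_mul_dist x' x
    rw [dist_eq_norm, dist_eq_norm, ← map_sub] at this
    exact this
  have h4 : ‖M₀ (x' - x)‖ ≤ K * ‖T x - T x'‖ + 1 / (2 * C₀) * ‖x' - x‖ := by
    calc ‖M₀ (x' - x)‖ = ‖(g (x', T x) - g (x, T x)) -
          (g (x', T x) - g (x, T x) - M₀ (x' - x))‖ := by congr 1; abel
      _ ≤ _ := (norm_sub_le _ _).trans (add_le_add h2 h1)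
  set w := ‖(T x, L x) - (T x', L x')‖
  have hw1 : ‖T x - T x'‖ ≤ w := norm_fst_le ((T x, L x) - (T x', L x'))
  have hw2 : ‖L (x' - x)‖ ≤ w := by
    rw [← norm_neg, ← map_neg, neg_sub, map_sub]
    exact norm_snd_le ((T x, L x) - (T x', L x'))
  have h5 : ‖(M₀ (x' - x), L (x' - x))‖ ≤ (K + 1) * w + 1 / (2 * C₀) * ‖x' - x‖ := by
    have hK := h.nonneg
    have hw0 : 0 ≤ w := norm_nonneg _
    refine (Prod.norm_def _).le.trans (max_le ?_ ?_)
    · have : K * ‖T x - T x'‖ ≤ K * w := by gcongr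
      refine h4.trans ?_
      linarith
    · have : 0 ≤ 1 / (2 * (C₀ : ℝ)) * ‖x' - x‖ := by positivity
      have : 0 ≤ K * w := by positivity
      change ‖L (x' - x)‖ ≤ _
      linarith
  have h6 : ‖x' - x‖ ≤ C₀ * ((K + 1) * w) + ‖x' - x‖ / 2 := by
    calc ‖x' - x‖ ≤ C₀ * ((K + 1) * w + 1 / (2 * C₀) * ‖x' - x‖) :=
          h3.trans (by gcongr)
      _ = _ := by field_simp
  rw [norm_sub_rev]
  change ‖x' - x‖ ≤ 2 * C₀ * (K + 1) * w
  linarith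

end Nondegeneracy

/-! ### Regularity of the mean field -/

section MeanFieldRegularity

variable {m n : ℕ}

theorem hasGradientAt_of_quadratic_bounds {f : Euc n → ℝ} {G y : Euc n} {C K : ℝ}
    (hl : ∀ᶠ y' in 𝓝 y, f y + inner ℝ G (y' - y) + C * ‖y' - y‖ ^ 2 ≤ f y')
    (hu : ∀ᶠ y' in 𝓝 y, f y' ≤ f y + inner ℝ G (y' - y) + K * ‖y' - y‖ ^ 2) :
    HasGradientAt f G y := by
  rw [hasGradientAt_iff_isLittleO]
  refine IsBigO.trans_isLittleO (g := fun y' => ‖y' - y‖ ^ 2) ?_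
    (isLittleO_pow_sub_sub y one_lt_two)
  refine IsBigO.of_bound (max |C| |K|) ?_
  filter_upwards [hl, hu] with y' h1 h2
  have h0 : 0 ≤ ‖y' - y‖ ^ 2 := by positivity
  rw [Real.norm_of_nonneg h0, Real.norm_eq_abs, abs_le]
  have h3 : -(max |C| |K|) * ‖y' - y‖ ^ 2 ≤ C * ‖y' - y‖ ^ 2 := by
    gcongr
    exact (neg_le_neg (le_max_left _ _)).trans (neg_abs_le C)
  have h4 : K * ‖y' - y‖ ^ 2 ≤ max |C| |K| * ‖y' - y‖ ^ 2 := by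
    gcongr
    exact (le_abs_self K).trans (le_max_right _ _)
  constructor <;> linarith

theorem inner_fderiv_comm_of_hasGradientAt {f : Euc n → ℝ} {G : Euc n → Euc n} {y : Euc n}
    (hf : ∀ᶠ z in 𝓝 y, HasGradientAt f (G z) z) (hG : DifferentiableAt ℝ G y) (v w : Euc n) :
    inner ℝ (fderiv ℝ G y v) w = inner ℝ v (fderiv ℝ G y w) := by
  let D : Euc n →L[ℝ] (Euc n →L[ℝ] ℝ) :=
    (isBoundedBilinearMap_inner (𝕜 := ℝ) (E := Euc n)).toContinuousLinearMap
  have h2 : HasFDerivAt (fun z => D (G z)) (D.comp (fderiv ℝ G y)) y :=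
    D.hasFDerivAt.comp y hG.hasFDerivAt
  have := second_derivative_symmetric_of_eventually (f := f) (f' := fun z => D (G z))
    (hf.mono fun z hz => hz.hasFDerivAt.congr_fderiv (by ext; rfl)) h2 v w
  have e : ∀ a b, D.comp (fderiv ℝ G y) a b = inner ℝ (fderiv ℝ G y a) b := fun a b => rfl
  rw [e, e] at this
  rw [this, real_inner_comm]

/-- The two quadratic bounds already make c(x, ·) + R differentiable at y; subtracting c(x, ·) gives
R without differentiating under the integral. -/
theorem IsConvexLandscape.hasGradientAt {X : Set (Euc m)} {Y : Set (Euc n)}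
    {c : Euc m → Euc n → ℝ} {R : Euc n → ℝ} {g : Euc m × Euc n → Euc n} {r : Euc n → Euc n}
    {C K : ℝ} (h : IsConvexLandscape X Y c R g r C K) (hYo : IsOpen Y) {x : Euc m} (hx : x ∈ X)
    {y : Euc n} (hy : y ∈ Y) (hc : HasGradientAt (c x) (g (x, y)) y) : HasGradientAt R (r y) y := by
  have h1 : HasGradientAt (fun y => c x y + R y) (g (x, y) + r y) y := by
    refine hasGradientAt_of_quadratic_bounds (C := C / 2) (K := K / 2) ?_ ?_
    · filter_upwards [hYo.mem_nhds hy] with y' hy' using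
        h.lower x hx y (subset_closure hy) y' (subset_closure hy')
    · filter_upwards [hYo.mem_nhds hy] with y' hy' using
        h.upper x hx y (subset_closure hy) y' (subset_closure hy')
  have h2 := h1.hasFDerivAt.sub hc.hasFDerivAt
  rw [hasGradientAt_iff_hasFDerivAt]
  refine (h2.congr_fderiv ?_).congr_of_eventuallyEq (Eventually.of_forall fun z => ?_)
  · rw [map_add, add_sub_cancel_left]
  · simp

theorem contDiffOn_integral_of_isC1UpToBoundary {A Y : Set (Euc n)} (hA : IsOpen A)
    (hYo : IsOpen Y) (hAb : Bornology.IsBounded A) (hYb : Bornology.IsBounded Y)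
    {G : Euc n × Euc n → Euc n} (hG : IsC1UpToBoundary (A ×ˢ Y) G)
    {ν : Measure (Euc n)} [IsFiniteMeasure ν] (hν : ν Aᶜ = 0) :
    ContDiffOn ℝ 1 (fun y => ∫ z, G (z, y) ∂ν) Y := by
  have hcomp : IsCompact (closure (A ×ˢ Y)) := by
    rw [closure_prod_eq]
    exact hAb.isCompact_closure.prod hYb.isCompact_closure
  obtain ⟨K, hK0, hK⟩ := hG.exists_bound_fderiv (hA.prod hYo) hcomp
  obtain ⟨M, hM⟩ := hcomp.exists_bound_of_continuousOn hG.continuousOn_extendFrom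
  have hae : ∀ᵐ z ∂ν, z ∈ A := mem_ae_iff.2 hν
  have hres : ν.restrict A = ν := Measure.restrict_eq_self_of_ae_mem hae
  have hcont : ∀ y ∈ Y, ContinuousOn (fun z => G (z, y)) A := fun y hy =>
    hG.contDiffOn.continuousOn.comp (by fun_prop) fun z hz => ⟨hz, hy⟩
  have hmeas : ∀ y ∈ Y, AEStronglyMeasurable (fun z => G (z, y)) ν := fun y hy => by
    rw [← hres]
    exact (hcont y hy).aestronglyMeasurable hA.measurableSet
  have hfc : ContinuousOn (fderiv ℝ G) (A ×ˢ Y) :=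
    hG.contDiffOn.continuousOn_fderiv_of_isOpen (hA.prod hYo) le_rfl
  set F' : Euc n → Euc n → (Euc n →L[ℝ] Euc n) := fun y z =>
    (fderiv ℝ G (z, y)).comp (ContinuousLinearMap.inr ℝ (Euc n) (Euc n))
  have hcompc : Continuous fun L : Euc n × Euc n →L[ℝ] Euc n =>
      L.comp (ContinuousLinearMap.inr ℝ (Euc n) (Euc n)) :=
    ((ContinuousLinearMap.compL ℝ (Euc n) (Euc n × Euc n) (Euc n)).flip
      (ContinuousLinearMap.inr ℝ (Euc n) (Euc n))).continuous
  have hF'm : ∀ y ∈ Y, AEStronglyMeasurable (F' y) ν := fun y hy => by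
    rw [← hres]
    refine ContinuousOn.aestronglyMeasurable ?_ hA.measurableSet
    exact hcompc.comp_continuousOn (hfc.comp (f := fun z => (z, y)) (by fun_prop)
      fun z hz => ⟨hz, hy⟩)
  have hF'b : ∀ z ∈ A, ∀ y ∈ Y, ‖F' y z‖ ≤ K := fun z hz y hy => by
    refine (ContinuousLinearMap.opNorm_comp_le _ _).trans ?_
    calc _ ≤ K * 1 := mul_le_mul (hK _ ⟨hz, hy⟩)
          (ContinuousLinearMap.norm_inr_le_one ℝ (Euc n) (Euc n)) (norm_nonneg _) hK0
      _ = K := mul_one K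
  have hder : ∀ y ∈ Y, HasFDerivAt (fun y => ∫ z, G (z, y) ∂ν) (∫ z, F' y z ∂ν) y := by
    intro y hy
    refine hasFDerivAt_integral_of_dominated_of_fderiv_le (F := fun y z => G (z, y)) (F' := F')
      (bound := fun _ => K) (s := Y) (hYo.mem_nhds hy) ?_ ?_ (hF'm y hy) ?_ (integrable_const K) ?_
    · filter_upwards [hYo.mem_nhds hy] with y' hy' using hmeas y' hy'
    · refine Integrable.of_bound (hmeas y hy) M ?_
      filter_upwards [hae] with z hz
      have := hM (z, y) (subset_closure ⟨hz, hy⟩)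
      rwa [hG.extendFrom_eq ⟨hz, hy⟩] at this
    · filter_upwards [hae] with z hz y' hy' using hF'b z hz y' hy'
    · filter_upwards [hae] with z hz y' hy'
      exact (hG.differentiableAt (hA.prod hYo) (x := (z, y')) ⟨hz, hy'⟩).hasFDerivAt.comp y'
        (hasFDerivAt_prodMk_right z y')
  rw [show (1 : WithTop ℕ∞) = 0 + 1 by simp, contDiffOn_succ_iff_fderiv_of_isOpen hYo]
  refine ⟨fun y hy => (hder y hy).differentiableAt.differentiableWithinAt, by simp, ?_⟩
  rw [contDiffOn_zero]
  refine ContinuousOn.congr (f := fun y => ∫ z, F' y z ∂ν) ?_ fun y hy => (hder y hy).fderiv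
  refine continuousOn_of_dominated (bound := fun _ => K) hF'm (fun y hy => ?_)
    (integrable_const K) ?_
  · filter_upwards [hae] with z hz using hF'b z hz y hy
  · filter_upwards [hae] with z hz
    exact hcompc.comp_continuousOn (hfc.comp (f := fun y => (z, y)) (by fun_prop)
      fun y hy => ⟨hz, hy⟩)

/-- Once ν is concentrated on the open set Y, the extended gradient agrees with the actual one for
almost every z, and it may be differentiated under the integral. -/
theorem contDiffOn_meanFieldGradient {Y : Set (Euc n)} (hYo : IsOpen Y)
    (hYb : Bornology.IsBounded Y) {V : Euc n → ℝ} {W : Euc n → Euc n → ℝ}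
    (hV : IsC2UpToBoundary Y V)
    (hW : IsC2UpToBoundary (Y ×ˢ Y) (fun p : Euc n × Euc n => W p.1 p.2))
    {ν : Measure (Euc n)} [IsFiniteMeasure ν] (hν : ν Yᶜ = 0) :
    ContDiffOn ℝ 1 (meanFieldGradient Y V W ν) Y := by
  have hG := isC1UpToBoundary_interactionGradient hYo hV hW
  refine (contDiffOn_integral_of_isC1UpToBoundary hYo hYo hYb hYb hG hν).congr fun y hy => ?_
  refine integral_congr_ae ?_
  filter_upwards [mem_ae_iff.2 hν] with z hz
  exact hG.extendFrom_eq ⟨hz, hy⟩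

end MeanFieldRegularity

/-! ### The implicit function theorem for the map of minimizers -/

section ArgminRegularity

variable {m n : ℕ} {X : Set (Euc m)} {Y : Set (Euc n)} {c : Euc m → Euc n → ℝ}
  {R : Euc n → ℝ} {r : Euc n → Euc n} {C K : ℝ}

theorem le_inner_fderiv_of_strongly_monotone {G : Euc n → Euc n} {y : Euc n}
    (hG : DifferentiableAt ℝ G y) (hmon : ∀ᶠ y' in 𝓝 y, C * ‖y' - y‖ ^ 2 ≤
      inner ℝ (G y' - G y) (y' - y)) (v : Euc n) :
    C * ‖v‖ ^ 2 ≤ inner ℝ (fderiv ℝ G y v) v := by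
  have h1 : HasDerivAt (fun t : ℝ => y + t • v) v 0 := by
    simpa using ((hasDerivAt_id (0 : ℝ)).smul_const v).const_add y
  have h2 : HasDerivAt (fun t : ℝ => G (y + t • v)) (fderiv ℝ G y v) 0 :=
    HasFDerivAt.comp_hasDerivAt (0 : ℝ) (by simpa using hG.hasFDerivAt) h1
  have h3 := h2.tendsto_slope_zero_right
  simp only [zero_add, zero_smul, add_zero] at h3
  have h4 : Tendsto (fun t : ℝ => inner ℝ (t⁻¹ • (G (y + t • v) - G y)) v) (𝓝[>] 0)
      (𝓝 (inner ℝ (fderiv ℝ G y v) v)) := h3.inner tendsto_const_nhds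
  refine ge_of_tendsto h4 ?_
  have h5 : Tendsto (fun t : ℝ => y + t • v) (𝓝[>] 0) (𝓝 y) := by
    have := h1.continuousAt.tendsto
    simp only [zero_smul, add_zero] at this
    exact this.mono_left nhdsWithin_le_nhds
  filter_upwards [h5.eventually hmon, self_mem_nhdsWithin] with t ht ht0
  rw [mem_Ioi] at ht0
  rw [add_sub_cancel_left, inner_smul_right, norm_smul, mul_pow, Real.norm_of_nonneg ht0.le] at ht
  rw [real_inner_smul_left, ← div_eq_inv_mul, le_div_iff₀' ht0]
  have : t * (t * (C * ‖v‖ ^ 2)) ≤ t * inner ℝ (G (y + t • v) - G y) v := by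
    rw [show t * (t * (C * ‖v‖ ^ 2)) = C * (t ^ 2 * ‖v‖ ^ 2) by ring]
    exact ht
  exact le_of_mul_le_mul_left this ht0

theorem le_inner_hessian (hXo : IsOpen X) (hYo : IsOpen Y)
    (hgc : IsC1UpToBoundary (X ×ˢ Y) (partialGradient c))
    (h : IsConvexLandscape X Y c R (extendFrom (X ×ˢ Y) (partialGradient c)) r C K)
    (hr : ContDiffOn ℝ 1 r Y) {x : Euc m} {y : Euc n} (hx : x ∈ X) (hy : y ∈ Y) (v : Euc n) :
    C * ‖v‖ ^ 2 ≤ inner ℝ (fderiv ℝ (gradient (c x)) y v + fderiv ℝ r y v) v := by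
  have hcd : DifferentiableAt ℝ (gradient (c x)) y :=
    differentiableAt_curry_right (hgc.differentiableAt (hXo.prod hYo) (x := (x, y)) ⟨hx, hy⟩)
  have hrd : DifferentiableAt ℝ r y :=
    (hr.contDiffAt (hYo.mem_nhds hy)).differentiableAt one_ne_zero
  have := le_inner_fderiv_of_strongly_monotone (C := C) (hcd.add hrd) (by
    filter_upwards [hYo.mem_nhds hy] with y' hy'
    have h1 := h.strongly_monotone hx (subset_closure hy) (subset_closure hy')
    rw [hgc.extendFrom_eq (p := (x, y)) ⟨hx, hy⟩, hgc.extendFrom_eq (p := (x, y')) ⟨hx, hy'⟩] at h1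
    exact h1) v
  rwa [fderiv_add hcd hrd] at this

/-- The map of minimizers is `C¹` where its values are interior points, with the derivative given
by the implicit function theorem. -/
theorem contDiffAt_argmin (hXo : IsOpen X) (hYo : IsOpen Y)
    (hgc : IsC1UpToBoundary (X ×ˢ Y) (partialGradient c))
    (h : IsConvexLandscape X Y c R (extendFrom (X ×ˢ Y) (partialGradient c)) r C K)
    (hr : ContDiffOn ℝ 1 r Y) {T : Euc m → Euc n} (hTc : ContinuousOn T X)
    (hT0 : ∀ x ∈ X, extendFrom (X ×ˢ Y) (partialGradient c) (x, T x) + r (T x) = 0)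
    {x : Euc m} (hx : x ∈ X) (hxY : T x ∈ Y) :
    ContDiffAt ℝ 1 T x ∧
      (fderiv ℝ (gradient (c x)) (T x) + fderiv ℝ r (T x)).comp (fderiv ℝ T x) =
        -(fderiv ℝ (partialGradient c) (x, T x)).comp
          (ContinuousLinearMap.inl ℝ (Euc m) (Euc n)) := by
  have hΩ := hXo.prod hYo
  set u : Euc m × Euc n := (x, T x)
  have hu : u ∈ X ×ˢ Y := ⟨hx, hxY⟩
  set F : Euc m × Euc n → Euc n := fun p => partialGradient c p + r p.2
  have hFc : ContDiffOn ℝ 1 F (X ×ˢ Y) :=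
    hgc.contDiffOn.add (hr.comp contDiff_snd.contDiffOn fun p hp => hp.2)
  have cdf : ContDiffAt ℝ 1 F u := hFc.contDiffAt (hΩ.mem_nhds hu)
  have hgd := hgc.differentiableAt hΩ hu
  have hrd : DifferentiableAt ℝ r (T x) :=
    (hr.contDiffAt (hYo.mem_nhds hxY)).differentiableAt one_ne_zero
  have hFd : HasFDerivAt F (fderiv ℝ (partialGradient c) u +
      (fderiv ℝ r (T x)).comp (ContinuousLinearMap.snd ℝ (Euc m) (Euc n))) u :=
    hgd.hasFDerivAt.add (HasFDerivAt.comp (g := r) u hrd.hasFDerivAt hasFDerivAt_snd)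
  have hH : fderiv ℝ (gradient (c x)) (T x) = (fderiv ℝ (partialGradient c) u).comp
      (ContinuousLinearMap.inr ℝ (Euc m) (Euc n)) :=
    (HasFDerivAt.comp (g := partialGradient c) (f := fun y => (x, y)) (T x) hgd.hasFDerivAt
      (hasFDerivAt_prodMk_right x (T x))).fderiv
  have hinr : fderiv ℝ F u ∘L ContinuousLinearMap.inr ℝ (Euc m) (Euc n) =
      fderiv ℝ (gradient (c x)) (T x) + fderiv ℝ r (T x) := by
    rw [hFd.fderiv, hH]
    ext v
    simp
  have hinl : fderiv ℝ F u ∘L ContinuousLinearMap.inl ℝ (Euc m) (Euc n) =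
      fderiv ℝ (partialGradient c) u ∘L ContinuousLinearMap.inl ℝ (Euc m) (Euc n) := by
    rw [hFd.fderiv]
    ext v
    simp
  have hinj : Function.Injective (fderiv ℝ (gradient (c x)) (T x) + fderiv ℝ r (T x)) := by
    rw [injective_iff_map_eq_zero]
    intro v hv
    have h1 := le_inner_hessian hXo hYo hgc h hr hx hxY v
    rw [← add_apply, hv, inner_zero_left] at h1
    by_contra hne
    have : 0 < C * ‖v‖ ^ 2 := mul_pos h.pos (pow_pos (norm_pos_iff.2 hne) 2)
    linarith
  have if₂ : (fderiv ℝ F u ∘L ContinuousLinearMap.inr ℝ (Euc m) (Euc n)).IsInvertible := by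
    rw [hinr]
    obtain ⟨e, he⟩ := exists_equiv_of_injective rfl hinj
    exact ⟨e, he⟩
  have hFT : ∀ x' ∈ X, T x' ∈ Y → F (x', T x') = 0 := fun x' hx' hx'Y => by
    have := hT0 x' hx'
    rwa [hgc.extendFrom_eq (p := (x', T x')) ⟨hx', hx'Y⟩] at this
  have hTx : ContinuousAt T x := hTc.continuousAt (hXo.mem_nhds hx)
  -- By continuity T stays in the neighbourhood where the zero of F is unique, so it agrees there
  -- with the implicit function.
  have heq : cdf.implicitFunction one_ne_zero if₂ =ᶠ[𝓝 x] T := by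
    have hcont : Tendsto (fun x' => (x', T x')) (𝓝 x) (𝓝 u) :=
      continuousAt_id.prodMk hTx
    filter_upwards [hcont.eventually (cdf.eventually_apply_eq_iff_implicitFunction one_ne_zero if₂),
      hXo.mem_nhds hx, hTx.preimage_mem_nhds (hYo.mem_nhds hxY)] with x' h1 h2 h3
    exact h1.1 ((hFT x' h2 h3).trans (hFT x hx hxY).symm)
  refine ⟨(cdf.contDiffAt_implicitFunction one_ne_zero if₂).congr_of_eventuallyEq heq.symm, ?_⟩
  have hd := ((cdf.hasStrictFDerivAt_implicitFunction one_ne_zero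
    if₂).hasFDerivAt.congr_of_eventuallyEq
    heq.symm).fderiv
  rw [hd, ← hinl, ← hinr, ContinuousLinearMap.comp_neg,
    ← ContinuousLinearMap.comp_assoc, if₂.self_comp_inverse, ContinuousLinearMap.id_comp]

end ArgminRegularity

/-! ### Hessian matrices and the Jacobian of the map of minimizers -/

section Hessians

variable {m n : ℕ} {f : Euc n → ℝ} {G : Euc n → Euc n} {y : Euc n}

theorem hasFDerivAt_gradient (hf : ∀ᶠ z in 𝓝 y, HasGradientAt f (G z) z)
    (hG : DifferentiableAt ℝ G y) : HasFDerivAt (gradient f) (fderiv ℝ G y) y :=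
  hG.hasFDerivAt.congr_of_eventuallyEq (hf.mono fun _ hz => hz.gradient)

theorem hessianMatrix_eq_of_hasGradientAt (hf : ∀ᶠ z in 𝓝 y, HasGradientAt f (G z) z)
    (hG : DifferentiableAt ℝ G y) (i j : Fin n) :
    hessianMatrix f y i j = fderiv ℝ G y (EuclideanSpace.single i 1) j := by
  have h := hasFDerivAt_gradient hf hG
  rw [hessianMatrix_apply h.differentiableAt, h.fderiv]

theorem dotProduct_hessianMatrix_mulVec_of_hasGradientAt
    (hf : ∀ᶠ z in 𝓝 y, HasGradientAt f (G z) z) (hG : DifferentiableAt ℝ G y) (v w : Euc n) :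
    v.ofLp ⬝ᵥ (hessianMatrix f y).mulVec w.ofLp = inner ℝ (fderiv ℝ G y v) w := by
  have h := hasFDerivAt_gradient hf hG
  rw [dotProduct_hessianMatrix_mulVec h.differentiableAt, h.fderiv]

theorem isSymm_hessianMatrix (hf : ∀ᶠ z in 𝓝 y, HasGradientAt f (G z) z)
    (hG : DifferentiableAt ℝ G y) : (hessianMatrix f y).IsSymm := by
  ext i j
  rw [Matrix.transpose_apply, hessianMatrix_eq_of_hasGradientAt hf hG,
    hessianMatrix_eq_of_hasGradientAt hf hG]
  have := inner_fderiv_comm_of_hasGradientAt hf hG (EuclideanSpace.single j 1)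
    (EuclideanSpace.single i 1)
  simpa [EuclideanSpace.inner_single_left, EuclideanSpace.inner_single_right] using this

theorem det_eq_of_apply_single {L : Euc n →L[ℝ] Euc n} {M : Matrix (Fin n) (Fin n) ℝ}
    (h : ∀ i j, M i j = L (EuclideanSpace.single i 1) j) :
    M.det = LinearMap.det (L : Euc n →ₗ[ℝ] Euc n) := by
  rw [← LinearMap.det_toMatrix (EuclideanSpace.basisFun (Fin n) ℝ).toBasis, ← Matrix.det_transpose]
  congr 1
  ext i j
  rw [Matrix.transpose_apply, h, LinearMap.toMatrix_apply]
  simp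

theorem normDet_adjoint_eq_sqrt {M : Euc m →L[ℝ] Euc n} {B : Matrix (Fin m) (Fin n) ℝ}
    (h : ∀ i j, B i j = M (EuclideanSpace.single i 1) j) :
    (ContinuousLinearMap.adjoint M : Euc n →ₗ[ℝ] Euc m).normDet = Real.sqrt |(Bᵀ * B).det| := by
  have h1 := LinearMap.normDet_sq_eq_det_gram
    (ContinuousLinearMap.adjoint M : Euc n →ₗ[ℝ] Euc m) (EuclideanSpace.basisFun (Fin n) ℝ)
  have h2 : Matrix.gram ℝ (fun j => (ContinuousLinearMap.adjoint M : Euc n →ₗ[ℝ] Euc m)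
      (EuclideanSpace.basisFun (Fin n) ℝ j)) = Bᵀ * B := by
    have hcoord : ∀ (i : Fin n) (k : Fin m),
        ContinuousLinearMap.adjoint M (EuclideanSpace.single i 1) k = B k i := by
      intro i k
      have := ContinuousLinearMap.adjoint_inner_right M (EuclideanSpace.single k (1 : ℝ))
        (EuclideanSpace.single i (1 : ℝ))
      rw [EuclideanSpace.inner_single_left, EuclideanSpace.inner_single_right] at this
      simpa [h] using this
    ext i j
    simp [Matrix.gram, Matrix.mul_apply, PiLp.inner_apply, hcoord, mul_comm]
  rw [h2] at h1
  simp only [RCLike.ofReal_real_eq_id, id_eq] at h1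
  rw [← h1, abs_of_nonneg (sq_nonneg _), Real.sqrt_sq (LinearMap.normDet_nonneg _)]

/-- H is self-adjoint, so taking adjoints of H D = -M gives D* H = -M*, and precomposition with an
endomorphism multiplies the Jacobian by |det H|. -/
theorem normDet_adjoint_mul_abs_det {E F : Type*} [NormedAddCommGroup E] [InnerProductSpace ℝ E]
    [FiniteDimensional ℝ E] [NormedAddCommGroup F] [InnerProductSpace ℝ F] [FiniteDimensional ℝ F]
    {H : F →L[ℝ] F} {D M : E →L[ℝ] F} (h : H.comp D = -M)
    (hH : ∀ v w, inner ℝ (H v) w = inner ℝ v (H w)) :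
    (ContinuousLinearMap.adjoint D : F →ₗ[ℝ] E).normDet * |LinearMap.det (H : F →ₗ[ℝ] F)| =
      (ContinuousLinearMap.adjoint M : F →ₗ[ℝ] E).normDet := by
  have hadj : ContinuousLinearMap.adjoint H = H := by
    symm
    rw [ContinuousLinearMap.eq_adjoint_iff]
    exact hH
  have h1 : (ContinuousLinearMap.adjoint D).comp H = -ContinuousLinearMap.adjoint M := by
    rw [← map_neg, ← h, ContinuousLinearMap.adjoint_comp, hadj]
  rw [← LinearMap.normDet_eq_abs_det, ← LinearMap.normDet_comp_of_finrank_eq _ _ rfl,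
    ← LinearMap.normDet_neg (ContinuousLinearMap.adjoint M : F →ₗ[ℝ] E)]
  exact congrArg (fun A : F →L[ℝ] E => (A : F →ₗ[ℝ] E).normDet) h1

end Hessians

/-! ### The density of the image measure -/

section Density

variable {m n : ℕ} {X : Set (Euc m)} {Y : Set (Euc n)} {c : Euc m → Euc n → ℝ}
  {R : Euc n → ℝ} {r : Euc n → Euc n} {C K : ℝ}

/-- The Jacobian of the map of minimizers. -/
theorem normDet_adjoint_fderiv_argmin (hXo : IsOpen X) (hYo : IsOpen Y)
    (hc : IsC2UpToBoundary (X ×ˢ Y) (fun p : Euc m × Euc n => c p.1 p.2))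
    (hnd : IsNondegenerate X Y c)
    (h : IsConvexLandscape X Y c R (extendFrom (X ×ˢ Y) (partialGradient c)) r C K)
    (hr : ContDiffOn ℝ 1 r Y) (hR : ∀ y ∈ Y, HasGradientAt R (r y) y) {T : Euc m → Euc n}
    (hTc : ContinuousOn T X)
    (hT0 : ∀ x ∈ X, extendFrom (X ×ˢ Y) (partialGradient c) (x, T x) + r (T x) = 0)
    {x : Euc m} (hx : x ∈ X) (hxY : T x ∈ Y) :
    Function.Surjective (fderiv ℝ T x) ∧
    0 < (ContinuousLinearMap.adjoint (fderiv ℝ T x) : Euc n →ₗ[ℝ] Euc m).normDet ∧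
    (hessianMatrix (c x) (T x) - -hessianMatrix R (T x)).det /
      Real.sqrt |((mixedHessian c x (T x))ᵀ * mixedHessian c x (T x)).det| =
      ((ContinuousLinearMap.adjoint (fderiv ℝ T x) : Euc n →ₗ[ℝ] Euc m).normDet)⁻¹ := by
  have hΩ := hXo.prod hYo
  have hgc := isC1UpToBoundary_partialGradient hΩ hc
  have hgd := hgc.differentiableAt hΩ (x := (x, T x)) ⟨hx, hxY⟩
  have hcd : DifferentiableAt ℝ (gradient (c x)) (T x) := differentiableAt_curry_right hgd
  have hrd : DifferentiableAt ℝ r (T x) :=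
    (hr.contDiffAt (hYo.mem_nhds hxY)).differentiableAt one_ne_zero
  have hcg : ∀ᶠ z in 𝓝 (T x), HasGradientAt (c x) (gradient (c x) z) z := by
    filter_upwards [hYo.mem_nhds hxY] with z hz using
      hasGradientAt_curry hΩ hc.2.1 (p := (x, z)) ⟨hx, hz⟩
  have hRg : ∀ᶠ z in 𝓝 (T x), HasGradientAt R (r z) z := by
    filter_upwards [hYo.mem_nhds hxY] with z hz using hR z hz
  set H := fderiv ℝ (gradient (c x)) (T x) + fderiv ℝ r (T x) with hH_def
  set M := (fderiv ℝ (partialGradient c) (x, T x)).comp (ContinuousLinearMap.inl ℝ (Euc m) (Euc n))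
  have hHD : H.comp (fderiv ℝ T x) = -M := (contDiffAt_argmin hXo hYo hgc h hr hTc hT0 hx hxY).2
  have hHpos : ∀ v, C * ‖v‖ ^ 2 ≤ inner ℝ (H v) v := le_inner_hessian hXo hYo hgc h hr hx hxY
  have hHpos' : ∀ v ≠ 0, 0 < inner ℝ (H v) v := fun v hv =>
    (mul_pos h.pos (pow_pos (norm_pos_iff.2 hv) 2)).trans_le (hHpos v)
  have hHinj : Function.Injective H := by
    rw [injective_iff_map_eq_zero]
    intro v hv
    by_contra hne
    have := hHpos' v hne
    rw [hv, inner_zero_left] at this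
    exact lt_irrefl _ this
  have hMsurj : Function.Surjective M := by
    refine surjective_of_isNondegenerate hXo hYo hgc hnd (subset_closure hx)
      (subset_closure hxY) (L := fderiv ℝ (partialGradient c) (x, T x)) ?_
    exact (hgc.contDiffOn.continuousOn_fderiv_of_isOpen hΩ le_rfl) (x, T x) ⟨hx, hxY⟩
  have hDsurj : Function.Surjective (fderiv ℝ T x) := by
    intro w
    obtain ⟨v, hv⟩ := hMsurj (-H w)
    refine ⟨v, hHinj ?_⟩
    have := DFunLike.congr_fun hHD v
    rw [ContinuousLinearMap.comp_apply, neg_apply, hv, neg_neg] at this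
    exact this
  have hHsymm : ∀ v w, inner ℝ (H v) w = inner ℝ v (H w) := fun v w => by
    rw [hH_def, add_apply, add_apply, inner_add_left, inner_add_right,
      inner_fderiv_comm_of_hasGradientAt hcg hcd, inner_fderiv_comm_of_hasGradientAt hRg hrd]
  set A := hessianMatrix (c x) (T x) - -hessianMatrix R (T x) with hA_def
  have hAH : ∀ i j, A i j = H (EuclideanSpace.single i 1) j := fun i j => by
    rw [hA_def, sub_neg_eq_add, Matrix.add_apply, hessianMatrix_eq_of_hasGradientAt hcg hcd,
      hessianMatrix_eq_of_hasGradientAt hRg hrd]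
    rfl
  -- Positivity, from strong convexity, removes the absolute value that the Jacobian identity
  -- produces.
  have hApos : 0 < A.det := by
    refine (Matrix.PosDef.of_dotProduct_mulVec_pos ?_ fun v hv => ?_).det_pos
    · rw [Matrix.IsHermitian, Matrix.conjTranspose_eq_transpose_of_trivial, hA_def, sub_neg_eq_add,
        Matrix.transpose_add, (isSymm_hessianMatrix hcg hcd).eq, (isSymm_hessianMatrix hRg hrd).eq]
    · have h1 := hHpos' (WithLp.toLp 2 v) (by simpa using hv)
      rw [hA_def, sub_neg_eq_add, star_trivial, Matrix.add_mulVec, dotProduct_add,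
        show v = (WithLp.toLp 2 v : Euc n).ofLp from rfl,
        dotProduct_hessianMatrix_mulVec_of_hasGradientAt hcg hcd,
        dotProduct_hessianMatrix_mulVec_of_hasGradientAt hRg hrd, ← inner_add_left]
      exact h1
  have hJ : 0 < (ContinuousLinearMap.adjoint (fderiv ℝ T x) : Euc n →ₗ[ℝ] Euc m).normDet := by
    refine LinearMap.normDet_pos_of_injective ?_
    rw [← LinearMap.ker_eq_bot, LinearMap.ker_eq_bot']
    intro w hw
    obtain ⟨v, rfl⟩ := hDsurj w
    have := ContinuousLinearMap.adjoint_inner_right (fderiv ℝ T x) v (fderiv ℝ T x v)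
    rw [show ContinuousLinearMap.adjoint (fderiv ℝ T x) (fderiv ℝ T x v) = 0 from hw,
      inner_zero_right] at this
    exact inner_self_eq_zero.1 this.symm
  refine ⟨hDsurj, hJ, ?_⟩
  have hB : ∀ i j, mixedHessian c x (T x) i j = M (EuclideanSpace.single i 1) j := fun i j =>
    mixedHessian_apply hgd i j
  have key := normDet_adjoint_mul_abs_det hHD hHsymm
  rw [← det_eq_of_apply_single hAH, abs_of_pos hApos, normDet_adjoint_eq_sqrt hB] at key
  rw [← key]
  field_simp

theorem measurable_normDet_adjoint_fderiv (T : Euc m → Euc n) : Measurable fun x =>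
    (ContinuousLinearMap.adjoint (fderiv ℝ T x) : Euc n →ₗ[ℝ] Euc m).normDet := by
  have h : Continuous fun A : Euc m →L[ℝ] Euc n =>
      (ContinuousLinearMap.adjoint A : Euc n →ₗ[ℝ] Euc m).normDet :=
    ContinuousLinearMap.continuous_normDet.comp
      (ContinuousLinearMap.adjoint : (Euc m →L[ℝ] Euc n) ≃ₗᵢ⋆[ℝ] _).continuous
  exact h.measurable.comp (measurable_fderiv ℝ T)

/-- The density of the image of an absolutely continuous measure under a `C¹` submersion. -/
theorem ae_rnDeriv_map_eq_lintegral {U : Set (Euc m)} (hU : IsOpen U) (hnm : n ≤ m)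
    {T : Euc m → Euc n} (hTm : Measurable T) (hT : ContDiffOn ℝ 1 T U)
    (hsurj : ∀ x ∈ U, Function.Surjective (fderiv ℝ T x))
    (hpos : ∀ x ∈ U,
      0 < (ContinuousLinearMap.adjoint (fderiv ℝ T x) : Euc n →ₗ[ℝ] Euc m).normDet)
    {μ : Measure (Euc m)} [IsFiniteMeasure μ] (hμ : μ ≪ volume) (hμU : μ Uᶜ = 0) :
    ∀ᵐ y, (μ.map T).rnDeriv volume y =
        ∫⁻ x in U ∩ T ⁻¹' {y}, ENNReal.ofReal ((μ.rnDeriv volume x).toReal /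
          (ContinuousLinearMap.adjoint (fderiv ℝ T x) : Euc n →ₗ[ℝ] Euc m).normDet) ∂μHE[m - n] ∧
      (μ.map T).rnDeriv volume y < ∞ := by
  set J : Euc m → ℝ := fun x =>
    (ContinuousLinearMap.adjoint (fderiv ℝ T x) : Euc n →ₗ[ℝ] Euc m).normDet
  set f : Euc m → ℝ≥0∞ := fun x => ENNReal.ofReal ((μ.rnDeriv volume x).toReal / J x)
  have hJm : Measurable J := measurable_normDet_adjoint_fderiv T
  have hfm : Measurable f :=
    ((Measure.measurable_rnDeriv μ volume).ennreal_toReal.div hJm).ennreal_ofReal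
  have hdim : Module.finrank ℝ (Euc m) = Module.finrank ℝ (Euc n) + (m - n) := by simp; omega
  set I : Euc n → ℝ≥0∞ := fun y => ∫⁻ x in U ∩ T ⁻¹' {y}, f x ∂μHE[m - n]
  have hIm : Measurable I := (lintegral_coarea hU hT hsurj hdim hfm).1
  have hmap : μ.map T = volume.withDensity I := by
    ext B hB
    rw [Measure.map_apply hTm hB, withDensity_apply _ hB]
    have hpre : MeasurableSet (T ⁻¹' B) := hTm hB
    have h1 := (lintegral_coarea hU hT hsurj hdim (hfm.indicator hpre)).2
    -- The indicator of T ⁻¹' B is constant on each fibre, so it leaves the inner integral as the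
    -- indicator of B.
    have h2 : ∀ y, ∫⁻ x in U ∩ T ⁻¹' {y}, (T ⁻¹' B).indicator f x ∂μHE[m - n] =
        B.indicator I y := by
      intro y
      have hms : MeasurableSet (U ∩ T ⁻¹' {y}) :=
        hU.measurableSet.inter (hTm (measurableSet_singleton y))
      by_cases hy : y ∈ B
      · rw [indicator_of_mem hy]
        refine setLIntegral_congr_fun hms fun x hx => ?_
        have : T x = y := hx.2
        exact indicator_of_mem (by rw [mem_preimage, this]; exact hy) f
      · rw [indicator_of_notMem hy]
        rw [setLIntegral_congr_fun (g := fun _ => 0) hms fun x hx => ?_]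
        · simp
        have : T x = y := hx.2
        exact indicator_of_notMem (by rw [mem_preimage, this]; exact hy) f
    rw [lintegral_congr h2, lintegral_indicator hB] at h1
    rw [h1]
    have h3 : μ (T ⁻¹' B) = μ (T ⁻¹' B ∩ U) := (measure_inter_conull' (by
      exact measure_mono_null (fun x hx => hx.2) hμU)).symm
    rw [h3]
    conv_lhs => rw [← Measure.withDensity_rnDeriv_eq μ volume hμ]
    rw [withDensity_apply _ (hpre.inter hU.measurableSet), ← setLIntegral_indicator hpre]
    refine lintegral_congr_ae ?_
    filter_upwards [ae_restrict_mem hU.measurableSet,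
      ae_restrict_of_ae (Measure.rnDeriv_lt_top μ volume)] with x hx hlt
    by_cases hxB : x ∈ T ⁻¹' B
    · rw [indicator_of_mem hxB, indicator_of_mem hxB, ← ENNReal.ofReal_mul
        (div_nonneg ENNReal.toReal_nonneg (hpos x hx).le), div_mul_cancel₀ _ (hpos x hx).ne',
        ENNReal.ofReal_toReal hlt.ne]
    · rw [indicator_of_notMem hxB, indicator_of_notMem hxB, zero_mul]
  have := Measure.isFiniteMeasure_map μ T
  filter_upwards [Measure.rnDeriv_withDensity volume hIm,
    Measure.rnDeriv_lt_top (μ.map T) volume] with y h1 h2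
  refine ⟨?_, h2⟩
  conv_lhs => rw [hmap]
  exact h1

/-- The Monge–Ampère type equation for the image of `μ` under the map of minimizers, in terms of
the mean field. -/
theorem ae_integrableOn_mongeAmpere (hnm : n ≤ m) (hXo : IsOpen X) (hYo : IsOpen Y)
    (hc : IsC2UpToBoundary (X ×ˢ Y) (fun p : Euc m × Euc n => c p.1 p.2))
    (hnd : IsNondegenerate X Y c)
    (h : IsConvexLandscape X Y c R (extendFrom (X ×ˢ Y) (partialGradient c)) r C K)
    (hr : ContDiffOn ℝ 1 r Y) (hR : ∀ y ∈ Y, HasGradientAt R (r y) y) {T : Euc m → Euc n}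
    (hTm : Measurable T) (hTc : ContinuousOn T X)
    (hT0 : ∀ x ∈ X, extendFrom (X ×ˢ Y) (partialGradient c) (x, T x) + r (T x) = 0)
    (hTu : ∀ x ∈ X, ∀ y ∈ closure Y,
      extendFrom (X ×ˢ Y) (partialGradient c) (x, y) + r y = 0 → y = T x)
    {μ : Measure (Euc m)} [IsFiniteMeasure μ] (hμX : μ Xᶜ = 0) (hμ : μ ≪ volume)
    (hμY : μ (T ⁻¹' Yᶜ) = 0) :
    ∀ᵐ y ∂(volume : Measure (Euc n)), y ∈ Y →
      IntegrableOn (mongeAmpereIntegrand c μ y (-hessianMatrix R y))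
        (levelSet X c y (-r y)) μHE[m - n] ∧
      ((μ.map T).rnDeriv volume y).toReal = ∫ x in levelSet X c y (-r y),
        mongeAmpereIntegrand c μ y (-hessianMatrix R y) x ∂μHE[m - n] := by
  have hgc := isC1UpToBoundary_partialGradient (hXo.prod hYo) hc
  have hU : IsOpen (X ∩ T ⁻¹' Y) := hTc.isOpen_inter_preimage hXo hYo
  have hjac := fun x (hx : x ∈ X ∩ T ⁻¹' Y) =>
    normDet_adjoint_fderiv_argmin hXo hYo hc hnd h hr hR hTc hT0 hx.1 hx.2
  have hmain := ae_rnDeriv_map_eq_lintegral hU hnm hTm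
    (fun x hx => (contDiffAt_argmin hXo hYo hgc h hr hTc hT0 hx.1 hx.2).1.contDiffWithinAt)
    (fun x hx => (hjac x hx).1) (fun x hx => (hjac x hx).2.1) hμ
    (by rw [compl_inter]; exact measure_union_null hμX hμY)
  filter_upwards [hmain] with y hy hyY
  have hms : MeasurableSet (X ∩ T ⁻¹' Y ∩ T ⁻¹' {y}) :=
    hU.measurableSet.inter (hTm (measurableSet_singleton y))
  -- D_y c(x, y) = -r(y) is the critical point equation, whose unique solution for given x is T x.
  have hlevel : levelSet X c y (-r y) = X ∩ T ⁻¹' Y ∩ T ⁻¹' {y} := by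
    ext x
    constructor
    · rintro ⟨hx, hgr⟩
      have : y = T x := by
        refine hTu x hx y (subset_closure hyY) ?_
        rw [hgc.extendFrom_eq (p := (x, y)) ⟨hx, hyY⟩]
        change gradient (c x) y + r y = 0
        rw [hgr, neg_add_cancel]
      exact ⟨⟨hx, by rw [mem_preimage, ← this]; exact hyY⟩, this.symm⟩
    · rintro ⟨⟨hx, hxY⟩, rfl⟩
      refine ⟨hx, ?_⟩
      have := hT0 x hx
      rw [hgc.extendFrom_eq (p := (x, T x)) ⟨hx, hxY⟩] at this
      exact eq_neg_of_add_eq_zero_left this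
  set f : Euc m → ℝ := fun x => (μ.rnDeriv volume x).toReal /
      (ContinuousLinearMap.adjoint (fderiv ℝ T x) : Euc n →ₗ[ℝ] Euc m).normDet
  have hf : EqOn (mongeAmpereIntegrand c μ y (-hessianMatrix R y)) f
      (X ∩ T ⁻¹' Y ∩ T ⁻¹' {y}) := by
    rintro x ⟨hx, rfl⟩
    simp only [mongeAmpereIntegrand]
    rw [(hjac x hx).2.2, ← div_eq_inv_mul]
  have hf0 : ∀ x, 0 ≤ f x := fun x => div_nonneg ENNReal.toReal_nonneg (LinearMap.normDet_nonneg _)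
  have hfm : Measurable f := (Measure.measurable_rnDeriv μ volume).ennreal_toReal.div
    (measurable_normDet_adjoint_fderiv T)
  rw [hlevel]
  refine ⟨IntegrableOn.congr_fun ?_ hf.symm hms, ?_⟩
  · refine ⟨hfm.aestronglyMeasurable, ?_⟩
    rw [hasFiniteIntegral_iff_ofReal (Eventually.of_forall hf0), ← hy.1]
    exact hy.2
  · rw [setIntegral_congr_fun hms hf, integral_eq_lintegral_of_nonneg_ae
      (Eventually.of_forall hf0) hfm.aestronglyMeasurable, hy.1]

end Density

/-! ### Second-order expansions at density points -/

section SecondOrder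

variable {n : ℕ}

/-- Along s ↦ y + s k the derivative of f is affine in s up to ε s ‖k‖², so differentiability of the
gradient at the single point y is enough. -/
theorem taylor_upper {f : Euc n → ℝ} {G : Euc n → Euc n} {y : Euc n}
    (hf : ∀ᶠ z in 𝓝 y, HasGradientAt f (G z) z) (hG : DifferentiableAt ℝ G y) {ε : ℝ}
    (hε : 0 < ε) : ∀ᶠ k in 𝓝 (0 : Euc n), f (y + k) ≤
      f y + inner ℝ (G y) k + (inner ℝ (fderiv ℝ G y k) k + ε * ‖k‖ ^ 2) / 2 := by
  have h1 : ∀ᶠ k in 𝓝 (0 : Euc n), ‖G (y + k) - G y - fderiv ℝ G y k‖ ≤ ε * ‖k‖ :=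
    (hasFDerivAt_iff_isLittleO_nhds_zero.1 hG.hasFDerivAt).bound hε
  have h2 : ∀ᶠ k in 𝓝 (0 : Euc n), HasGradientAt f (G (y + k)) (y + k) := by
    have : Tendsto (fun k => y + k) (𝓝 (0 : Euc n)) (𝓝 y) := by
      simpa using (continuous_const_add y).tendsto (0 : Euc n)
    exact this.eventually hf
  obtain ⟨δ, hδ, hball⟩ := Metric.eventually_nhds_iff_ball.1 (h1.and h2)
  filter_upwards [Metric.ball_mem_nhds (0 : Euc n) hδ] with k hk
  have hmem : ∀ s ∈ Icc (0 : ℝ) 1, s • k ∈ Metric.ball (0 : Euc n) δ := fun s hs => by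
    rw [mem_ball_zero_iff] at hk ⊢
    rw [norm_smul, Real.norm_of_nonneg hs.1]
    exact (mul_le_of_le_one_left (norm_nonneg _) hs.2).trans_lt hk
  have := le_of_deriv_le_affine (ψ := fun s => f (y + s • k))
    (ψ' := fun s => inner ℝ (G (y + s • k)) k) (a := inner ℝ (G y) k)
    (b := inner ℝ (fderiv ℝ G y k) k + ε * ‖k‖ ^ 2)
    (fun s hs => by
      have h1 : HasDerivAt (fun s : ℝ => y + s • k) k s := by
        simpa using ((hasDerivAt_id s).smul_const k).const_add y
      have h2 := ((hball _ (hmem s hs)).2.hasFDerivAt).comp_hasDerivAt s h1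
      simpa [Function.comp_def] using h2)
    (fun s hs => by
      have h3 := (hball _ (hmem s hs)).1
      rw [map_smul, norm_smul, Real.norm_of_nonneg hs.1] at h3
      have h4 := (real_inner_le_norm (G (y + s • k) - G y - s • fderiv ℝ G y k) k).trans
        (mul_le_mul_of_nonneg_right h3 (norm_nonneg k))
      rw [inner_sub_left, inner_sub_left, real_inner_smul_left] at h4
      nlinarith)
  simpa using this

theorem isLittleO_taylor {f : Euc n → ℝ} {G : Euc n → Euc n} {y : Euc n}
    (hf : ∀ᶠ z in 𝓝 y, HasGradientAt f (G z) z) (hG : DifferentiableAt ℝ G y) :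
    (fun k => f (y + k) - f y - inner ℝ (G y) k - (1 / 2) * inner ℝ (fderiv ℝ G y k) k)
      =o[𝓝 0] fun k : Euc n => ‖k‖ ^ 2 := by
  refine isLittleO_iff.2 fun ε hε => ?_
  have h1 := taylor_upper hf hG hε
  have h2 := taylor_upper (f := fun z => -f z) (G := fun z => -G z) (y := y)
    (hf.mono fun z hz => by
      have := hz.hasFDerivAt.fun_neg
      rw [hasGradientAt_iff_hasFDerivAt]
      simpa using this) hG.fun_neg hε
  filter_upwards [h1, h2] with k hk1 hk2
  have e : fderiv ℝ (fun z => -G z) y = -fderiv ℝ G y := fderiv_fun_neg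
  rw [e, neg_apply, inner_neg_left, inner_neg_left] at hk2
  have h0 : 0 ≤ ε * ‖k‖ ^ 2 := by positivity
  rw [Real.norm_eq_abs, Real.norm_of_nonneg (by positivity), abs_le]
  constructor <;> linarith

/-- The quadratic term is itself o(‖k‖), so the expansion contains differentiability and determines
the gradient. -/
theorem hasHessianAt_of_isLittleO {v : Euc n → ℝ} {y p : Euc n} {A : Matrix (Fin n) (Fin n) ℝ}
    (hA : A.IsSymm) (h : (fun k : Euc n => v (y + k) - v y - inner ℝ p k
      - (1 / 2) * ∑ i, ∑ j, A i j * k i * k j) =o[𝓝 0] fun k : Euc n => ‖k‖ ^ 2) :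
    HasHessianAt v y A ∧ gradient v y = p := by
  have hq : (fun k : Euc n => (1 / 2) * ∑ i, ∑ j, A i j * k i * k j)
      =O[𝓝 0] fun k : Euc n => ‖k‖ ^ 2 := by
    refine (IsBigO.const_mul_left ?_ _)
    refine IsBigO.fun_sum fun i _ => IsBigO.fun_sum fun j _ => ?_
    refine IsBigO.of_bound ‖A i j‖ (Eventually.of_forall fun k => ?_)
    rw [norm_mul, norm_mul, mul_assoc, norm_pow, norm_norm, pow_two]
    gcongr
    · exact PiLp.norm_apply_le k i
    · exact PiLp.norm_apply_le k j
  have hsq : (fun k : Euc n => ‖k‖ ^ 2) =o[𝓝 0] fun k : Euc n => k := by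
    simpa using isLittleO_pow_sub_sub (0 : Euc n) one_lt_two
  have hg : HasGradientAt v p y := by
    rw [hasGradientAt_iff_isLittleO_nhds_zero]
    have := (h.isBigO.add hq).trans_isLittleO hsq
    simpa using this
  refine ⟨⟨hg.differentiableAt, hA, ?_⟩, hg.gradient⟩
  rw [hg.gradient]
  exact h

theorem sum_mul_eq_dotProduct (A : Matrix (Fin n) (Fin n) ℝ) (k : Euc n) :
    ∑ i, ∑ j, A i j * k i * k j = k.ofLp ⬝ᵥ A.mulVec k.ofLp := by
  simp only [dotProduct, Matrix.mulVec, Finset.mul_sum]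
  exact Finset.sum_congr rfl fun i _ => Finset.sum_congr rfl fun j _ => by ring

/-- Near a density point of `E`, every point of a ball is close to `E` relative to the radius. -/
theorem eventually_exists_mem_of_density {E : Set (Euc n)} {y : Euc n}
    (hE : Tendsto (fun ρ => volume (E ∩ Metric.closedBall y ρ) / volume (Metric.closedBall y ρ))
      (𝓝[>] 0) (𝓝 1)) {N : ℝ} (hN : 1 ≤ N) :
    ∀ᶠ ρ in 𝓝[>] (0 : ℝ), ∀ w ∈ Metric.closedBall y (2 * ρ), ∃ z ∈ E, ‖z - w‖ ≤ ρ / N := by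
  -- The fraction of the volume of a ball of radius 3ρ that a ball of radius ρ/N occupies. Such a
  -- hole in E would keep the density ratio at most 1 - θ. Radius 3ρ is needed because w ranges up
  -- to distance 2ρ.
  set θ : ℝ≥0∞ := ENNReal.ofReal ((1 / (3 * N)) ^ n)
  have hθ : θ ≠ 0 := by
    rw [Ne, ENNReal.ofReal_eq_zero, not_le]
    positivity
  have h3 : Tendsto (fun ρ : ℝ => 3 * ρ) (𝓝[>] 0) (𝓝[>] 0) := by
    refine tendsto_nhdsWithin_iff.2 ⟨?_, ?_⟩
    · have : Tendsto (fun ρ : ℝ => 3 * ρ) (𝓝 0) (𝓝 (3 * 0)) := tendsto_id.const_mul 3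
      rw [mul_zero] at this
      exact this.mono_left nhdsWithin_le_nhds
    · filter_upwards [self_mem_nhdsWithin] with ρ hρ
      rw [mem_Ioi] at hρ ⊢
      linarith
  have h4 := (hE.comp h3).eventually (lt_mem_nhds (ENNReal.sub_lt_self ENNReal.one_ne_top
    one_ne_zero hθ))
  filter_upwards [h4, self_mem_nhdsWithin] with ρ hlt hρ w hw
  rw [mem_Ioi] at hρ
  by_contra! hno
  set B := Metric.closedBall y (3 * ρ)
  have hs : 0 < ρ / N := by positivity
  have hsub : Metric.ball w (ρ / N) ⊆ B := by
    intro z hz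
    rw [Metric.mem_ball] at hz
    rw [Metric.mem_closedBall] at hw ⊢
    have h5 : ρ / N ≤ ρ := div_le_self hρ.le hN
    linarith [dist_triangle z w y]
  have hdisj : Disjoint (E ∩ B) (Metric.ball w (ρ / N)) := by
    rw [Set.disjoint_left]
    intro z hz hzw
    rw [mem_ball_iff_norm] at hzw
    exact absurd hzw (hno z hz.1).le.not_gt
  have hle : volume (E ∩ B) + volume (Metric.ball w (ρ / N)) ≤ volume B := by
    rw [← measure_union hdisj Metric.isOpen_ball.measurableSet]
    exact measure_mono (union_subset inter_subset_right hsub)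
  have hB0 : volume B ≠ 0 := (Metric.measure_closedBall_pos volume y (by positivity)).ne'
  have hBt : volume B ≠ ∞ := measure_closedBall_lt_top.ne
  have hball : volume (Metric.ball w (ρ / N)) = θ * volume B := by
    rw [Measure.addHaar_ball_of_pos volume w hs,
      Measure.addHaar_closedBall volume y (by positivity), ← mul_assoc,
      ← ENNReal.ofReal_mul (by positivity), finrank_euclideanSpace, Fintype.card_fin, ← mul_pow]
    congr 3
    field_simp
  have h6 : volume (E ∩ B) / volume B + θ ≤ 1 := by
    calc _ = (volume (E ∩ B) + volume (Metric.ball w (ρ / N))) / volume B := by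
          rw [ENNReal.add_div, hball, ENNReal.mul_div_cancel_right hB0 hBt]
      _ ≤ 1 := ENNReal.div_le_of_le_mul (by rwa [one_mul])
  exact hlt.not_ge (ENNReal.le_sub_of_add_le_right ENNReal.ofReal_ne_top h6)

/-- With s = ρ/N, the segment is cut into N pieces of length at most 2s and each division point is
replaced by a point of E within s. A jump has length at most 4s and costs 16 K s²; the last one, to
b, costs K s². The total is at most 17 N K s² = 17 K ρ²/N, so a quadratic error becomes small after
subdivision. -/
theorem le_add_of_chain {h : Euc n → ℝ} {E : Set (Euc n)} {B : Set (Euc n)} {y a b : Euc n}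
    {K ρ : ℝ} {N : ℕ} (hN : 1 ≤ N) (hρ : 0 < ρ) (hK : 0 ≤ K)
    (hB : Metric.closedBall y (3 * ρ) ⊆ B)
    (hE : ∀ z ∈ E, z ∈ B → ∀ z' ∈ B, h z' ≤ h z + K * ‖z' - z‖ ^ 2)
    (hnet : ∀ w ∈ Metric.closedBall y (2 * ρ), ∃ z ∈ E, ‖z - w‖ ≤ ρ / N)
    (ha : a ∈ E) (haB : a ∈ Metric.closedBall y (2 * ρ)) (hbB : b ∈ Metric.closedBall y (2 * ρ))
    (hab : ‖b - a‖ ≤ 2 * ρ) : h b ≤ h a + 17 * K * ρ ^ 2 / N := by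
  have hN0 : (0 : ℝ) < N := by exact_mod_cast hN
  set s : ℝ := ρ / N
  have hs0 : 0 < s := by positivity
  have hsρ : s ≤ ρ := div_le_self hρ.le (by exact_mod_cast hN)
  set w : ℝ → Euc n := fun t => a + t • (b - a)
  have hw : ∀ t ∈ Icc (0 : ℝ) 1, w t ∈ Metric.closedBall y (2 * ρ) := fun t ht =>
    (convex_closedBall y (2 * ρ)).add_smul_sub_mem haB hbB ht
  have hnear : ∀ w' ∈ Metric.closedBall y (2 * ρ), ∀ z, ‖z - w'‖ ≤ s → z ∈ B := by
    intro w' hw' z hz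
    apply hB
    rw [Metric.mem_closedBall] at hw' ⊢
    rw [← dist_eq_norm] at hz
    linarith [dist_triangle z w' y]
  have key : ∀ j : ℕ, j ≤ N → ∃ z ∈ E, ‖z - w (j / N)‖ ≤ s ∧ h z ≤ h a + j * (16 * K * s ^ 2) := by
    intro j
    induction j with
    | zero =>
      intro _
      exact ⟨a, ha, by simpa [w] using hs0.le, by simp⟩
    | succ j ih =>
      intro hj
      obtain ⟨z, hzE, hzw, hz⟩ := ih (by omega)
      have hmem : ∀ i : ℕ, i ≤ N → (i / N : ℝ) ∈ Icc (0 : ℝ) 1 := fun i hi =>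
        ⟨by positivity, (div_le_one hN0).2 (by exact_mod_cast hi)⟩
      obtain ⟨z', hz'E, hz'w⟩ := hnet _ (hw _ (hmem (j + 1) hj))
      refine ⟨z', hz'E, hz'w, ?_⟩
      have h1 := hE z hzE (hnear _ (hw _ (hmem j (by omega))) z hzw) z'
        (hnear _ (hw _ (hmem (j + 1) hj)) z' hz'w)
      have h2 : ‖w ((j + 1 : ℕ) / N) - w (j / N)‖ ≤ 2 * s := by
        have : w ((j + 1 : ℕ) / N) - w (j / N) = (1 / N : ℝ) • (b - a) := by
          simp only [w]
          rw [add_sub_add_left_eq_sub, ← sub_smul]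
          congr 1
          push_cast
          ring
        rw [this, norm_smul, Real.norm_of_nonneg (by positivity)]
        calc 1 / (N : ℝ) * ‖b - a‖ ≤ 1 / N * (2 * ρ) := by gcongr
          _ = 2 * s := by ring
      have h3 : ‖z' - z‖ ≤ 4 * s := by
        have : z' - z = (z' - w ((j + 1 : ℕ) / N)) + (w ((j + 1 : ℕ) / N) - w (j / N)) -
            (z - w (j / N)) := by abel
        rw [this]
        refine (norm_sub_le _ _).trans ?_
        have := norm_add_le (z' - w ((j + 1 : ℕ) / N)) (w ((j + 1 : ℕ) / N) - w (j / N))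
        linarith
      have h4 : K * ‖z' - z‖ ^ 2 ≤ K * (4 * s) ^ 2 := by gcongr
      push_cast
      linarith
  obtain ⟨z, hzE, hzw, hz⟩ := key N le_rfl
  rw [div_self hN0.ne'] at hzw
  have hw1 : w 1 = b := by simp [w]
  rw [hw1] at hzw
  have h1 := hE z hzE (hnear b hbB z hzw) b (hnear b hbB b (by simpa using hs0.le))
  have h2 : K * ‖b - z‖ ^ 2 ≤ K * s ^ 2 := by
    rw [norm_sub_rev]
    gcongr
  have h3 : K * s ^ 2 ≤ N * (K * s ^ 2) :=
    le_mul_of_one_le_left (by positivity) (by exact_mod_cast hN)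
  have h4 : 17 * K * ρ ^ 2 / N = 17 * (N * (K * s ^ 2)) := by
    simp only [s]
    field_simp
  rw [h4]
  linarith

/-- A semiconcave function which, at the points of `E`, is touched from above by parabolas with
vertical axis is constant up to second order at the density points of `E`. -/
theorem isLittleO_sq_of_density {h : Euc n → ℝ} {E B : Set (Euc n)} {y : Euc n} {K : ℝ}
    (hK : 0 ≤ K) (hB : B ∈ 𝓝 y) (hy : y ∈ E)
    (hE : ∀ z ∈ E, z ∈ B → ∀ z' ∈ B, h z' ≤ h z + K * ‖z' - z‖ ^ 2)
    (hsc : ∀ z ∈ B, ∃ p, ∀ z' ∈ B, h z' ≤ h z + inner ℝ p (z' - z) + K * ‖z' - z‖ ^ 2)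
    (hdens : Tendsto (fun ρ => volume (E ∩ Metric.closedBall y ρ) / volume (Metric.closedBall y ρ))
      (𝓝[>] 0) (𝓝 1)) :
    (fun k => h (y + k) - h y) =o[𝓝 0] fun k : Euc n => ‖k‖ ^ 2 := by
  refine isLittleO_iff.2 fun ε hε => ?_
  -- The constant 21 is 17 for the chain plus 4 for the step between y + k and a nearby point of E;
  -- N ≥ 2 keeps that step within the ball.
  obtain ⟨N, hN⟩ := exists_nat_gt (21 * K / ε + 2)
  have hN2 : (2 : ℝ) ≤ N := by
    have : 0 ≤ 21 * K / ε := by positivity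
    linarith
  have hN1 : 1 ≤ N := by
    have : 2 ≤ N := by exact_mod_cast hN2
    omega
  have hN0 : (0 : ℝ) < N := by linarith
  have hKN : 21 * K / N ≤ ε := by
    rw [div_le_iff₀ hN0]
    have : 21 * K / ε ≤ N := by linarith
    rwa [div_le_iff₀' hε] at this
  obtain ⟨R, hR, hRB⟩ := Metric.nhds_basis_closedBall.mem_iff.1 hB
  have hev := (eventually_exists_mem_of_density hdens (N := N) (by linarith)).and
    (Ioo_mem_nhdsGT (show (0 : ℝ) < R / 3 by positivity))
  obtain ⟨δ, hδ, hδ'⟩ := mem_nhdsGT_iff_exists_Ioo_subset.1 hev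
  filter_upwards [Metric.ball_mem_nhds (0 : Euc n) hδ] with k hk
  rcases eq_or_ne k 0 with rfl | hk0
  · simp
  set ρ := ‖k‖
  have hρ : 0 < ρ := norm_pos_iff.2 hk0
  obtain ⟨hnet, hρR⟩ := hδ' ⟨hρ, by simpa using hk⟩
  have h3B : Metric.closedBall y (3 * ρ) ⊆ B :=
    (Metric.closedBall_subset_closedBall (by linarith [hρR.2])).trans hRB
  have hyB : y ∈ Metric.closedBall y (2 * ρ) := Metric.mem_closedBall_self (by positivity)
  have hkB : y + k ∈ Metric.closedBall y (2 * ρ) := by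
    rw [mem_closedBall_iff_norm, add_sub_cancel_left]
    linarith
  have hup := le_add_of_chain hN1 hρ hK h3B hE hnet hy hyB hkB
    (by rw [add_sub_cancel_left]; linarith)
  set s : ℝ := ρ / N
  have hs0 : 0 < s := by positivity
  have hs2 : 2 * s ≤ ρ := by
    have : s * N = ρ := div_mul_cancel₀ _ hN0.ne'
    nlinarith
  obtain ⟨p, hp⟩ := hsc (y + k) (h3B (Metric.closedBall_subset_closedBall (by linarith) hkB))
  -- The point y + k need not lie in E, so the lower bound comes from semiconcavity there. A point z
  -- of E within s of y + k + s e satisfies ⟨p, z - (y + k)⟩ ≤ -s‖p‖ + s‖p‖ = 0, so the unknown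
  -- slope p drops out, and a chain leads from z back to y.
  obtain ⟨e, he1, hep⟩ : ∃ e : Euc n, ‖e‖ ≤ 1 ∧ inner ℝ p e = -‖p‖ := by
    rcases eq_or_ne p 0 with rfl | hp0
    · exact ⟨0, by simp, by simp⟩
    · refine ⟨-(‖p‖⁻¹ • p), ?_, ?_⟩
      · rw [norm_neg, norm_smul, norm_inv, norm_norm, inv_mul_cancel₀ (norm_ne_zero_iff.2 hp0)]
      · rw [inner_neg_right, inner_smul_right, real_inner_self_eq_norm_sq]
        have := norm_ne_zero_iff.2 hp0
        field_simp
  have hse : ‖s • e‖ ≤ s := by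
    rw [norm_smul, Real.norm_of_nonneg hs0.le]
    exact mul_le_of_le_one_right hs0.le he1
  obtain ⟨z, hzE, hz⟩ := hnet (y + k + s • e) (by
    rw [mem_closedBall_iff_norm, add_assoc, add_sub_cancel_left]
    exact (norm_add_le _ _).trans (by linarith))
  have hzk : ‖z - (y + k)‖ ≤ 2 * s := by
    have : z - (y + k) = (z - (y + k + s • e)) + s • e := by abel
    rw [this]
    exact (norm_add_le _ _).trans (by linarith)
  have hzy : ‖z - y‖ ≤ 2 * ρ := by
    have : z - y = (z - (y + k)) + k := by abel
    rw [this]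
    exact (norm_add_le _ _).trans (by linarith)
  have hzB : z ∈ Metric.closedBall y (2 * ρ) := by rwa [mem_closedBall_iff_norm]
  have h1 := hp z (h3B (Metric.closedBall_subset_closedBall (by linarith) hzB))
  have h2 : inner ℝ p (z - (y + k)) ≤ 0 := by
    have : z - (y + k) = (z - (y + k + s • e)) + s • e := by abel
    rw [this, inner_add_right, inner_smul_right, hep]
    have h4 := (real_inner_le_norm p (z - (y + k + s • e))).trans
      (mul_le_mul_of_nonneg_left hz (norm_nonneg p))
    linarith
  have h4 : K * ‖z - (y + k)‖ ^ 2 ≤ K * (2 * s) ^ 2 := by gcongr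
  have hlow := le_add_of_chain hN1 hρ hK h3B hE hnet hzE hzB hyB
    (by rwa [norm_sub_rev])
  have h5 : K * (2 * s) ^ 2 ≤ 4 * K * ρ ^ 2 / N := by
    have e1 : K * (2 * s) ^ 2 = 4 * K * ρ ^ 2 / N / N := by
      simp only [s]
      field_simp
      ring
    rw [e1]
    exact div_le_self (by positivity) (by linarith)
  have h6 : 17 * K * ρ ^ 2 / N + 4 * K * ρ ^ 2 / N ≤ ε * ρ ^ 2 := by
    calc _ = 21 * K / N * ρ ^ 2 := by ring
      _ ≤ _ := by gcongr
  have h7 : 0 ≤ 4 * K * ρ ^ 2 / N := by positivity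
  rw [Real.norm_eq_abs, Real.norm_of_nonneg (by positivity), abs_le]
  constructor <;> linarith

end SecondOrder

/-! ### Kantorovich potentials and their second-order expansion -/

section Potentials

/-- A minimum of the functions c(·, y) - b(y) inherits their common modulus of continuity, whatever
b is. -/
theorem continuousOn_of_isLeast_sub {α β : Type*} [PseudoMetricSpace α] [PseudoMetricSpace β]
    {A : Set α} {B : Set β} (hA : IsCompact A) (hB : IsCompact B) {c : α → β → ℝ}
    (hc : ContinuousOn (fun p : α × β => c p.1 p.2) (A ×ˢ B)) {b : β → ℝ} {u : α → ℝ}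
    (hu : ∀ x ∈ A, IsLeast ((fun y => c x y - b y) '' B) (u x)) : ContinuousOn u A := by
  have huc := (hA.prod hB).uniformContinuousOn_of_continuous hc
  rw [Metric.uniformContinuousOn_iff_le] at huc
  refine UniformContinuousOn.continuousOn ?_
  rw [Metric.uniformContinuousOn_iff_le]
  intro ε hε
  obtain ⟨δ, hδ, h⟩ := huc ε hε
  have key : ∀ x ∈ A, ∀ x' ∈ A, dist x x' ≤ δ → u x' ≤ u x + ε := by
    intro x hx x' hx' hd
    obtain ⟨⟨y, hy, hyu⟩, -⟩ := hu x hx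
    have h1 := (hu x' hx').2 ⟨y, hy, rfl⟩
    have h2 := h (x, y) ⟨hx, hy⟩ (x', y) ⟨hx', hy⟩ (by
      rw [Prod.dist_eq, dist_self]
      exact max_le hd hδ.le)
    rw [Real.dist_eq, abs_le] at h2
    simp only at h1 h2 hyu
    linarith
  refine ⟨δ, hδ, fun x hx x' hx' hd => ?_⟩
  have h1 := key x hx x' hx' hd
  have h2 := key x' hx' x hx (by rwa [dist_comm])
  rw [Real.dist_eq, abs_le]
  constructor <;> linarith

theorem exists_isLeast_sub {α β : Type*} [TopologicalSpace α] [TopologicalSpace β]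
    {A : Set α} {B : Set β} (hB : IsCompact B) (hBne : B.Nonempty) {c : α → β → ℝ}
    (hc : ContinuousOn (fun p : α × β => c p.1 p.2) (A ×ˢ B)) {b : β → ℝ} (hb : ContinuousOn b B) :
    ∃ u : α → ℝ, ∀ x ∈ A, IsLeast ((fun y => c x y - b y) '' B) (u x) := by
  have : ∀ x, ∃ t, x ∈ A → IsLeast ((fun y => c x y - b y) '' B) t := by
    intro x
    by_cases hx : x ∈ A
    · have hcont : ContinuousOn (fun y => c x y - b y) B :=
        (hc.comp (f := fun y => (x, y)) (by fun_prop) fun y hy => ⟨hx, hy⟩).sub hb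
      obtain ⟨t, ht⟩ := (hB.image_of_continuousOn hcont).exists_isLeast (hBne.image _)
      exact ⟨t, fun _ => ht⟩
    · exact ⟨0, fun h => absurd h hx⟩
  choose u hu using this
  exact ⟨u, hu⟩

variable {m n : ℕ} {X : Set (Euc m)} {Y : Set (Euc n)} {c : Euc m → Euc n → ℝ}
  {R : Euc n → ℝ} {g : Euc m × Euc n → Euc n} {r : Euc n → Euc n} {C K : ℝ}
  {μ : Measure (Euc m)} {T : Euc m → Euc n}

theorem IsConvexLandscape.integrable_cost_graph (h : IsConvexLandscape X Y c R g r C K)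
    (hXb : Bornology.IsBounded X) (hYb : Bornology.IsBounded Y) (hμ : IsProbabilityOn X μ)
    (hT : Measurable T) (hTY : ∀ x, T x ∈ closure Y) : Integrable (fun x => c x (T x)) μ := by
  have := hμ.1
  have h1 : Measurable fun x => (x, T x) := measurable_id.prodMk hT
  have h2 : (μ.map fun x => (x, T x)) (closure X ×ˢ closure Y)ᶜ = 0 := by
    rw [Measure.map_apply h1 (isClosed_closure.prod isClosed_closure).measurableSet.compl]
    refine measure_mono_null (fun x hx => ?_) hμ.2
    intro hxX
    exact hx ⟨subset_closure hxX, hTY x⟩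
  have := Measure.isFiniteMeasure_map μ fun x => (x, T x)
  have h3 := integrable_of_continuousOn_of_measure_compl
    (hXb.isCompact_closure.prod hYb.isCompact_closure) h2 h.continuousOn_cost
  exact h3.comp_measurable h1

theorem integral_add_integral_map (hT : Measurable T) {u : Euc m → ℝ} {v : Euc n → ℝ}
    (hu : Integrable u μ) (hv : Integrable v (μ.map T)) :
    ∫ x, u x ∂μ + ∫ y, v y ∂(μ.map T) = ∫ x, (u x + v (T x)) ∂μ := by
  rw [integral_map hT.aemeasurable hv.aestronglyMeasurable]
  exact (integral_add hu (hv.comp_measurable hT)).symm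

/-- Since T x minimizes c(x, ·) + R, the c-transform u of -R satisfies u(x) - R(T x) = c(x, T x):
equality holds on the graph, which is what dual optimality requires. -/
theorem exists_optimal_potentials (h : IsConvexLandscape X Y c R g r C K)
    (hXb : Bornology.IsBounded X) (hYb : Bornology.IsBounded Y) (hYne : Y.Nonempty)
    (hμ : IsProbabilityOn X μ) (hT : Measurable T) (hTY : ∀ x, T x ∈ closure Y)
    (hTmin : ∀ x ∈ X, ∀ y ∈ closure Y, c x (T x) + R (T x) ≤ c x y + R y) :
    ∃ u, ContinuousOn u (closure X) ∧
      (∀ x ∈ closure X, IsLeast ((fun y => c x y - -R y) '' closure Y) (u x)) ∧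
      IsDualAdmissible X Y c μ (μ.map T) u (fun y => -R y) ∧
      ∫ x, u x ∂μ + ∫ y, -R y ∂(μ.map T) = ∫ x, c x (T x) ∂μ := by
  have := hμ.1
  have hcX := hXb.isCompact_closure
  have hcY := hYb.isCompact_closure
  have hν := isProbabilityOn_map hT hTY hμ
  have := hν.1
  obtain ⟨u, hu⟩ := exists_isLeast_sub (A := closure X) hcY hYne.closure h.continuousOn_cost
    h.continuousOn_R.neg
  have huc := continuousOn_of_isLeast_sub hcX hcY h.continuousOn_cost hu
  have hui : Integrable u μ := integrable_of_continuousOn_of_measure_compl hcX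
    (measure_mono_null (compl_subset_compl.2 subset_closure) hμ.2) huc
  have hRi : Integrable (fun y => -R y) (μ.map T) :=
    integrable_of_continuousOn_of_measure_compl hcY hν.2 h.continuousOn_R.neg
  refine ⟨u, huc, hu, ⟨hui, hRi, fun x hx y hy => ?_⟩, ?_⟩
  · have := (hu x hx).2 ⟨y, hy, rfl⟩
    simp only [Pi.neg_apply] at this
    linarith
  · rw [integral_add_integral_map hT hui hRi]
    refine integral_congr_ae ?_
    filter_upwards [mem_ae_iff.2 hμ.2] with x hx
    obtain ⟨⟨y, hy, hyu⟩, hle⟩ := hu x (subset_closure hx)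
    have h1 := hle ⟨T x, hTY x, rfl⟩
    have h2 := hTmin x hx y hy
    simp only [Pi.neg_apply] at h1 hyu
    linarith

theorem dual_le_integral_graph (h : IsConvexLandscape X Y c R g r C K)
    (hXb : Bornology.IsBounded X) (hYb : Bornology.IsBounded Y)
    (hμ : IsProbabilityOn X μ) (hT : Measurable T) (hTY : ∀ x, T x ∈ closure Y)
    {u : Euc m → ℝ} {v : Euc n → ℝ} (huv : IsDualAdmissible X Y c μ (μ.map T) u v) :
    ∫ x, u x ∂μ + ∫ y, v y ∂(μ.map T) ≤ ∫ x, c x (T x) ∂μ := by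
  rw [integral_add_integral_map hT huv.1 huv.2.1]
  refine integral_mono_ae (huv.1.add (huv.2.1.comp_measurable hT))
    (h.integrable_cost_graph hXb hYb hμ hT hTY) ?_
  filter_upwards [mem_ae_iff.2 hμ.2] with x hx using huv.2.2 x (subset_closure hx) _ (hTY x)

/-- The function -R need not be a c-transform itself. Replacing it by the transform v of u only
increases it, so optimality is kept, and u remains the transform of v. -/
theorem exists_isKantorovichPair (h : IsConvexLandscape X Y c R g r C K)
    (hXb : Bornology.IsBounded X) (hXne : X.Nonempty) (hYb : Bornology.IsBounded Y)
    (hYne : Y.Nonempty) (hμ : IsProbabilityOn X μ) (hT : Measurable T)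
    (hTY : ∀ x, T x ∈ closure Y)
    (hTmin : ∀ x ∈ X, ∀ y ∈ closure Y, c x (T x) + R (T x) ≤ c x y + R y) :
    ∃ u v, IsKantorovichPair X Y c μ (μ.map T) u v := by
  have := hμ.1
  have hcX := hXb.isCompact_closure
  have hcY := hYb.isCompact_closure
  have hν := isProbabilityOn_map hT hTY hμ
  have := hν.1
  obtain ⟨u, huc, hu, hadm, heq⟩ := exists_optimal_potentials h hXb hYb hYne hμ hT hTY hTmin
  have hcs : ContinuousOn (fun p : Euc n × Euc m => c p.2 p.1) (closure Y ×ˢ closure X) :=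
    h.continuousOn_cost.comp (f := Prod.swap) continuous_swap.continuousOn
      fun p hp => ⟨hp.2, hp.1⟩
  obtain ⟨v, hv⟩ := exists_isLeast_sub (A := closure Y) (c := fun y x => c x y) hcX
    hXne.closure hcs huc
  have hvc := continuousOn_of_isLeast_sub (c := fun y x => c x y) hcY hcX hcs hv
  have hvi : Integrable v (μ.map T) := integrable_of_continuousOn_of_measure_compl hcY hν.2 hvc
  have hle : ∀ x ∈ closure X, ∀ y ∈ closure Y, u x + v y ≤ c x y := fun x hx y hy => by
    have := (hv y hy).2 ⟨x, hx, rfl⟩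
    simp only at this
    linarith
  have hRv : ∀ y ∈ closure Y, -R y ≤ v y := by
    intro y hy
    obtain ⟨⟨x, hx, hxv⟩, -⟩ := hv y hy
    have := hadm.2.2 x hx y hy
    simp only at hxv
    linarith
  refine ⟨u, v, ⟨hadm.1, hvi, hle⟩, fun u' v' h' => ?_, fun x hx => ⟨?_, ?_⟩, hv⟩
  · have h1 := dual_le_integral_graph h hXb hYb hμ hT hTY h'
    have h2 : ∫ y, -R y ∂(μ.map T) ≤ ∫ y, v y ∂(μ.map T) := by
      refine integral_mono_ae hadm.2.1 hvi ?_
      filter_upwards [mem_ae_iff.2 hν.2] with y hy using hRv y hy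
    linarith
  · obtain ⟨⟨y, hy, hyu⟩, -⟩ := hu x hx
    refine ⟨y, hy, le_antisymm ?_ ?_⟩
    · have := hRv y hy
      simp only at hyu ⊢
      linarith
    · have := hle x hx y hy
      simp only
      linarith
  · rintro _ ⟨y, hy, rfl⟩
    have := hle x hx y hy
    simp only
    linarith

/-- The slack c - u - v is nonnegative on the graph, and comparison with the optimal pair (u₀, -R)
shows that its integral vanishes. -/
theorem ae_add_eq_cost (h : IsConvexLandscape X Y c R g r C K)
    (hXb : Bornology.IsBounded X) (hYb : Bornology.IsBounded Y) (hYne : Y.Nonempty)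
    (hμ : IsProbabilityOn X μ) (hT : Measurable T) (hTY : ∀ x, T x ∈ closure Y)
    (hTmin : ∀ x ∈ X, ∀ y ∈ closure Y, c x (T x) + R (T x) ≤ c x y + R y)
    {u : Euc m → ℝ} {v : Euc n → ℝ} (huv : IsKantorovichPair X Y c μ (μ.map T) u v) :
    ∀ᵐ x ∂μ, u x + v (T x) = c x (T x) := by
  obtain ⟨u₀, -, -, hadm, heq⟩ := exists_optimal_potentials h hXb hYb hYne hμ hT hTY hTmin
  have h1 := huv.2.1 _ _ hadm
  rw [heq, integral_add_integral_map hT huv.1.1 huv.1.2.1] at h1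
  have hi := h.integrable_cost_graph hXb hYb hμ hT hTY
  have hi' := huv.1.1.add (huv.1.2.1.comp_measurable hT)
  have hnn : 0 ≤ᵐ[μ] fun x => c x (T x) - (u x + v (T x)) := by
    filter_upwards [mem_ae_iff.2 hμ.2] with x hx
    exact sub_nonneg.2 (huv.1.2.2 x (subset_closure hx) _ (hTY x))
  have h2 : ∫ x, (c x (T x) - (u x + v (T x))) ∂μ = 0 := by
    refine le_antisymm ?_ (integral_nonneg_of_ae hnn)
    have := integral_sub hi hi'
    simp only [Pi.add_apply, Function.comp_apply] at this
    rw [this]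
    linarith
  have h3 := (integral_eq_zero_iff_of_nonneg_ae hnn (hi.sub hi')).1 h2
  filter_upwards [h3] with x hx
  exact (sub_eq_zero.1 hx).symm

/-- At almost every density point of the support, φ = v + R is constant up to o(‖k‖²), so v inherits
the Taylor expansion of -R. Only the conjugacy and the optimality of the pair enter, so any
Kantorovich pair is covered. -/
theorem hasHessianAt_of_isKantorovichPair (h : IsConvexLandscape X Y c R g r C K)
    (hXb : Bornology.IsBounded X) (hYo : IsOpen Y) (hYb : Bornology.IsBounded Y)
    (hYne : Y.Nonempty)
    (hμ : IsProbabilityOn X μ) (hT : Measurable T) (hTY : ∀ x, T x ∈ closure Y)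
    (hTmin : ∀ x ∈ X, ∀ y ∈ closure Y, c x (T x) + R (T x) ≤ c x y + R y)
    (hT0 : ∀ x ∈ X, g (x, T x) + r (T x) = 0) (hμY : μ (T ⁻¹' Yᶜ) = 0)
    (hR : ∀ y ∈ Y, HasGradientAt R (r y) y) (hr : ∀ y ∈ Y, DifferentiableAt ℝ r y)
    {u : Euc m → ℝ} {v : Euc n → ℝ} (huv : IsKantorovichPair X Y c μ (μ.map T) u v) :
    ∀ᵐ y ∂(volume : Measure (Euc n)), y ∈ (μ.map T).support → y ∈ Y →
      HasHessianAt v y (-hessianMatrix R y) ∧ gradient v y = -r y := by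
  have := hμ.1
  have hcX := hXb.isCompact_closure
  have hcY := hYb.isCompact_closure
  have hcs : ContinuousOn (fun p : Euc n × Euc m => c p.2 p.1) (closure Y ×ˢ closure X) :=
    h.continuousOn_cost.comp (f := Prod.swap) continuous_swap.continuousOn
      fun p hp => ⟨hp.2, hp.1⟩
  have hvc : ContinuousOn v (closure Y) :=
    continuousOn_of_isLeast_sub (c := fun y x => c x y) hcY hcX hcs huv.2.2.2
  set φ : Euc n → ℝ := fun y => v y + R y
  have hφc : ContinuousOn φ (closure Y) := hvc.add h.continuousOn_R
  set E : Set (Euc n) := (μ.map T).support ∩ Y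
  have hEm : MeasurableSet E := Measure.isClosed_support.measurableSet.inter hYo.measurableSet
  have hupper : ∀ x ∈ closure X, ∀ y ∈ closure Y, ∀ y' ∈ closure Y,
      c x y' + R y' ≤ c x y + R y + inner ℝ (g (x, y) + r y) (y' - y) +
        K / 2 * ‖y' - y‖ ^ 2 := by
    intro x hx y hy y' hy'
    have hcw : ∀ y ∈ closure Y, ContinuousWithinAt (fun x => c x y) X x := fun y hy =>
      ((h.continuousOn_cost.comp (f := fun x => (x, y)) (s := closure X) (by fun_prop)
        fun x hx => ⟨hx, hy⟩) x hx).mono subset_closure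
    have hgw : ContinuousWithinAt (fun x => g (x, y)) X x :=
      ((h.continuousOn_g.comp (f := fun x => (x, y)) (s := closure X) (by fun_prop)
        fun x hx => ⟨hx, hy⟩) x hx).mono subset_closure
    refine ContinuousWithinAt.closure_le (f := fun x => c x y' + R y')
      (g := fun x => c x y + R y + inner ℝ (g (x, y) + r y) (y' - y) + K / 2 * ‖y' - y‖ ^ 2) hx
      ((hcw y' hy').add continuousWithinAt_const)
      ((((hcw y hy).add continuousWithinAt_const).add
        ((hgw.add continuousWithinAt_const).inner continuousWithinAt_const)).add
          continuousWithinAt_const) fun x hx => h.upper x hx y hy y' hy'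
  have hvle : ∀ x ∈ closure X, ∀ y ∈ closure Y, v y ≤ c x y - u x := fun x hx y hy => by
    linarith [huv.1.2.2 x hx y hy]
  -- If x attains the minimum defining v(z), then c(x, ·) - u(x) lies above v with contact at z, and
  -- the upper bound of the landscape applies to it.
  have hsc : ∀ z ∈ Y, ∃ p, ∀ z' ∈ Y,
      φ z' ≤ φ z + inner ℝ p (z' - z) + K / 2 * ‖z' - z‖ ^ 2 := by
    intro z hz
    obtain ⟨⟨x, hx, hxv⟩, -⟩ := huv.2.2.2 z (subset_closure hz)
    refine ⟨g (x, z) + r z, fun z' hz' => ?_⟩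
    have h1 := hupper x hx z (subset_closure hz) z' (subset_closure hz')
    have h2 := hvle x hx z' (subset_closure hz')
    simp only [φ] at hxv ⊢
    linarith
  set S : Set (Euc n) := {z | z ∈ Y ∧ ∀ z' ∈ Y, φ z' ≤ φ z + K / 2 * ‖z' - z‖ ^ 2}
  have hS : ∀ᵐ x ∂μ, T x ∈ S := by
    filter_upwards [ae_add_eq_cost h hXb hYb hYne hμ hT hTY hTmin huv, mem_ae_iff.2 hμ.2,
      mem_ae_iff.2 (show μ (T ⁻¹' Y)ᶜ = 0 from hμY)] with x h1 hx hxY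
    refine ⟨hxY, fun z' hz' => ?_⟩
    have h2 := h.upper x hx (T x) (hTY x) z' (subset_closure hz')
    rw [hT0 x hx, inner_zero_left] at h2
    have h3 := hvle x (subset_closure hx) z' (subset_closure hz')
    simp only [φ]
    linarith
  -- The touching property holds at T x for almost every x, hence on a set whose closure contains
  -- the support within Y; continuity of φ carries it to every such point.
  have hE : ∀ z ∈ E, ∀ z' ∈ Y, φ z' ≤ φ z + K / 2 * ‖z' - z‖ ^ 2 := by
    rintro z ⟨hz, hzY⟩ z' hz'
    have hzS : z ∈ closure S := by
      rw [mem_closure_iff_nhds]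
      intro N hN
      obtain ⟨O, hON, hO, hzO⟩ := mem_nhds_iff.1 hN
      have hpos := (Measure.mem_support_iff_forall z).1 hz O (hO.mem_nhds hzO)
      rw [Measure.map_apply hT hO.measurableSet] at hpos
      obtain ⟨x, hxO, hxS⟩ := nonempty_of_measure_ne_zero
        (μ := μ) (s := T ⁻¹' O ∩ {x | T x ∈ S}) (by
          rw [measure_inter_conull' (measure_mono_null (fun x hx => hx.2) hS)]
          exact hpos.ne')
      exact ⟨T x, hON hxO, hxS⟩
    have hφw : ContinuousWithinAt φ S z :=
      (hφc z (subset_closure hzY)).mono fun z hz => subset_closure hz.1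
    refine ContinuousWithinAt.closure_le (f := fun _ => φ z')
      (g := fun z => φ z + K / 2 * ‖z' - z‖ ^ 2) hzS continuousWithinAt_const
      (hφw.add (by fun_prop)) fun w hw => hw.2 z' hz'
  have hK : 0 ≤ K / 2 := div_nonneg h.nonneg two_pos.le
  filter_upwards [Besicovitch.ae_tendsto_measure_inter_div_of_measurableSet volume hEm]
    with y hdens hy hyY
  have hyE : y ∈ E := ⟨hy, hyY⟩
  rw [indicator_of_mem hyE, Pi.one_apply] at hdens
  have h1 := isLittleO_sq_of_density hK (hYo.mem_nhds hyY) hyE (fun z hz _ => hE z hz) hsc hdens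
  have hRg : ∀ᶠ z in 𝓝 y, HasGradientAt R (r z) z := by
    filter_upwards [hYo.mem_nhds hyY] with z hz using hR z hz
  have h2 := isLittleO_taylor hRg (hr y hyY)
  refine hasHessianAt_of_isLittleO (isSymm_hessianMatrix hRg (hr y hyY)).neg
    ((h1.sub h2).congr_left fun k => ?_)
  rw [sum_mul_eq_dotProduct, Matrix.neg_mulVec, dotProduct_neg,
    dotProduct_hessianMatrix_mulVec_of_hasGradientAt hRg (hr y hyY), inner_neg_left]
  simp only [φ]
  ring

end Potentials

/-! ### The main theorem -/

theorem mainTheorem8 {m n : ℕ} (hn : 0 < n) (hnm : n < m)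
    (X : Set (Euc m)) (Y : Set (Euc n))
    (hXo : IsOpen X) (hXb : Bornology.IsBounded X)
    (hYo : IsOpen Y) (hYb : Bornology.IsBounded Y) (hYc : Convex ℝ Y)
    (c : Euc m → Euc n → ℝ) (V : Euc n → ℝ) (W : Euc n → Euc n → ℝ)
    (hc : IsC2UpToBoundary (X ×ˢ Y) (fun p : Euc m × Euc n => c p.1 p.2))
    (hV : IsC2UpToBoundary Y V)
    (hW : IsC2UpToBoundary (Y ×ˢ Y) (fun p : Euc n × Euc n => W p.1 p.2))
    (hWsymm : ∀ y ∈ closure Y, ∀ z ∈ closure Y, W y z = W z y)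
    (htwist : IsTwisted X Y c) (hnondeg : IsNondegenerate X Y c)
    (hconv : IsUniformlyConvexSum X Y c V W) (hout : HasOutwardGradient X Y c V W)
    (μ : Measure (Euc m)) (hμ : IsProbabilityOn X μ) (hμac : μ ≪ volume)
    (ν : Measure (Euc n)) (hν : IsInteractionMinimizer Y c V W μ ν) :
    ν ≪ volume ∧
    (∃ u v, IsKantorovichPair X Y c μ ν u v) ∧
    ∀ u v, IsKantorovichPair X Y c μ ν u v →
      ∀ᵐ y ∂(volume : Measure (Euc n)), y ∈ ν.support →
        SatisfiesLocalMongeAmpereAt X c μ ν v y := by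
  have := hμ.1
  have := hν.1.1
  have hΩ := hXo.prod hYo
  have hXne : X.Nonempty := by
    rw [nonempty_iff_ne_empty]
    rintro rfl
    have := hμ.2
    rw [compl_empty, measure_univ] at this
    exact one_ne_zero this
  have hYne : Y.Nonempty := by
    rw [← closure_nonempty_iff, nonempty_iff_ne_empty]
    intro he
    have := hν.1.2
    rw [he, compl_empty, measure_univ] at this
    exact one_ne_zero this
  obtain ⟨C, K, h⟩ := exists_isConvexLandscape hXo hXb hYo hYb hYc hc hV hW hWsymm hconv hout hν.1
  obtain ⟨T₀, hT₀Y, hT₀c, hT₀0, hT₀min, hT₀u⟩ := h.exists_argmin hYb hYo hYc hYne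
  obtain ⟨y₀, hy₀⟩ := hYne
  classical
  -- T₀ is continuous only on X. A constant value outside X makes it Borel, and μ does not see the
  -- change.
  obtain ⟨T, hTm, hTY, hTX⟩ : ∃ T : Euc m → Euc n, Measurable T ∧ (∀ x, T x ∈ closure Y) ∧
      EqOn T T₀ X := by
    refine ⟨X.piecewise T₀ fun _ => y₀, hT₀c.measurable_piecewise continuousOn_const
      hXo.measurableSet, fun x => ?_, fun x hx => piecewise_eq_of_mem X _ _ hx⟩
    by_cases hx : x ∈ X
    · rw [piecewise_eq_of_mem X _ _ hx]
      exact hT₀Y x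
    · rw [piecewise_eq_of_notMem X _ _ hx]
      exact subset_closure hy₀
  have hTc : ContinuousOn T X := hT₀c.congr hTX
  have hT0 : ∀ x ∈ X, extendFrom (X ×ˢ Y) (partialGradient c) (x, T x) +
      meanFieldGradient Y V W ν (T x) = 0 := fun x hx => by rw [hTX hx]; exact hT₀0 x hx
  have hTmin : ∀ x ∈ X, ∀ y ∈ closure Y, c x (T x) + meanField V W ν (T x) +
      C / 2 * ‖y - T x‖ ^ 2 ≤ c x y + meanField V W ν y := fun x hx => by
    rw [hTX hx]; exact hT₀min x hx
  have hTu : ∀ x ∈ X, ∀ y ∈ closure Y, extendFrom (X ×ˢ Y) (partialGradient c) (x, y) +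
      meanFieldGradient Y V W ν y = 0 → y = T x := fun x hx => by rw [hTX hx]; exact hT₀u x hx
  have hνT : ν = μ.map T := minimizer_eq_map rfl h hXb hYb hV.1
    (by rw [← closure_prod_eq]; exact hW.1) hWsymm hμ hν hTm hTY hTmin
  have hnull : ∀ N : Set (Euc n), volume N = 0 → μ (T ⁻¹' N) = 0 := fun N hN => by
    rw [← measure_inter_conull' (t := X) (measure_mono_null (fun x hx => hx.2) hμ.2), inter_comm]
    exact hμac (volume_inter_preimage_eq_zero hnm.le hXo hYo hc hnondeg h hTY hTc hT0 hN)
  have hfr : volume (frontier Y) = 0 := hYc.addHaar_frontier volume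
  have hμY : μ (T ⁻¹' Yᶜ) = 0 := by
    refine measure_mono_null (fun x hx => ?_) (hnull _ hfr)
    rw [mem_preimage, frontier, hYo.interior_eq]
    exact ⟨hTY x, hx⟩
  have hνY : ν Yᶜ = 0 := by rw [hνT, Measure.map_apply hTm hYo.measurableSet.compl, hμY]
  have hr := contDiffOn_meanFieldGradient hYo hYb hV hW hνY
  have hgc := isC1UpToBoundary_partialGradient hΩ hc
  obtain ⟨x₀, hx₀⟩ := hXne
  have hR : ∀ y ∈ Y, HasGradientAt (meanField V W ν) (meanFieldGradient Y V W ν y) y :=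
    fun y hy => h.hasGradientAt hYo hx₀ hy (by
      rw [hgc.extendFrom_eq (p := (x₀, y)) ⟨hx₀, hy⟩]
      exact hasGradientAt_curry hΩ hc.2.1 (p := (x₀, y)) ⟨hx₀, hy⟩)
  have hTmin' : ∀ x ∈ X, ∀ y ∈ closure Y, c x (T x) + meanField V W ν (T x) ≤
      c x y + meanField V W ν y := fun x hx y hy => by
    have h1 := hTmin x hx y hy
    have h2 : 0 ≤ C / 2 * ‖y - T x‖ ^ 2 := by
      have := h.pos
      positivity
    linarith
  -- R and r are built from ν; only their established properties are used from here on, so they are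
  -- frozen before ν is replaced by the image measure.
  generalize meanField V W ν = R at *
  generalize meanFieldGradient Y V W ν = r at *
  subst hνT
  refine ⟨Measure.AbsolutelyContinuous.mk fun N hNm hN => ?_, ?_, fun u v huv => ?_⟩
  · rw [Measure.map_apply hTm hNm, hnull N hN]
  · exact exists_isKantorovichPair h hXb ⟨x₀, hx₀⟩ hYb ⟨y₀, hy₀⟩ hμ hTm hTY hTmin'
  · filter_upwards [hasHessianAt_of_isKantorovichPair h hXb hYo hYb ⟨y₀, hy₀⟩ hμ hTm hTY hTmin' hT0
        hμY hR (fun y hy => (hr.contDiffAt (hYo.mem_nhds hy)).differentiableAt one_ne_zero) huv,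
      ae_integrableOn_mongeAmpere hnm.le hXo hYo hc hnondeg h hr hR hTm hTc hT0 hTu hμ.2 hμac hμY,
      compl_mem_ae_iff.2 hfr] with y h1 h2 hyf hy
    have hyY : y ∈ Y := by
      have hcl : y ∈ closure Y := Measure.support_subset_of_isClosed isClosed_closure
        (mem_ae_iff.2 hν.1.2) hy
      by_contra hyY
      exact hyf ⟨hcl, by rwa [hYo.interior_eq]⟩
    obtain ⟨hH, hg⟩ := h1 hy hyY
    refine ⟨_, hH, ?_⟩
    rw [hg]
    exact h2 hyY
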